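/- **Setting.** Let $\bar S$ be a compact connected oriented surface of genus $g$ with $k\ge 1$ boundary components, $R\subset\partial\bar S$ a finite set with $r\ge 0$ elements, $4g-4+2k+r>0$, and $S=\bar S\smallsetminus R$. Put $\chi=\chi(\bar S)=2-2g-k$. Let $\mathcal T$ be an ideal triangulation of $S$ (with exactly one vertex on each component of $\partial S$). The quiver $\Gamma_{\mathcal T}$ has one vertex for each pair (face $f$, side of $f$), drawn inside $f$ near the midpoint of the side; its arrows are: for each internal edge, the two opposite arrows joining the two vertices next to that edge (these arrows form the set $A_2$), and for each face, the three arrows of the clockwise $3$-cycle joining its three vertices (these form $A_3$). Put $A=A_2\sqcup A_3$, and write $v^-(a)$, $v^+(a)$ for the start and the end of $a\in A$. For a vertex $v$, lying in the face $f$, let $b(v)$ and $t(v)$ be the endpoints of its side, so that the side goes from $b(v)$ to $t(v)$ in the counterclockwise orientation of $\partial f$. A *framed twisted symplectic local system* on $\Gamma_{\mathcal T}$ consists of $2n$-dimensional real symplectic vector spaces $F_v$, symplectic isomorphisms $g_a\colon F_{v^-(a)}\to F_{v^+(a)}$ whose product along each $2$-cycle in $A_2$ and along each $3$-cycle of a face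 is $-\mathrm{Id}$, and Lagrangians $L^t_v, L^b_v\subset F_v$ such that $g_a(L^t_{v^-(a)})=L^b_{v^+(a)}$ and $g_a(L^b_{v^-(a)})=L^t_{v^+(a)}$ for $a\in A_2$, and $g_a(L^b_{v^-(a)})=L^t_{v^+(a)}$ for $a\in A_3$. Two of them are *equivalent* if they are related by symplectic isomorphisms $F_v\to F'_v$ that commute with the transition maps and respect the Lagrangians. By parallel transport the framing defines a Lagrangian at each boundary component of the universal cover of $S$ (the sign $-\mathrm{Id}$ does not affect Lagrangians). Similarly, a *framed representation* is a homomorphism $\rho\colon\pi_1(S)\to\mathrm{Sp}(2n,\mathbf R)$ together with a $\rho$-equivariant map from the set of boundary components of the universal cover to the Lagrangian Grassmannian. In both cases the object is *maximal* if there is an ideal triangulation of $S$ such that, for each of its triangles, the Maslov index of the triple of Lagrangians at the three vertices, taken in counterclockwise order, is $n$; here the Maslov index of $(L_1,M,L_2)$ is the signature of the quadratic form $\omega(v,w)+\omega(w,x)+\omega(x,v)$ on $L_1\oplus M\oplus L_2$. The space of framed maximal representations is the subspace of maximal classes in the quotient, by $\mathrm{Sp}(2n,\mathbf R)$-conjugation,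 of the space of framed representations. Let $\mathcal S\subset A_3$ be a spanning tree of the graph $\Gamma_{\mathcal T}/A_2$ obtained by collapsing the arrows of $A_2$. Let $\mathcal X^+_{\mathcal S}(\mathcal T,n)$ be the set of tuples $z\in \mathrm{Sym}^+(n,\mathbf R)^{A_2}\times \mathrm O(n)^{A_3}$ such that $z(a)=z(a')$ for each $2$-cycle $\{a,a'\}$ in $A_2$, $z(a_3)z(a_2)z(a_1)=\mathrm{Id}$ for each $3$-cycle $(a_1,a_2,a_3)$ in $A_3$, and $z(a)=\mathrm{Id}$ for all $a\in\mathcal S$. Let $\mathrm{hol}(z)$ be the class of the framed twisted local system with $F_v=\mathbf R^{2n}$, $L^t_v=\mathrm{Span}(e_1,\dots,e_n)$, $L^b_v=\mathrm{Span}(f_1,\dots,f_n)$ (for the standard symplectic basis $(e,f)$) and transition matrices $$G_a(z)=\begin{pmatrix}0&-z(a)^{-1/2}\\ z(a)^{1/2}&0\end{pmatrix}\ (a\in A_2),\qquad G_a(z)=\begin{pmatrix}z(a)&-z(a)\\ z(a)&0\end{pmatrix}\ (a\in A_3).$$ **Theorem.** The map $\mathrm{hol}$ sends $\mathcal X^+_{\mathcal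 S}(\mathcal T,n)$ to, and is onto, the set of equivalence classes of maximal framed twisted symplectic local systems on $\Gamma_{\mathcal T}$. Two tuples $z,z'$ have the same image if and only if there is $u\in\mathrm O(n)$ with $z'(a)=u\,z(a)\,u^{-1}$ for all $a\in A$. Moreover, for every choice of signs on the arrows whose product along each of the above $2$- and $3$-cycles is $-1$ (multiplication by these signs turns twisted local systems on $\Gamma_{\mathcal T}$ into local systems on $S$), $\mathrm{hol}$ induces a homeomorphism from the quotient $\mathcal X^+_{\mathcal S}(\mathcal T,n)/\mathrm O(n)$ onto the space of framed maximal representations of $\pi_1(S)$ into $\mathrm{Sp}(2n,\mathbf R)$. Hence the latter space is homeomorphic to $$\bigl(\mathrm{Sym}^+(n,\mathbf R)^{-3\chi+r}\times \mathrm O(n)^{-\chi+1}\bigr)/\mathrm O(n),$$ where $\mathrm O(n)$ acts by simultaneous conjugation; for $r=0$ this is $\bigl(\mathrm{Sym}^+(n,\mathbf R)^{3|\chi|}\times \mathrm O(n)^{|\chi|+1}\bigr)/\mathrm O(n)$. -/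

import Mathlib

universe u u'

noncomputable section

open CategoryTheory

/-! ### Linear symplectic algebra -/

/-- The symplectic group `Sp(2n, ℝ)`. -/
abbrev Sp (n : ℕ) := Matrix.symplecticGroup (Fin n) ℝ

/-- The orthogonal group `O(n)`. -/
abbrev OO (n : ℕ) := Matrix.orthogonalGroup (Fin n) ℝ

/-- `Sym⁺(n, ℝ)`: positive definite symmetric matrices. -/
abbrev SymPos (n : ℕ) := {A : Matrix (Fin n) (Fin n) ℝ // A.PosDef}

/-- `ℝ²ⁿ`, the first (resp. second) summand of the index set corresponding to the vectors `e_i`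
(resp. `f_i`) of the standard symplectic basis. -/
abbrev R2 (n : ℕ) := Fin n ⊕ Fin n → ℝ

/-- The standard symplectic form `ω(x, y) = ᵗx (0 Id; -Id 0) y` on `ℝ²ⁿ`. -/
def stdForm (n : ℕ) : LinearMap.BilinForm ℝ (R2 n) :=
  Matrix.toBilin' (Matrix.fromBlocks 0 1 (-1) 0)

/-- `L` is a Lagrangian of a `2n`-dimensional symplectic vector space `(F, ω)`. -/
def IsLagrangian {F : Type*} [AddCommGroup F] [Module ℝ F] (ω : LinearMap.BilinForm ℝ F) (n : ℕ)
    (L : Submodule ℝ F) : Prop :=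
  Module.finrank ℝ L = n ∧ ∀ u ∈ L, ∀ v ∈ L, ω u v = 0

/-- The quadratic form `(v, w, x) ↦ ω(v, w) + ω(w, x) + ω(x, v)` on `L₁ ⊕ M ⊕ L₂`. -/
def maslovForm {F : Type*} [AddCommGroup F] [Module ℝ F] (ω : LinearMap.BilinForm ℝ F)
    (L₁ M L₂ : Submodule ℝ F) : QuadraticForm ℝ (L₁ × M × L₂) :=
  let v : L₁ × M × L₂ →ₗ[ℝ] F := L₁.subtype ∘ₗ LinearMap.fst ℝ _ _
  let w : L₁ × M × L₂ →ₗ[ℝ] F := M.subtype ∘ₗ LinearMap.fst ℝ _ _ ∘ₗ LinearMap.snd ℝ _ _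
  let x : L₁ × M × L₂ →ₗ[ℝ] F := L₂.subtype ∘ₗ LinearMap.snd ℝ _ _ ∘ₗ LinearMap.snd ℝ _ _
  LinearMap.BilinMap.toQuadraticMap (ω.compl₁₂ v w + ω.compl₁₂ w x + ω.compl₁₂ x v)

/-- The Maslov index of a triple of Lagrangians: the signature of `maslovForm`. -/
def maslovIndex {F : Type*} [AddCommGroup F] [Module ℝ F] (ω : LinearMap.BilinForm ℝ F)
    (L₁ M L₂ : Submodule ℝ F) : ℤ :=
  (sigPos (maslovForm ω L₁ M L₂) : ℤ) - sigNeg (maslovForm ω L₁ M L₂)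

lemma stdForm_apply {n : ℕ} (x y : R2 n) :
    stdForm n x y = (∑ i, x (Sum.inl i) * y (Sum.inr i)) - ∑ i, x (Sum.inr i) * y (Sum.inl i) := by
  simp only [stdForm, Matrix.toBilin'_apply', dotProduct, Matrix.mulVec, Fintype.sum_sum_type,
    Matrix.fromBlocks_apply₁₁, Matrix.fromBlocks_apply₁₂, Matrix.fromBlocks_apply₂₁,
    Matrix.fromBlocks_apply₂₂]
  simp [Matrix.one_apply, sub_eq_add_neg]

lemma stdForm_isAlt (n : ℕ) : (stdForm n).IsAlt := by
  intro x
  rw [stdForm_apply, sub_eq_zero]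
  exact Finset.sum_congr rfl fun i _ => mul_comm _ _

lemma stdForm_nondegenerate (n : ℕ) : (stdForm n).Nondegenerate := by
  apply Matrix.nondegenerate_toBilin'_iff.mpr
  apply Matrix.nondegenerate_of_det_ne_zero
  have h : (Matrix.fromBlocks 0 1 (-1) 0 : Matrix (Fin n ⊕ Fin n) (Fin n ⊕ Fin n) ℝ)
      = - Matrix.J (Fin n) ℝ := by
    simp [Matrix.J, Matrix.fromBlocks_neg]
  rw [h, ← Matrix.J_transpose, Matrix.det_transpose]
  exact (Matrix.isUnit_det_J _ _).ne_zero

/-- The linear automorphism of `ℝ²ⁿ` given by a symplectic matrix. -/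
def spEquiv {n : ℕ} (g : Sp n) : R2 n ≃ₗ[ℝ] R2 n :=
  LinearEquiv.ofLinearMap (Matrix.toLin' (g : Matrix _ _ ℝ))
    (Matrix.toLin' ((g⁻¹ : Sp n) : Matrix _ _ ℝ))
    (by rw [← Matrix.toLin'_mul, ← Submonoid.coe_mul]; simp)
    (by rw [← Matrix.toLin'_mul, ← Submonoid.coe_mul]; simp)

lemma spEquiv_apply {n : ℕ} (g : Sp n) (x : R2 n) :
    spEquiv g x = Matrix.mulVec (g : Matrix _ _ ℝ) x := rfl

lemma spEquiv_one {n : ℕ} : spEquiv (1 : Sp n) = LinearEquiv.refl ℝ (R2 n) := by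
  ext1 x; simp [spEquiv_apply]

lemma spEquiv_mul {n : ℕ} (g h : Sp n) (x : R2 n) :
    spEquiv (g * h) x = spEquiv g (spEquiv h x) := by
  simp [spEquiv_apply, Matrix.mulVec_mulVec]

lemma stdForm_spEquiv {n : ℕ} (g : Sp n) (x y : R2 n) :
    stdForm n (spEquiv g x) (spEquiv g y) = stdForm n x y := by
  have h : (Matrix.fromBlocks 0 1 (-1) 0 : Matrix (Fin n ⊕ Fin n) (Fin n ⊕ Fin n) ℝ)
      = - Matrix.J (Fin n) ℝ := by
    simp [Matrix.J, Matrix.fromBlocks_neg]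
  have hg : (g : Matrix _ _ ℝ).transpose * Matrix.J (Fin n) ℝ * (g : Matrix _ _ ℝ)
      = Matrix.J (Fin n) ℝ := SymplecticGroup.mem_iff'.mp g.2
  rw [stdForm, Matrix.toBilin'_apply', Matrix.toBilin'_apply', spEquiv_apply, spEquiv_apply,
    Matrix.dotProduct_mulVec, Matrix.vecMul_mulVec, ← Matrix.dotProduct_mulVec,
    Matrix.mulVec_mulVec, h, Matrix.mul_neg, Matrix.neg_mul, hg]

/-- The Lagrangian Grassmannian of `ℝ²ⁿ`. -/
def Lag (n : ℕ) := {L : Submodule ℝ (R2 n) // IsLagrangian (stdForm n) n L}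

instance (n : ℕ) : MulAction (Sp n) (Lag n) where
  smul g L := ⟨L.1.map (spEquiv g).toLinearMap,
    (LinearEquiv.finrank_map_eq (spEquiv g) L.1).trans L.2.1, by
      rintro _ ⟨u, hu, rfl⟩ _ ⟨v, hv, rfl⟩
      exact (stdForm_spEquiv g u v).trans (L.2.2 u hu v hv)⟩
  one_smul L := Subtype.ext (by
    change L.1.map (spEquiv (1 : Sp n)).toLinearMap = L.1
    rw [spEquiv_one]; exact Submodule.map_id L.1)
  mul_smul g h L := Subtype.ext (by
    change L.1.map (spEquiv (g * h)).toLinearMap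
      = (L.1.map (spEquiv h).toLinearMap).map (spEquiv g).toLinearMap
    rw [← Submodule.map_comp]
    congr 1
    exact LinearMap.ext fun x => spEquiv_mul g h x)

/-- `Span(e₁, …, eₙ)`. -/
def stdE (n : ℕ) : Submodule ℝ (R2 n) :=
  Submodule.span ℝ (Set.range fun i : Fin n => (Pi.single (Sum.inl i) 1 : R2 n))

/-- `Span(f₁, …, fₙ)`. -/
def stdF (n : ℕ) : Submodule ℝ (R2 n) :=
  Submodule.span ℝ (Set.range fun i : Fin n => (Pi.single (Sum.inr i) 1 : R2 n))

lemma mem_stdE {n : ℕ} {x : R2 n} : x ∈ stdE n ↔ ∀ i, x (Sum.inr i) = 0 := by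
  constructor
  · intro h i
    induction h using Submodule.span_induction with
    | mem y hy => obtain ⟨j, rfl⟩ := hy; simp
    | zero => rfl
    | add y z _ _ hy hz => simp [hy, hz]
    | smul a y _ hy => simp [hy]
  · intro h
    have hx : x = ∑ i, x (Sum.inl i) • (Pi.single (Sum.inl i) 1 : R2 n) := by
      ext (j | j)
      · simp [Finset.sum_apply, Pi.single_apply]
      · simp [Finset.sum_apply, h j]
    rw [hx]
    exact Submodule.sum_mem _ fun i _ => Submodule.smul_mem _ _ (Submodule.subset_span ⟨i, rfl⟩)

lemma mem_stdF {n : ℕ} {x : R2 n} : x ∈ stdF n ↔ ∀ i, x (Sum.inl i) = 0 := by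
  constructor
  · intro h i
    induction h using Submodule.span_induction with
    | mem y hy => obtain ⟨j, rfl⟩ := hy; simp
    | zero => rfl
    | add y z _ _ hy hz => simp [hy, hz]
    | smul a y _ hy => simp [hy]
  · intro h
    have hx : x = ∑ i, x (Sum.inr i) • (Pi.single (Sum.inr i) 1 : R2 n) := by
      ext (j | j)
      · simp [Finset.sum_apply, h j]
      · simp [Finset.sum_apply, Pi.single_apply]
    rw [hx]
    exact Submodule.sum_mem _ fun i _ => Submodule.smul_mem _ _ (Submodule.subset_span ⟨i, rfl⟩)

lemma stdE_isLagrangian (n : ℕ) : IsLagrangian (stdForm n) n (stdE n) := by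
  constructor
  · have hli : LinearIndependent ℝ fun i : Fin n => (Pi.single (Sum.inl i) 1 : R2 n) := by
      simpa [Function.comp_def] using
        (Pi.basisFun ℝ (Fin n ⊕ Fin n)).linearIndependent.comp Sum.inl Sum.inl_injective
    exact (finrank_span_eq_card hli).trans (Fintype.card_fin n)
  · intro u hu v hv
    rw [mem_stdE] at hu hv
    simp [stdForm_apply, hu, hv]

lemma stdF_isLagrangian (n : ℕ) : IsLagrangian (stdForm n) n (stdF n) := by
  constructor
  · have hli : LinearIndependent ℝ fun i : Fin n => (Pi.single (Sum.inr i) 1 : R2 n) := by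
      simpa [Function.comp_def] using
        (Pi.basisFun ℝ (Fin n ⊕ Fin n)).linearIndependent.comp Sum.inr Sum.inr_injective
    exact (finrank_span_eq_card hli).trans (Fintype.card_fin n)
  · intro u hu v hv
    rw [mem_stdF] at hu hv
    simp [stdForm_apply, hu, hv]

/-- The Lagrangian `L₀ = Span(e₁, …, eₙ)`. -/
def lagE (n : ℕ) : Lag n := ⟨stdE n, stdE_isLagrangian n⟩

/-- The topology of the Lagrangian Grassmannian as a homogeneous space of `Sp(2n, ℝ)` (the action
is transitive): the quotient topology for `g ↦ g • L₀`. -/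
instance (n : ℕ) : TopologicalSpace (Lag n) :=
  TopologicalSpace.coinduced (fun g : Sp n => g • lagE n) inferInstance

open scoped MatrixOrder in
/-- The positive square root of a positive definite symmetric matrix. -/
def symSqrt {n : ℕ} (A : SymPos n) : Matrix (Fin n) (Fin n) ℝ := CFC.sqrt A.1

open scoped MatrixOrder in
lemma symSqrt_mul_self {n : ℕ} (A : SymPos n) : symSqrt A * symSqrt A = A.1 :=
  CFC.sqrt_mul_sqrt_self A.1 A.2.posSemidef.nonneg

open scoped MatrixOrder in
lemma symSqrt_transpose {n : ℕ} (A : SymPos n) : (symSqrt A).transpose = symSqrt A := by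
  have h := (Matrix.nonneg_iff_posSemidef.mp (CFC.sqrt_nonneg A.1)).isHermitian
  simpa [Matrix.IsHermitian, symSqrt] using h

lemma symSqrt_isUnit_det {n : ℕ} (A : SymPos n) : IsUnit (symSqrt A).det := by
  have h := congrArg Matrix.det (symSqrt_mul_self A)
  rw [Matrix.det_mul] at h
  rw [isUnit_iff_ne_zero]
  intro h0
  rw [h0, zero_mul] at h
  exact A.2.det_pos.ne h

/-- The symplectic matrix `(0  -x^{-1/2}; x^{1/2}  0)`. -/
def crossMat {n : ℕ} (A : SymPos n) : Sp n :=
  ⟨Matrix.fromBlocks 0 (-(symSqrt A)⁻¹) (symSqrt A) 0, by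
    rw [SymplecticGroup.mem_iff, Matrix.J, Matrix.fromBlocks_transpose, Matrix.fromBlocks_multiply,
      Matrix.fromBlocks_multiply]
    simp [symSqrt_transpose, Matrix.transpose_nonsing_inv,
      Matrix.nonsing_inv_mul _ (symSqrt_isUnit_det A),
      Matrix.mul_nonsing_inv _ (symSqrt_isUnit_det A)]⟩

/-- The symplectic matrix `(u  -u; u  0)`. -/
def turnMat {n : ℕ} (u : OO n) : Sp n :=
  ⟨Matrix.fromBlocks u.1 (-u.1) u.1 0, by
    have h : u.1 * u.1.transpose = 1 := (Matrix.mem_orthogonalGroup_iff (Fin n) ℝ).mp u.2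
    rw [SymplecticGroup.mem_iff, Matrix.J, Matrix.fromBlocks_transpose, Matrix.fromBlocks_multiply,
      Matrix.fromBlocks_multiply]
    simp [h]⟩

/-! ### Ideal triangulations and the quiver `Γ_T` -/

/-- An ideal triangulation of a connected oriented surface `S = S̄ ∖ R` of finite type: finitely many
oriented triangles, some of whose sides are glued in pairs by orientation reversing maps, the
resulting surface being connected. A *side* is a pair (face, element of `ZMod 3`), the three sides
of a face being numbered in the **clockwise** cyclic order. `glue` exchanges two sides that are
glued together (an internal edge) and fixes a side that is not glued (an external edge). The
vertices of the triangulation correspond to the connected components of `∂S`. A vertex in the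
interior of the glued triangles is a compact component of `∂S` shrunk to a point; a vertex on the
boundary of the glued triangles is a component of `C ∖ R`, with `C` a component of `∂S̄` that meets
`R`, and the external edges join the consecutive components of `C ∖ R`. -/
structure IdealTriangulation where
  Face : Type
  [fintypeFace : Fintype Face]
  [nonemptyFace : Nonempty Face]
  glue : Face × ZMod 3 → Face × ZMod 3
  glue_glue : Function.Involutive glue
  connected : ∀ f f' : Face,
    Relation.EqvGen (fun a b => ∃ i j, glue (a, i) = (b, j)) f f'

namespace IdealTriangulation

attribute [instance] fintypeFace nonemptyFace

variable (T : IdealTriangulation)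

/-- The sides of the triangles, i.e. the vertices of `Γ_T` (the vertex of `Γ_T` is the point inside
the face next to the midpoint of the side). -/
def Side : Type := T.Face × ZMod 3

instance : Fintype T.Side := inferInstanceAs (Fintype (T.Face × ZMod 3))

variable {T} in
/-- The side glued to `v` (or `v` itself if `v` is external). -/
def opp (v : T.Side) : T.Side := T.glue v

variable {T} in
/-- The next side of the same face in clockwise order. -/
def next (v : T.Side) : T.Side := (v.1, v.2 + 1)

lemma opp_opp (v : T.Side) : opp (opp v) = v := T.glue_glue v

lemma next_next_next (v : T.Side) : next (next (next v)) = v := by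
  refine Prod.ext rfl ?_
  change v.2 + 1 + 1 + 1 = v.2
  have h : (1 : ZMod 3) + 1 + 1 = 0 := by decide
  rw [add_assoc, add_assoc, ← add_assoc (1 : ZMod 3), h, add_zero]

/-- `A₂`: arrows crossing an internal edge; the arrow indexed by `v` goes from `v` to `opp v`. -/
abbrev A₂ := {v : T.Side // opp v ≠ v}

/-- `A₃`: arrows inside a face; the arrow indexed by `v` goes from `v` to `next v`. -/
abbrev A₃ := T.Side

/-- The arrows of the quiver `Γ_T`. -/
inductive Arrow : T.Side → T.Side → Type
  | cross {v w : T.Side} (hne : opp v ≠ v) (h : w = opp v) : Arrow v w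
  | turn {v w : T.Side} (h : w = next v) : Arrow v w

instance : Quiver T.Side := ⟨T.Arrow⟩

/-! ### Edges, vertices, Euler characteristic -/

/-- The (nonoriented) edges of the triangulation. -/
def Edge : Type := Quot fun v w : T.Side => w = opp v

/-- The vertices of the triangulation, i.e. the components of `∂S`, presented as the endpoints
`t(v)` of the sides. Viewed from inside the face, going along the side `v` counterclockwise around
the face leads from the endpoint `b(v)` to the endpoint `t(v)`; thus `b(v) = t(next v)`, and crossing
an internal edge exchanges `t` and `b`. -/
def BdryComp : Type := Quot fun v w : T.Side => opp v ≠ v ∧ w = next (opp v)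

/-- The endpoint `t(v)`. -/
def t (v : T.Side) : T.BdryComp := Quot.mk _ v

/-- The endpoint `b(v)`. -/
def b (v : T.Side) : T.BdryComp := T.t (next v)

/-- A component of `∂S` is compact if it is not an endpoint of an external edge. -/
def IsCompactComp (x : T.BdryComp) : Prop := ∀ v : T.Side, opp v = v → T.t v ≠ x ∧ T.b v ≠ x

/-- The number `r` of points of `R`, which is the number of external edges. -/
def r : ℕ := Nat.card {v : T.Side // opp v = v}

/-- The Euler characteristic of `S̄`: the surface obtained by gluing the triangles has Euler
characteristic `#vertices - #edges + #faces`, and `S̄` is obtained from it by removing an open disk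
around every vertex that stands for a compact component of `∂S`. -/
def eulerChar : ℤ :=
  (Nat.card T.BdryComp : ℤ) - Nat.card T.Edge + Nat.card T.Face
    - Nat.card {x : T.BdryComp // T.IsCompactComp x}

/-! ### Spanning trees -/

/-- The set `S` of arrows of `A₃` connects all the vertices of the graph `Γ_T / A₂`. -/
def Connects (S : Set T.A₃) : Prop :=
  ∀ v w : T.Side, Relation.EqvGen (fun x y => y = opp x ∨ (x ∈ S ∧ y = next x)) v w

/-- `S` is a spanning tree of `Γ_T / A₂`: a minimal set of edges connecting all the vertices. -/
def IsSpanningTree (S : Set T.A₃) : Prop :=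
  T.Connects S ∧ ∀ a ∈ S, ¬ T.Connects (S \ {a})

/-! ### The fundamental group, the universal cover, and triangulations of `S` -/

/-- The elementary homotopies between paths of `Γ_T` in `S`: the 2-cycles around an edge and the
3-cycles in a face bound disks. -/
inductive Homotopy : HomRel (Paths T.Side)
  | two {v w : T.Side} (hv : opp v ≠ v) (h : w = opp v) (hw : opp w ≠ w) (h' : v = opp w) :
      Homotopy
        ((Paths.of T.Side).map (Arrow.cross hv h) ≫ (Paths.of T.Side).map (Arrow.cross hw h'))
        (𝟙 ((Paths.of T.Side).obj v))
  | three {u v w : T.Side} (h₁ : v = next u) (h₂ : w = next v) (h₃ : u = next w) :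
      Homotopy
        ((Paths.of T.Side).map (Arrow.turn h₁) ≫ (Paths.of T.Side).map (Arrow.turn h₂) ≫
          (Paths.of T.Side).map (Arrow.turn h₃))
        (𝟙 ((Paths.of T.Side).obj u))

/-- The fundamental groupoid of `S` restricted to the vertices of `Γ_T`: paths in `Γ_T` up to
homotopy in `S`. -/
abbrev FundGpd := CategoryTheory.Quotient T.Homotopy

variable {T}

/-- A vertex of `Γ_T` as an object of the fundamental groupoid. -/
def pt (v : T.Side) : T.FundGpd := (CategoryTheory.Quotient.functor T.Homotopy).obj ((Paths.of T.Side).obj v)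

/-- The homotopy class of a path in `Γ_T`. -/
def hc {v w : T.Side} (p : Quiver.Path v w) : pt v ⟶ pt w :=
  (CategoryTheory.Quotient.functor T.Homotopy).map (X := (Paths.of T.Side).obj v) (Y := (Paths.of T.Side).obj w) p

/-- The fundamental group `π₁(S, v₀)`; the product `α * γ` is the class of `γ` followed by `α`. -/
abbrev π₁ (v₀ : T.Side) := Aut (pt v₀)

/-- The lifts of the vertices of `Γ_T` to the universal cover of `S`: homotopy classes of paths
starting at the base point. -/
abbrev Lift (v₀ : T.Side) := Σ v : T.Side, (pt v₀ ⟶ pt v)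

/-- The set of components of `∂S̃`, for `S̃` the universal cover, i.e. the vertices of the lifted
triangulation, presented (as in `BdryComp`) as the endpoints `t` of the lifted sides. -/
def BdryCover (v₀ : T.Side) : Type :=
  Quot fun x y : Lift v₀ => ∃ (hne : opp x.1 ≠ x.1) (h : y.1 = next (opp x.1)),
    y.2 = x.2 ≫ hc (Quiver.Hom.toPath (Arrow.cross hne rfl)) ≫
      hc (Quiver.Hom.toPath (Arrow.turn h))

/-- The endpoint `t` of a lifted side. -/
def tCover {v₀ v : T.Side} (p : pt v₀ ⟶ pt v) : BdryCover v₀ := Quot.mk _ ⟨v, p⟩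

/-- The right action of the fundamental group on the components of `∂S̃`. -/
def act {v₀ : T.Side} (x : BdryCover v₀) (γ : π₁ v₀) : BdryCover v₀ :=
  Quot.map (fun p : Lift v₀ => (⟨p.1, γ.hom ≫ p.2⟩ : Lift v₀))
    (by rintro ⟨v, p⟩ ⟨w, q⟩ ⟨hne, h, e⟩; exact ⟨hne, h, by simp at e; simp [e]⟩) x

/-- The triangles of the lift of the triangulation `T` to the universal cover, as triples of
components of `∂S̃` in counterclockwise order. -/
def liftedTriangles (v₀ : T.Side) : Set (BdryCover v₀ × BdryCover v₀ × BdryCover v₀) :=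
  {s | ∃ (u v w : T.Side) (h₁ : v = next u) (h₂ : w = next v) (p : pt v₀ ⟶ pt u),
    s = (tCover p,
      tCover (p ≫ hc (Quiver.Hom.toPath (Arrow.turn h₁)) ≫ hc (Quiver.Hom.toPath (Arrow.turn h₂))),
      tCover (p ≫ hc (Quiver.Hom.toPath (Arrow.turn h₁))))}

/-- The orbit of a triangle `(x, y, z)` of the universal cover under the fundamental group and the
cyclic permutations of the vertices. -/
def triOrbit {v₀ : T.Side} (x y z : BdryCover v₀) :
    Set (BdryCover v₀ × BdryCover v₀ × BdryCover v₀) :=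
  {s | ∃ γ : π₁ v₀, s = (act x γ, act y γ, act z γ) ∨ s = (act y γ, act z γ, act x γ) ∨
    s = (act z γ, act x γ, act y γ)}

/-- Flips, for (lifts to the universal cover of) triangulations of `S`: in a quadrilateral with
vertices `x, y, z, w` in counterclockwise order, made up of two distinct faces of the triangulation
with common edge `xz`, the diagonal `xz` is replaced by the diagonal `yw`. -/
def Flip {v₀ : T.Side} (𝒯 𝒯' : Set (BdryCover v₀ × BdryCover v₀ × BdryCover v₀)) : Prop :=
  ∃ x y z w : BdryCover v₀, (x, y, z) ∈ 𝒯 ∧ (x, z, w) ∈ 𝒯 ∧ (x, z, w) ∉ triOrbit x y z ∧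
    𝒯' = (𝒯 \ (triOrbit x y z ∪ triOrbit x z w)) ∪ (triOrbit x y w ∪ triOrbit y z w)

/-- The ideal triangulations of the surface `S` underlying `T`: those that are obtained from `T` by
a finite sequence of flips. -/
def IsTriangulation {v₀ : T.Side} (𝒯 : Set (BdryCover v₀ × BdryCover v₀ × BdryCover v₀)) : Prop :=
  Relation.ReflTransGen Flip (liftedTriangles v₀) 𝒯

end IdealTriangulation

open IdealTriangulation

/-! ### Framed representations of the fundamental group -/

/-- A framed symplectic representation of `π₁(S)`: a representation `ρ` together with a
`ρ`-equivariant map from the set of components of `∂S̃` to the Lagrangian Grassmannian. -/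
structure FramedRep {T : IdealTriangulation} (v₀ : T.Side) (n : ℕ) where
  ρ : π₁ v₀ →* Sp n
  ξ : BdryCover v₀ → Lag n
  equivariant : ∀ (γ : π₁ v₀) (x : BdryCover v₀), ξ (act x γ⁻¹) = ρ γ • ξ x

namespace FramedRep

variable {T : IdealTriangulation} {v₀ : T.Side} {n : ℕ}

instance : TopologicalSpace (FramedRep v₀ n) :=
  TopologicalSpace.induced (fun h => ((fun γ => h.ρ γ : π₁ v₀ → Sp n), h.ξ)) inferInstance

/-- Conjugation by the symplectic group. -/
instance setoid : Setoid (FramedRep v₀ n) where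
  r h h' := ∃ g : Sp n, (∀ γ, h'.ρ γ = g * h.ρ γ * g⁻¹) ∧ ∀ x, h'.ξ x = g • h.ξ x
  iseqv :=
    { refl := fun _ => ⟨1, by simp, by simp⟩
      symm := by
        rintro h h' ⟨g, h₁, h₂⟩
        exact ⟨g⁻¹, fun γ => by rw [h₁]; group, fun x => by rw [h₂, inv_smul_smul]⟩
      trans := by
        rintro h h' h'' ⟨g, h₁, h₂⟩ ⟨g', h₁', h₂'⟩
        exact ⟨g' * g, fun γ => by rw [h₁', h₁]; group, fun x => by rw [h₂', h₂, mul_smul]⟩ }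

/-- A framed representation is maximal if there is a triangulation of `S` all of whose triangles
have Maslov index `n`. -/
def IsMaximal (h : FramedRep v₀ n) : Prop :=
  ∃ 𝒯 : Set (BdryCover v₀ × BdryCover v₀ × BdryCover v₀), IsTriangulation 𝒯 ∧
    ∀ x y z, (x, y, z) ∈ 𝒯 → maslovIndex (stdForm n) (h.ξ x).1 (h.ξ y).1 (h.ξ z).1 = n

end FramedRep

/-- The moduli space of framed symplectic representations, with the quotient topology. -/
abbrev RepF {T : IdealTriangulation} (v₀ : T.Side) (n : ℕ) :=
  _root_.Quotient (FramedRep.setoid (v₀ := v₀) (n := n))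

/-- The space of framed maximal representations (up to conjugation). -/
abbrev MaxRepF {T : IdealTriangulation} (v₀ : T.Side) (n : ℕ) :=
  {c : RepF v₀ n // ∃ h : FramedRep v₀ n, h.IsMaximal ∧ c = ⟦h⟧}

/-! ### Framed twisted local systems on the quiver `Γ_T` -/

/-- Framed `δ`-twisted symplectic local systems (of rank `2n`) on the quiver `Γ_T`. -/
structure FramedLocSys (T : IdealTriangulation) (n : ℕ) where
  F : T.Side → Type u
  [addCommGroup : ∀ v, AddCommGroup (F v)]
  [module : ∀ v, Module ℝ (F v)]
  [finiteDimensional : ∀ v, FiniteDimensional ℝ (F v)]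
  finrank_eq : ∀ v, Module.finrank ℝ (F v) = 2 * n
  ω : ∀ v, LinearMap.BilinForm ℝ (F v)
  isAlt : ∀ v, (ω v).IsAlt
  nondegenerate : ∀ v, (ω v).Nondegenerate
  g : ∀ {v w : T.Side}, (v ⟶ w) → (F v ≃ₗ[ℝ] F w)
  symplectic : ∀ {v w : T.Side} (a : v ⟶ w) (x y : F v), ω w (g a x) (g a y) = ω v x y
  twisted_two : ∀ {v w : T.Side} (hv : opp v ≠ v) (h : w = opp v) (hw : opp w ≠ w) (h' : v = opp w)
    (x : F v), g (Arrow.cross hw h') (g (Arrow.cross hv h) x) = -x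
  twisted_three : ∀ {u v w : T.Side} (h₁ : v = next u) (h₂ : w = next v) (h₃ : u = next w)
    (x : F u), g (Arrow.turn h₃) (g (Arrow.turn h₂) (g (Arrow.turn h₁) x)) = -x
  Lt : ∀ v, Submodule ℝ (F v)
  Lb : ∀ v, Submodule ℝ (F v)
  lt_lagrangian : ∀ v, IsLagrangian (ω v) n (Lt v)
  lb_lagrangian : ∀ v, IsLagrangian (ω v) n (Lb v)
  cross_lt : ∀ {v w : T.Side} (hv : opp v ≠ v) (h : w = opp v),
    (Lt v).map (g (Arrow.cross hv h)).toLinearMap = Lb w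
  cross_lb : ∀ {v w : T.Side} (hv : opp v ≠ v) (h : w = opp v),
    (Lb v).map (g (Arrow.cross hv h)).toLinearMap = Lt w
  turn_lb : ∀ {v w : T.Side} (h : w = next v),
    (Lb v).map (g (Arrow.turn h)).toLinearMap = Lt w

namespace FramedLocSys

attribute [instance] addCommGroup module finiteDimensional

variable {T : IdealTriangulation} {n : ℕ}

/-- Equivalence of framed twisted symplectic local systems. -/
def Equivalent (X : FramedLocSys.{u} T n) (Y : FramedLocSys.{u'} T n) : Prop :=
  ∃ ψ : ∀ v, X.F v ≃ₗ[ℝ] Y.F v,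
    (∀ v x y, Y.ω v (ψ v x) (ψ v y) = X.ω v x y) ∧
    (∀ (v w : T.Side) (a : v ⟶ w) (x : X.F v), Y.g a (ψ v x) = ψ w (X.g a x)) ∧
    ∀ v, (X.Lt v).map (ψ v).toLinearMap = Y.Lt v ∧ (X.Lb v).map (ψ v).toLinearMap = Y.Lb v

/-- The parallel transport along a path of `Γ_T`. -/
def transport (X : FramedLocSys.{u} T n) {v : T.Side} :
    ∀ {w : T.Side}, Quiver.Path v w → (X.F v ≃ₗ[ℝ] X.F w)
  | _, Quiver.Path.nil => LinearEquiv.refl ℝ _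
  | _, Quiver.Path.cons p a => (X.transport p).trans (X.g a)

/-- The Lagrangian of the fibre at the start of the path `p` obtained from the framing at the end of
`p` by parallel transport. It depends only on the component of `∂S̃` defined by `p`. -/
def lag (X : FramedLocSys.{u} T n) {v w : T.Side} (p : Quiver.Path v w) : Submodule ℝ (X.F v) :=
  (X.Lt w).comap (X.transport p).toLinearMap

/-- A framed twisted local system is maximal if there is a triangulation of `S` all of whose
triangles have Maslov index `n` (computed in the fibre at the base point `v₀`). -/
def IsMaximal (X : FramedLocSys.{u} T n) (v₀ : T.Side) : Prop :=
  ∃ 𝒯 : Set (BdryCover v₀ × BdryCover v₀ × BdryCover v₀), IsTriangulation 𝒯 ∧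
    ∀ {v₁ v₂ v₃ : T.Side} (p₁ : Quiver.Path v₀ v₁) (p₂ : Quiver.Path v₀ v₂)
      (p₃ : Quiver.Path v₀ v₃), (tCover (hc p₁), tCover (hc p₂), tCover (hc p₃)) ∈ 𝒯 →
      maslovIndex (X.ω v₀) (X.lag p₁) (X.lag p₂) (X.lag p₃) = n

end FramedLocSys

/-! ### Coordinates and holonomy -/

/-- Two families of matrices in `Sym⁺(n, ℝ)^I × O(n)^K` are equivalent if they are conjugate by an
element of `O(n)` (acting diagonally). -/
def conjSetoid (I K : Type) (n : ℕ) : Setoid ((I → SymPos n) × (K → OO n)) where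
  r z z' := ∃ u : OO n, (∀ i, (z'.1 i).1 = u.1 * (z.1 i).1 * (u⁻¹ : OO n).1) ∧
    ∀ k, z'.2 k = u * z.2 k * u⁻¹
  iseqv :=
    { refl := fun _ => ⟨1, by simp, by simp⟩
      symm := by
        rintro z z' ⟨u, h₁, h₂⟩
        refine ⟨u⁻¹, fun i => ?_, fun k => by rw [h₂]; group⟩
        have h : (u⁻¹ : OO n).1 * u.1 = 1 := by rw [← Submonoid.coe_mul]; simp
        rw [h₁, inv_inv]
        simp only [mul_assoc, h, mul_one]
        rw [← mul_assoc, h, one_mul]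
      trans := by
        rintro z z' z'' ⟨u, h₁, h₂⟩ ⟨w, h₁', h₂'⟩
        refine ⟨w * u, fun i => ?_, fun k => by rw [h₂', h₂]; group⟩
        rw [h₁', h₁, mul_inv_rev]
        simp only [Submonoid.coe_mul, mul_assoc] }

/-- The space `𝒳⁺(T, n)` of coordinates. -/
def Coord (T : IdealTriangulation) (n : ℕ) : Set ((T.A₂ → SymPos n) × (T.A₃ → OO n)) :=
  {x | (∀ v w : T.A₂, w.1 = opp v.1 → x.1 w = x.1 v) ∧
    ∀ v : T.A₃, x.2 (next (next v)) * x.2 (next v) * x.2 v = 1}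

/-- The space `𝒳⁺_S(T, n)` of coordinates that are trivial on the set `S` of arrows. -/
def CoordS (T : IdealTriangulation) (n : ℕ) (S : Set T.A₃) :
    Set ((T.A₂ → SymPos n) × (T.A₃ → OO n)) :=
  {x | x ∈ Coord T n ∧ ∀ a ∈ S, x.2 a = 1}

/-- The quotient of `𝒳⁺_S(T, n)` by the diagonal conjugation action of `O(n)`. -/
def coordSSetoid (T : IdealTriangulation) (n : ℕ) (S : Set T.A₃) : Setoid (CoordS T n S) :=
  (conjSetoid T.A₂ T.A₃ n).comap Subtype.val

/-- The transition matrices `G_a(x)`. -/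
def transMat {T : IdealTriangulation} {n : ℕ} (x : (T.A₂ → SymPos n) × (T.A₃ → OO n)) :
    ∀ {v w : T.Side}, T.Arrow v w → Sp n
  | v, _, Arrow.cross hne _ => crossMat (x.1 ⟨v, hne⟩)
  | v, _, Arrow.turn _ => turnMat (x.2 v)

lemma finrank_R2 (n : ℕ) : Module.finrank ℝ (R2 n) = 2 * n := by
  simp [two_mul]

lemma map_eq_of_le {n : ℕ} (g : Sp n) {L L' : Submodule ℝ (R2 n)}
    (hL : IsLagrangian (stdForm n) n L) (hL' : IsLagrangian (stdForm n) n L')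
    (h : ∀ x ∈ L, spEquiv g x ∈ L') : L.map (spEquiv g).toLinearMap = L' := by
  apply Submodule.eq_of_le_of_finrank_eq
  · rintro _ ⟨x, hx, rfl⟩
    exact h x hx
  · exact ((LinearEquiv.finrank_map_eq (spEquiv g) L).trans hL.1).trans hL'.1.symm

lemma crossMat_mul_self {n : ℕ} (A : SymPos n) (x : R2 n) :
    spEquiv (crossMat A) (spEquiv (crossMat A) x) = -x := by
  rw [← spEquiv_mul, spEquiv_apply]
  have h : (crossMat A * crossMat A).1 = -1 := by
    rw [Submonoid.coe_mul, crossMat, Matrix.fromBlocks_multiply]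
    simp [Matrix.nonsing_inv_mul _ (symSqrt_isUnit_det A),
      Matrix.mul_nonsing_inv _ (symSqrt_isUnit_det A), ← Matrix.fromBlocks_one,
      Matrix.fromBlocks_neg]
  rw [h, Matrix.neg_mulVec, Matrix.one_mulVec]

lemma turnMat_mul {n : ℕ} (a b c : OO n) (h : c * b * a = 1) (x : R2 n) :
    spEquiv (turnMat c) (spEquiv (turnMat b) (spEquiv (turnMat a) x)) = -x := by
  rw [← spEquiv_mul, ← spEquiv_mul, spEquiv_apply]
  have h' : c.1 * (b.1 * a.1) = 1 := by
    rw [← mul_assoc, ← Submonoid.coe_mul, ← Submonoid.coe_mul, h]; rfl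
  have h : (turnMat c * (turnMat b * turnMat a)).1 = -1 := by
    rw [Submonoid.coe_mul, Submonoid.coe_mul, turnMat, turnMat, turnMat,
      Matrix.fromBlocks_multiply, Matrix.fromBlocks_multiply]
    simp [h', ← Matrix.fromBlocks_one, Matrix.fromBlocks_neg]
  rw [mul_assoc, h, Matrix.neg_mulVec, Matrix.one_mulVec]

/-- The framed twisted local system `hol(x)` defined by the coordinates `x`: all the fibres are
`ℝ²ⁿ` with the framing `(Span(e), Span(f))` and the transition maps are given by the `G_a(x)`. -/
def hol {T : IdealTriangulation} {n : ℕ} (x : (T.A₂ → SymPos n) × (T.A₃ → OO n))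
    (hx : x ∈ Coord T n) : FramedLocSys.{0} T n where
  F _ := R2 n
  finrank_eq _ := finrank_R2 n
  ω _ := stdForm n
  isAlt _ := stdForm_isAlt n
  nondegenerate _ := stdForm_nondegenerate n
  g a := spEquiv (transMat x a)
  symplectic a := stdForm_spEquiv (transMat x a)
  twisted_two {v w} hv h hw h' y := by
    have e : x.1 ⟨w, hw⟩ = x.1 ⟨v, hv⟩ := hx.1 ⟨v, hv⟩ ⟨w, hw⟩ h
    simp only [transMat, e]
    exact crossMat_mul_self _ y
  twisted_three {u v w} h₁ h₂ h₃ y := by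
    subst h₁ h₂
    exact turnMat_mul _ _ _ (hx.2 u) y
  Lt _ := stdE n
  Lb _ := stdF n
  lt_lagrangian _ := stdE_isLagrangian n
  lb_lagrangian _ := stdF_isLagrangian n
  cross_lt {v w} hv h := by
    refine map_eq_of_le _ (stdE_isLagrangian n) (stdF_isLagrangian n) fun y hy => ?_
    rw [mem_stdE] at hy
    rw [mem_stdF, spEquiv_apply]
    intro i
    simp [transMat, crossMat, Matrix.mulVec, dotProduct, hy]
  cross_lb {v w} hv h := by
    refine map_eq_of_le _ (stdF_isLagrangian n) (stdE_isLagrangian n) fun y hy => ?_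
    rw [mem_stdF] at hy
    rw [mem_stdE, spEquiv_apply]
    intro i
    simp [transMat, crossMat, Matrix.mulVec, dotProduct, hy]
  turn_lb {v w} h := by
    refine map_eq_of_le _ (stdF_isLagrangian n) (stdE_isLagrangian n) fun y hy => ?_
    rw [mem_stdF] at hy
    rw [mem_stdE, spEquiv_apply]
    intro i
    simp [transMat, turnMat, Matrix.mulVec, dotProduct, hy]

/-- The product of the transition matrices `G_a(x)` along a path of `Γ_T`. -/
def pathMat {T : IdealTriangulation} {n : ℕ} (x : (T.A₂ → SymPos n) × (T.A₃ → OO n))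
    {v : T.Side} : ∀ {w : T.Side}, Quiver.Path v w → Sp n
  | _, Quiver.Path.nil => 1
  | _, Quiver.Path.cons p a => transMat x a * pathMat x p

/-- Signs on the arrows of `Γ_T` whose product along each 2-cycle and each 3-cycle is `-1`; changing
the transition maps by these signs turns twisted local systems into local systems on `S` (a
nonvanishing vector field on `S` gives such signs). -/
structure Untwisting (T : IdealTriangulation) where
  ε : ∀ {v w : T.Side}, (v ⟶ w) → ℤˣ
  two : ∀ {v w : T.Side} (hv : opp v ≠ v) (h : w = opp v) (hw : opp w ≠ w) (h' : v = opp w),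
    ε (Arrow.cross hw h') * ε (Arrow.cross hv h) = -1
  three : ∀ {u v w : T.Side} (h₁ : v = next u) (h₂ : w = next v) (h₃ : u = next w),
    ε (Arrow.turn h₃) * ε (Arrow.turn h₂) * ε (Arrow.turn h₁) = -1

/-- The product of the signs along a path. -/
def Untwisting.pathSign {T : IdealTriangulation} (E : Untwisting T) {v : T.Side} :
    ∀ {w : T.Side}, Quiver.Path v w → ℤˣ
  | _, Quiver.Path.nil => 1
  | _, Quiver.Path.cons p a => E.ε a * E.pathSign p

/-- `h` is the framed representation given by the parallel transport and the framing of the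
(untwisted by `E`) framed local system `hol(x)`. -/
def IsHolonomyRep {T : IdealTriangulation} {n : ℕ} {v₀ : T.Side} (E : Untwisting T)
    (x : (T.A₂ → SymPos n) × (T.A₃ → OO n)) (h : FramedRep v₀ n) : Prop :=
  (∀ (p : Quiver.Path v₀ v₀) (γ : π₁ v₀), γ.hom = hc p →
    (h.ρ γ).1 = (((E.pathSign p : ℤˣ) : ℤ) : ℝ) • (pathMat x p).1) ∧
  ∀ {v : T.Side} (p : Quiver.Path v₀ v), h.ξ (tCover (hc p)) = (pathMat x p)⁻¹ • lagE n

end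

noncomputable section

open CategoryTheory

open IdealTriangulation

/-! ### Positive triples of Lagrangians -/

/-! The proof is a reduction to normal form. A triple of Lagrangians `(L₁, M, L₂)` has Maslov index
`n` exactly when it is positive (`maslovIndex_eq_iff`): `L₁` and `L₂` are transverse and `a + c ↦
ω(a, c)` is positive definite on `M`. An orthonormal basis of `M` for this form yields a symplectic
basis in which the triple is `(Span(e), Span(e + f), Span(f))` (`PosTriple.exists_frame`), and the
stabilizer of this standard triple is `O(n)`, embedded diagonally (`exists_eq_diagO`). Positivity of
the two triangles of a quadrilateral passes from one diagonal to the other (`PosTriple.flip`), so an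
object that is maximal for some triangulation is maximal on the faces of the given one
(`IsTriangulation.maslovIndex_liftedTriangles`).

Hence a maximal local system has, at each vertex of the quiver, a frame that is unique up to `O(n)`.
In such frames an arrow inside a face permutes the standard triple cyclically, so it is `turnMat u`
with `u` orthogonal. An arrow across an edge exchanges `Span(e)` and `Span(f)`, so it is determined
by its invertible lower left block. The polar decomposition of this block uses up the gauge freedom
on one side of the edge and makes the block symmetric positive definite; what remains is one copy of
`O(n)` for each edge. Normalizing along the spanning tree removes all of these but one
(`TransFamily.exists_coord`), and the last one acts by simultaneous conjugation
(`exists_conj_of_intertwine`). This gives surjectivity and the fibres of the holonomy.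

For representations, signs on the arrows make the transport a functor on the fundamental groupoid,
and the same normalization is carried out in families. Frames can be chosen continuously near any
point (`exists_continuous_frame`), the square root of a positive matrix is continuous
(`continuous_symSqrt`), and the projection to conjugacy classes is open, so the inverse of the
holonomy is continuous (`exists_homeomorph_maxRepF`). The final description comes from solving the
relation of each face for one arrow outside the tree, and from counting with the Euler
characteristic. -/

theorem exists_orthonormal_basis {M : Type*} [AddCommGroup M] [Module ℝ M] [FiniteDimensional ℝ M]
    {n : ℕ} (hn : Module.finrank ℝ M = n) (B : LinearMap.BilinForm ℝ M)
    (hs : ∀ x y, B x y = B y x) (hp : ∀ x, x ≠ 0 → 0 < B x x) :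
    ∃ b : Module.Basis (Fin n) ℝ M, ∀ i j, B (b i) (b j) = if i = j then 1 else 0 := by
  let c : InnerProductSpace.Core ℝ M :=
    { inner := fun x y => B x y
      conj_inner_symm := fun x y => hs y x
      re_inner_nonneg := fun x => by
        by_cases h : x = 0
        · simp [h]
        · exact (hp x h).le
      add_left := by simp
      smul_left := by simp
      definite := fun x h => by
        by_contra h0
        exact (hp x h0).ne' h }
  let _ : NormedAddCommGroup M := c.toNormedAddCommGroup
  let _ : InnerProductSpace ℝ M := InnerProductSpace.ofCore c.toCore
  let b := (stdOrthonormalBasis ℝ M).reindex (finCongr hn)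
  refine ⟨b.toBasis, fun i j => ?_⟩
  have := orthonormal_iff_ite.mp b.orthonormal i j
  simp only [OrthonormalBasis.coe_toBasis]
  exact this

section PosTriple

variable {F : Type*} [AddCommGroup F] [Module ℝ F]

/-- `(L₁, M, L₂)` is a positive triple: `L₁` and `L₂` are transverse, and the quadratic form
`a + c ↦ ω(a, c)` (`a ∈ L₁`, `c ∈ L₂`) is positive definite on `M`. -/
def PosTriple (ω : LinearMap.BilinForm ℝ F) (L₁ M L₂ : Submodule ℝ F) : Prop :=
  (∀ a ∈ L₁, a ∈ L₂ → a = 0) ∧ ∀ a ∈ L₁, ∀ c ∈ L₂, a + c ∈ M → a + c ≠ 0 → 0 < ω a c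

lemma maslovForm_apply (ω : LinearMap.BilinForm ℝ F) (L₁ M L₂ : Submodule ℝ F)
    (y : L₁ × M × L₂) : maslovForm ω L₁ M L₂ y
      = ω (y.1 : F) (y.2.1 : F) + ω (y.2.1 : F) (y.2.2 : F) + ω (y.2.2 : F) (y.1 : F) := rfl

/-- A symplectic isomorphism preserves the Maslov index. -/
lemma maslovIndex_map {F' : Type*} [AddCommGroup F'] [Module ℝ F']
    {ω : LinearMap.BilinForm ℝ F} {ω' : LinearMap.BilinForm ℝ F'} (ψ : F ≃ₗ[ℝ] F')
    (hψ : ∀ x y, ω' (ψ x) (ψ y) = ω x y) (L₁ M L₂ : Submodule ℝ F) :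
    maslovIndex ω' (L₁.map ψ.toLinearMap) (M.map ψ.toLinearMap) (L₂.map ψ.toLinearMap)
      = maslovIndex ω L₁ M L₂ := by
  have e : QuadraticMap.Equivalent (maslovForm ω L₁ M L₂)
      (maslovForm ω' (L₁.map ψ.toLinearMap) (M.map ψ.toLinearMap) (L₂.map ψ.toLinearMap)) :=
    ⟨{ toLinearEquiv := (ψ.submoduleMap L₁).prodCongr
          ((ψ.submoduleMap M).prodCongr (ψ.submoduleMap L₂))
       map_app' := fun y => by
          rw [maslovForm_apply, maslovForm_apply]
          exact congrArg₂ _ (congrArg₂ _ (hψ _ _) (hψ _ _)) (hψ _ _) }⟩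
  unfold maslovIndex
  rw [e.sigPos_eq, e.sigNeg_eq]

variable {n : ℕ} {ω : LinearMap.BilinForm ℝ F}

/-- A common vector has component `0` along `L₂`, so the form takes the value `0` on it. With
`PosTriple.disjoint_right`, the three subspaces of a positive triple are pairwise transverse. -/
lemma PosTriple.disjoint_left {L₁ M L₂ : Submodule ℝ F} (h : PosTriple ω L₁ M L₂) :
    ∀ a ∈ L₁, a ∈ M → a = 0 := by
  intro a h₁ h₂
  by_contra h0
  have := h.2 a h₁ 0 L₂.zero_mem (by simpa using h₂) (by simpa using h0)
  simp at this

lemma PosTriple.disjoint_right {L₁ M L₂ : Submodule ℝ F} (h : PosTriple ω L₁ M L₂) :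
    ∀ a ∈ M, a ∈ L₂ → a = 0 := by
  intro a h₁ h₂
  by_contra h0
  have := h.2 0 L₁.zero_mem a h₂ (by simpa using h₁) (by simpa using h0)
  simp at this

/-- The polar form pairs `(v, w, x)` with the three summands through `ω(·, w - x)` on `L₁`, `ω(·, x
- v)` on `M` and `ω(·, v - w)` on `L₂`. These vanish under the hypotheses because each subspace is
isotropic. -/
lemma mem_radical_maslovForm_of_mem {L₁ M L₂ : Submodule ℝ F} (hω : ω.IsAlt)
    (h₁ : IsLagrangian ω n L₁) (hM : IsLagrangian ω n M) (h₂ : IsLagrangian ω n L₂)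
    {y : L₁ × M × L₂} (e₁ : (y.2.1 : F) - y.2.2 ∈ L₁) (e₂ : (y.2.2 : F) - y.1 ∈ M)
    (e₃ : (y.1 : F) - y.2.1 ∈ L₂) : y ∈ (maslovForm ω L₁ M L₂).radical := by
  have hs : ∀ a b, ω a b = - ω b a := fun a b => (hω.neg_eq b a).symm
  obtain ⟨⟨v, hv⟩, ⟨w, hw⟩, ⟨x, hx⟩⟩ := y
  simp only at e₁ e₂ e₃
  have key : ∀ v' ∈ L₁, ∀ w' ∈ M, ∀ x' ∈ L₂, ω (v + v') (w + w') + ω (w + w') (x + x')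
      + ω (x + x') (v + v') = ω v' w' + ω w' x' + ω x' v' := by
    intro v' hv' w' hw' x' hx'
    have a₁ := h₁.2 _ hv' _ e₁
    have a₂ := hM.2 _ hw' _ e₂
    have a₃ := h₂.2 _ hx' _ e₃
    have b₁ := h₁.2 _ hv _ e₁
    have b₂ := h₂.2 _ hx _ e₃
    have b₃ := hM.2 _ hw _ e₂
    simp only [map_add, map_sub, LinearMap.add_apply] at *
    have s₁ := hs v w'
    have s₂ := hs w x'
    have s₃ := hs x v'
    have s₄ := hs x v
    have s₅ := hs w v
    have s₆ := hs w x
    linarith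
  rw [QuadraticMap.mem_radical_iff']
  refine ⟨?_, ?_⟩
  · have := key 0 L₁.zero_mem 0 M.zero_mem 0 L₂.zero_mem
    simpa [maslovForm_apply] using this
  · rintro ⟨⟨v', hv'⟩, ⟨w', hw'⟩, ⟨x', hx'⟩⟩
    exact key v' hv' w' hw' x' hx'

/-- Positivity is invariant under cyclic permutations. -/
lemma PosTriple.cyclic (hω : ω.IsAlt) {x y z : Submodule ℝ F}
    (h : PosTriple ω x y z) : PosTriple ω y z x := by
  refine ⟨fun a ha ha' => h.disjoint_left a ha' ha, fun a ha c hc hac h0 => ?_⟩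
  have hca := hω.neg_eq c a
  -- The vector `a` of `y` is decomposed as `-c + (a + c)` along `x` and `z`; moreover `ω(-c, a + c)
  -- = ω(a, c)`.
  have e := h.2 (-c) (x.neg_mem hc) (a + c) hac (by simpa using ha) (by
    intro h1
    have ha0 : a = 0 := by simpa using h1
    subst ha0
    rw [zero_add] at hac h0
    exact h0 (h.1 c hc hac))
  simp only [map_neg, map_add, LinearMap.neg_apply, hω.self_eq_zero] at e
  linarith

variable [FiniteDimensional ℝ F]

/-- A Lagrangian is its own orthogonal. -/
lemma IsLagrangian.mem_of_orthogonal (hn : Module.finrank ℝ F = 2 * n) (hω : ω.Nondegenerate)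
    {L : Submodule ℝ F} (hL : IsLagrangian ω n L) {y : F} (h : ∀ x ∈ L, ω x y = 0) : y ∈ L := by
  have e : L = ω.orthogonal L := by
    apply Submodule.eq_of_le_of_finrank_eq
    · intro x hx
      rw [LinearMap.BilinForm.mem_orthogonal_iff]
      exact fun z hz => hL.2 z hz x hx
    · rw [LinearMap.BilinForm.finrank_orthogonal hω, hL.1, hn]; omega
  rw [e, LinearMap.BilinForm.mem_orthogonal_iff]
  exact h

lemma IsLagrangian.isCompl (hn : Module.finrank ℝ F = 2 * n) {L₁ L₂ : Submodule ℝ F}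
    (h₁ : IsLagrangian ω n L₁) (h₂ : IsLagrangian ω n L₂) (h : ∀ a ∈ L₁, a ∈ L₂ → a = 0) :
    IsCompl L₁ L₂ := by
  have hd : Disjoint L₁ L₂ := Submodule.disjoint_def.mpr h
  refine ⟨hd, codisjoint_iff.mpr ?_⟩
  apply Submodule.eq_top_of_disjoint _ _ _ hd
  rw [hn, h₁.1, h₂.1]; omega

lemma IsLagrangian.exists_add (hn : Module.finrank ℝ F = 2 * n) {L₁ L₂ : Submodule ℝ F}
    (h₁ : IsLagrangian ω n L₁) (h₂ : IsLagrangian ω n L₂) (h : ∀ a ∈ L₁, a ∈ L₂ → a = 0) (x : F) :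
    ∃ a ∈ L₁, ∃ c ∈ L₂, a + c = x :=
  Submodule.mem_sup.mp (by rw [(h₁.isCompl hn h₂ h).sup_eq_top]; trivial)

/-- Testing against one summand at a time shows that `w - x` is orthogonal to `L₁`, `x - v` to `M`
and `v - w` to `L₂`; a Lagrangian is its own orthogonal. This is the converse of
`mem_radical_maslovForm_of_mem`. -/
lemma mem_radical_maslovForm (hn : Module.finrank ℝ F = 2 * n) (hω : ω.IsAlt)
    (hω' : ω.Nondegenerate) {L₁ M L₂ : Submodule ℝ F}
    (h₁ : IsLagrangian ω n L₁) (hM : IsLagrangian ω n M) (h₂ : IsLagrangian ω n L₂)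
    {y : L₁ × M × L₂} (hy : y ∈ (maslovForm ω L₁ M L₂).radical) :
    (y.2.1 : F) - y.2.2 ∈ L₁ ∧ (y.2.2 : F) - y.1 ∈ M ∧ (y.1 : F) - y.2.1 ∈ L₂ := by
  have hs : ∀ a b, ω a b = - ω b a := fun a b => (hω.neg_eq b a).symm
  obtain ⟨⟨v, hv⟩, ⟨w, hw⟩, ⟨x, hx⟩⟩ := y
  rw [QuadraticMap.mem_radical_iff'] at hy
  obtain ⟨hy₀, hy⟩ := hy
  replace hy : ∀ v' ∈ L₁, ∀ w' ∈ M, ∀ x' ∈ L₂, ω (v + v') (w + w') + ω (w + w') (x + x')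
      + ω (x + x') (v + v') = ω v' w' + ω w' x' + ω x' v' := fun v' hv' w' hw' x' hx' =>
    hy (⟨v', hv'⟩, ⟨w', hw'⟩, ⟨x', hx'⟩)
  rw [maslovForm_apply] at hy₀
  simp only at hy₀
  refine ⟨h₁.mem_of_orthogonal hn hω' fun v' hv' => ?_,
    hM.mem_of_orthogonal hn hω' fun w' hw' => ?_, h₂.mem_of_orthogonal hn hω' fun x' hx' => ?_⟩
  · have := hy v' hv' 0 M.zero_mem 0 L₂.zero_mem
    have s := hs x v'
    simp only [map_add, map_sub, LinearMap.add_apply, map_zero, LinearMap.zero_apply] at *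
    linarith
  · have := hy 0 L₁.zero_mem w' hw' 0 L₂.zero_mem
    have s := hs v w'
    simp only [map_add, map_sub, LinearMap.add_apply, map_zero, LinearMap.zero_apply] at *
    linarith
  · have := hy 0 L₁.zero_mem 0 M.zero_mem x' hx'
    have s := hs w x'
    simp only [map_add, map_sub, LinearMap.add_apply, map_zero, LinearMap.zero_apply] at *
    linarith

/-- The Maslov form vanishes on the first summand. -/
lemma sigPos_maslovForm_le {L₁ M L₂ : Submodule ℝ F}
    (h₁ : IsLagrangian ω n L₁) (hM : IsLagrangian ω n M) (h₂ : IsLagrangian ω n L₂) :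
    sigPos (maslovForm ω L₁ M L₂) ≤ 2 * n := by
  have h := QuadraticForm.sigPos_add_finrank_le_of_nonpos (Q := maslovForm ω L₁ M L₂)
    (V := LinearMap.range (LinearMap.inl ℝ L₁ (M × L₂))) (by
      rintro _ ⟨v, rfl⟩
      simp [maslovForm_apply])
  rw [LinearMap.finrank_range_of_inj LinearMap.inl_injective, Module.finrank_prod,
    Module.finrank_prod, h₁.1, hM.1, h₂.1] at h
  omega

/-- The form lives on a space of dimension `3n`. It is nondegenerate, its positive index is at most
`2n` because it vanishes on `L₁`, and its negative index is at most `n` because it is nonnegative on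
a subspace of dimension `2n`. The indices are therefore `2n` and `n`. -/
theorem PosTriple.maslovIndex_eq (hn : Module.finrank ℝ F = 2 * n) (hω : ω.IsAlt)
    (hω' : ω.Nondegenerate) {L₁ M L₂ : Submodule ℝ F}
    (h₁ : IsLagrangian ω n L₁) (hM : IsLagrangian ω n M) (h₂ : IsLagrangian ω n L₂)
    (h : PosTriple ω L₁ M L₂) : maslovIndex ω L₁ M L₂ = n := by
  have hc := h₁.isCompl hn h₂ h.1
  have hp := sigPos_maslovForm_le h₁ hM h₂
  have hr : (maslovForm ω L₁ M L₂).radical = ⊥ := by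
    rw [Submodule.eq_bot_iff]
    intro y hy
    obtain ⟨e₁, e₂, e₃⟩ := mem_radical_maslovForm hn hω hω' h₁ hM h₂ hy
    obtain ⟨⟨v, hv⟩, ⟨w, hw⟩, ⟨x, hx⟩⟩ := y
    simp only at e₁ e₂ e₃
    have hwvx : w - x - v = 0 := h.1 _ (L₁.sub_mem e₁ hv) (by
      have := L₂.neg_mem (L₂.add_mem e₃ hx)
      rwa [show -(v - w + x) = w - x - v by abel] at this)
    have hx0 : x = 0 := by
      apply h.disjoint_right x _ hx
      -- Both `x - v` and `w` are in `M`, and `w = x + v`, so their sum is `2x`.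
      have h2 : (2 : ℝ) • x ∈ M := by
        have := M.add_mem e₂ hw
        have e : x - v + w = (2 : ℝ) • x := by
          rw [two_smul, ← sub_eq_zero]
          rw [← hwvx]; abel
        rwa [e] at this
      simpa using M.smul_mem (2 : ℝ)⁻¹ h2
    subst hx0
    have hwv : w = v := by simpa [sub_eq_zero] using hwvx
    subst hwv
    have := h.disjoint_left w hv hw
    subst this
    rfl
  have hq : sigNeg (maslovForm ω L₁ M L₂) ≤ n := by
    let π := L₁.projection L₂ hc
    -- For `w = a + c` with `a ∈ L₁` and `c ∈ L₂`, the image of `(v, w)` is `(a + v, a + c, c)`,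
    -- where the Maslov form takes the value `ω(a, c) ≥ 0`, independently of `v`.
    let f : L₁ × M →ₗ[ℝ] L₁ × M × L₂ :=
      ((L₁.projectionOnto L₂ hc ∘ₗ M.subtype).coprod LinearMap.id ∘ₗ LinearEquiv.prodComm ℝ L₁ M).prod
        ((LinearMap.snd ℝ L₁ M).prod (L₂.projectionOnto L₁ hc.symm ∘ₗ M.subtype ∘ₗ LinearMap.snd ℝ L₁ M))
    have hf : Function.Injective f := by
      rw [injective_iff_map_eq_zero]
      rintro ⟨v, w⟩ hvw
      have hw : w = 0 := congrArg (fun t => t.2.1) hvw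
      have hv : L₁.projectionOnto L₂ hc w + v = 0 := congrArg (fun t => t.1) hvw
      subst hw
      simpa using hv
    have h' := QuadraticForm.sigPos_add_finrank_le_of_nonpos (Q := -maslovForm ω L₁ M L₂)
      (V := LinearMap.range f) (by
        rintro _ ⟨⟨v, w⟩, rfl⟩
        have e := Submodule.projection_add_projection_eq_self hc (w : F)
        have ha : L₁.projection L₂ hc w ∈ L₁ := Submodule.projection_apply_mem hc _
        have hcc : L₂.projection L₁ hc.symm w ∈ L₂ := Submodule.projection_apply_mem hc.symm _
        have ef : maslovForm ω L₁ M L₂ (f (v, w)) =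
            ω (L₁.projection L₂ hc w + v) w + ω w (L₂.projection L₁ hc.symm w)
              + ω (L₂.projection L₁ hc.symm w) (L₁.projection L₂ hc w + v) := rfl
        generalize L₁.projection L₂ hc (w : F) = a at *
        generalize L₂.projection L₁ hc.symm (w : F) = c at *
        have hac : 0 ≤ ω a c := by
          by_cases h0 : a + c = 0
          · have : c = -a := by rw [eq_neg_iff_add_eq_zero, add_comm]; exact h0
            rw [this, map_neg, hω a, neg_zero]
          · exact (h.2 a ha c hcc (by rw [e]; exact w.2) h0).le
        have s₁ := h₁.2 v v.2 a ha
        have s₂ := (hω.neg_eq c a)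
        have s₃ := (hω.neg_eq c (v : F))
        rw [neg_apply, ef, ← e]
        simp only [map_add, LinearMap.add_apply, hω.self_eq_zero, s₁]
        linarith)
    rw [LinearMap.finrank_range_of_inj hf, Module.finrank_prod, Module.finrank_prod,
      Module.finrank_prod, h₁.1, hM.1, h₂.1] at h'
    rw [← sigPos_neg]
    omega
  have hs := QuadraticForm.sigPos_add_sigNeg_add_radical (Q := maslovForm ω L₁ M L₂)
  rw [hr, finrank_bot, Module.finrank_prod, Module.finrank_prod, h₁.1, hM.1, h₂.1] at hs
  unfold maslovIndex
  omega

/-- Let `k = dim (L₁ ∩ M ∩ L₂)` and let `ρ` be the dimension of the radical. The form vanishes on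
the sum of the summand `L₁` and the radical, of dimension at least `n + ρ - k`; with signature `n`
this forces `ρ ≤ 2k`. Three copies of the triple intersection lie in the radical, so `3k ≤ ρ`. Both
numbers are therefore `0`. -/
lemma radical_maslovForm_eq_bot (hn : Module.finrank ℝ F = 2 * n) (hω : ω.IsAlt)
    (hω' : ω.Nondegenerate) {L₁ M L₂ : Submodule ℝ F}
    (h₁ : IsLagrangian ω n L₁) (hM : IsLagrangian ω n M) (h₂ : IsLagrangian ω n L₂)
    (h : maslovIndex ω L₁ M L₂ = n) : (maslovForm ω L₁ M L₂).radical = ⊥ := by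
  set Q := maslovForm ω L₁ M L₂ with hQ
  let K : Submodule ℝ F := L₁ ⊓ M ⊓ L₂
  have hs := QuadraticForm.sigPos_add_sigNeg_add_radical (Q := Q)
  have hdim : Module.finrank ℝ (L₁ × M × L₂) = 3 * n := by
    rw [Module.finrank_prod, Module.finrank_prod, h₁.1, hM.1, h₂.1]; omega
  let N : Submodule ℝ (L₁ × M × L₂) := LinearMap.range (LinearMap.inl ℝ L₁ (M × L₂))
  have hN : Module.finrank ℝ N = n := by
    rw [LinearMap.finrank_range_of_inj LinearMap.inl_injective, h₁.1]
  have hup := QuadraticForm.sigPos_add_finrank_le_of_nonpos (Q := Q) (V := N ⊔ Q.radical) (by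
    intro y hy
    obtain ⟨a, ⟨v, rfl⟩, b, hb, rfl⟩ := Submodule.mem_sup.mp hy
    rw [add_comm, (QuadraticMap.mem_radical_iff'.mp hb).2]
    simp [hQ, maslovForm_apply])
  have hsup := Submodule.finrank_sup_add_finrank_inf_eq N Q.radical
  have hinf : Module.finrank ℝ ↥(N ⊓ Q.radical) ≤ Module.finrank ℝ K := by
    let f : ↥(N ⊓ Q.radical) →ₗ[ℝ] F :=
      L₁.subtype ∘ₗ LinearMap.fst ℝ L₁ (M × L₂) ∘ₗ (N ⊓ Q.radical).subtype
    have hf : ∀ y, f y ∈ K := by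
      rintro ⟨_, ⟨v, rfl⟩, hy⟩
      obtain ⟨-, e₂, e₃⟩ := mem_radical_maslovForm hn hω hω' h₁ hM h₂ hy
      simp only [LinearMap.inl_apply, Prod.fst_zero, Prod.snd_zero, ZeroMemClass.coe_zero, zero_sub,
        sub_zero, Submodule.neg_mem_iff] at e₂ e₃
      exact ⟨⟨v.2, e₂⟩, e₃⟩
    apply LinearMap.finrank_le_finrank_of_injective (f := f.codRestrict K hf)
    rw [injective_iff_map_eq_zero]
    rintro ⟨_, ⟨v, rfl⟩, hy⟩ h0
    have : (v : F) = 0 := congrArg Subtype.val h0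
    have : v = 0 := Subtype.ext this
    subst this
    rfl
  have hK : 3 * Module.finrank ℝ K ≤ Module.finrank ℝ Q.radical := by
    have k₁ : K ≤ L₁ := inf_le_left.trans inf_le_left
    have k₂ : K ≤ M := inf_le_left.trans inf_le_right
    have k₃ : K ≤ L₂ := inf_le_right
    let f : K × K × K →ₗ[ℝ] L₁ × M × L₂ :=
      (Submodule.inclusion k₁).prodMap
        ((Submodule.inclusion k₂).prodMap (Submodule.inclusion k₃))
    have hf : ∀ y, f y ∈ Q.radical := by
      rintro ⟨v, w, x⟩
      exact mem_radical_maslovForm_of_mem hω h₁ hM h₂ (L₁.sub_mem (k₁ w.2) (k₁ x.2))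
        (M.sub_mem (k₂ x.2) (k₂ v.2)) (L₂.sub_mem (k₃ v.2) (k₃ w.2))
    have hfi : Function.Injective (f.codRestrict _ hf) := by
      intro y z hyz
      have hyz' : f y = f z := congrArg Subtype.val hyz
      exact Prod.map_injective.mpr ⟨Submodule.inclusion_injective k₁,
        Prod.map_injective.mpr ⟨Submodule.inclusion_injective k₂,
          Submodule.inclusion_injective k₃⟩⟩ hyz'
    have := LinearMap.finrank_le_finrank_of_injective hfi
    rw [Module.finrank_prod, Module.finrank_prod] at this
    omega
  unfold maslovIndex at h
  rw [← hQ] at h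
  rw [← Submodule.finrank_eq_zero (R := ℝ)]
  omega

/-- The form is nondegenerate, so index `n` means that its positive index is `2n`. A nonzero vector
`a + c` of `M` with `ω(a, c) ≤ 0` would give a subspace of dimension `n + 1` on which the form is
nonpositive, which is too large. -/
theorem posTriple_of_maslovIndex_eq (hn : Module.finrank ℝ F = 2 * n) (hω : ω.IsAlt)
    (hω' : ω.Nondegenerate) {L₁ M L₂ : Submodule ℝ F}
    (h₁ : IsLagrangian ω n L₁) (hM : IsLagrangian ω n M) (h₂ : IsLagrangian ω n L₂)
    (h : maslovIndex ω L₁ M L₂ = n) : PosTriple ω L₁ M L₂ := by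
  have hr := radical_maslovForm_eq_bot hn hω hω' h₁ hM h₂ h
  have hs := QuadraticForm.sigPos_add_sigNeg_add_radical (Q := maslovForm ω L₁ M L₂)
  rw [hr, finrank_bot, Module.finrank_prod, Module.finrank_prod, h₁.1, hM.1, h₂.1] at hs
  -- For `a` in `L₁ ∩ L₂`, the vector `(a, 0, a)` is in the radical.
  have hd : ∀ a ∈ L₁, a ∈ L₂ → a = 0 := by
    intro a ha ha'
    have := mem_radical_maslovForm_of_mem hω h₁ hM h₂ (y := (⟨a, ha⟩, 0, ⟨a, ha'⟩))
      (by simpa using ha) (by simp) (by simpa using ha')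
    rw [hr, Submodule.mem_bot] at this
    exact congrArg (fun t : L₁ × M × L₂ => (t.1 : F)) this
  refine ⟨hd, fun a ha c hc hac h0 => ?_⟩
  by_contra hneg
  push Not at hneg
  -- On `(v + ta, t(a + c), tc)` the form equals `t² ω(a, c)`, whatever `v` is.
  let f : L₁ × ℝ →ₗ[ℝ] L₁ × M × L₂ :=
    (LinearMap.inl ℝ L₁ (M × L₂)).coprod
      (LinearMap.toSpanSingleton ℝ (L₁ × M × L₂) (⟨a, ha⟩, ⟨a + c, hac⟩, ⟨c, hc⟩))
  have hf : Function.Injective f := by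
    rw [injective_iff_map_eq_zero]
    rintro ⟨v, t⟩ hvt
    have e₁ : t • (a + c) = 0 := by
      have := congrArg (fun t : L₁ × M × L₂ => (t.2.1 : F)) hvt
      simpa [f] using this
    have ht : t = 0 := (smul_eq_zero.mp e₁).resolve_right h0
    subst ht
    have e₂ : v = 0 := by
      have := congrArg (fun t : L₁ × M × L₂ => t.1) hvt
      simpa [f] using this
    rw [e₂]; rfl
  have h' := QuadraticForm.sigPos_add_finrank_le_of_nonpos (Q := maslovForm ω L₁ M L₂)
    (V := LinearMap.range f) (by
      rintro _ ⟨⟨v, t⟩, rfl⟩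
      have ef : maslovForm ω L₁ M L₂ (f (v, t)) =
          ω (v + t • a) ((0 : F) + t • (a + c)) + ω ((0 : F) + t • (a + c)) ((0 : F) + t • c)
            + ω ((0 : F) + t • c) (v + t • a) := rfl
      have s₁ := h₁.2 v v.2 a ha
      have s₂ := hω.neg_eq c a
      have s₃ := hω.neg_eq c (v : F)
      have hnn := mul_nonneg (mul_self_nonneg t) (neg_nonneg.mpr hneg)
      rw [ef]
      simp only [map_add, LinearMap.add_apply, hω.self_eq_zero, s₁, map_smul, smul_add, zero_add,
        LinearMap.smul_apply, smul_eq_mul, ← s₂, ← s₃]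
      rw [← s₂] at hnn
      linear_combination hnn)
  rw [LinearMap.finrank_range_of_inj hf, Module.finrank_prod, Module.finrank_prod,
    Module.finrank_prod, h₁.1, hM.1, h₂.1, Module.finrank_self] at h'
  unfold maslovIndex at h
  omega

lemma maslovIndex_eq_iff (hn : Module.finrank ℝ F = 2 * n) (hω : ω.IsAlt)
    (hω' : ω.Nondegenerate) {L₁ M L₂ : Submodule ℝ F}
    (h₁ : IsLagrangian ω n L₁) (hM : IsLagrangian ω n M) (h₂ : IsLagrangian ω n L₂) :
    maslovIndex ω L₁ M L₂ = n ↔ PosTriple ω L₁ M L₂ :=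
  ⟨posTriple_of_maslovIndex_eq hn hω hω' h₁ hM h₂, PosTriple.maslovIndex_eq hn hω hω' h₁ hM h₂⟩

/-! ### Flips and normal form of positive triples. -/

/-- If `(x, y, w)` and `(y, z, w)` are positive, so are `(x, y, z)` and `(x, z, w)`. -/
lemma PosTriple.flip (hn : Module.finrank ℝ F = 2 * n) (hω : ω.IsAlt) {x y z w : Submodule ℝ F}
    (hy : IsLagrangian ω n y) (hw : IsLagrangian ω n w)
    (h₁ : PosTriple ω x y w) (h₂ : PosTriple ω y z w) :
    PosTriple ω x y z ∧ PosTriple ω x z w := by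
  -- Everything is compared in the decomposition `F = y ⊕ w`: the form `b + d ↦ ω(b, d)` is positive
  -- on `z` by `h₂`, and negative on `x` because `b = a - d` lies in `y` and `(x, y, w)` is
  -- positive.
  have hdec : ∀ a ∈ x, ∃ b ∈ y, ∃ d ∈ w, b + d = a ∧ (a ≠ 0 → ω b d < 0) := by
    intro a ha
    obtain ⟨b, hb, d, hd, e⟩ := hy.exists_add hn hw h₂.1 a
    refine ⟨b, hb, d, hd, e, fun h0 => ?_⟩
    have hb' : a + -d = b := by rw [← e]; abel
    have := h₁.2 a ha (-d) (w.neg_mem hd) (by rw [hb']; exact hb) (by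
      rw [hb']
      rintro rfl
      rw [zero_add] at e
      subst e
      exact h0 (h₁.1 d ha hd))
    rw [← e] at this
    simp only [map_neg, map_add, LinearMap.add_apply, hω.self_eq_zero] at this
    linarith
  refine ⟨⟨fun a ha haz => ?_, fun a ha c hc hac h0 => ?_⟩,
    ⟨h₁.1, fun a ha c hc hac h0 => ?_⟩⟩
  · obtain ⟨b, hb, d, hd, e, hneg⟩ := hdec a ha
    by_contra h0
    have := h₂.2 b hb d hd (by rw [e]; exact haz) (by rw [e]; exact h0)
    linarith [hneg h0]
  · obtain ⟨b, hb, d, hd, e, hneg⟩ := hdec a ha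
    obtain ⟨b', hb', d', hd', e'⟩ := hy.exists_add hn hw h₂.1 c
    -- This vector is in `w`, and also in `y` as the difference of `a + c` and `b + b'`. Hence `ω(a,
    -- c) = ω(b', d') - ω(b, d)`, where the first term comes from `z` and the second from `x`.
    have hdd : d + d' = 0 := by
      apply h₂.1 _ _ (w.add_mem hd hd')
      have := y.sub_mem hac (y.add_mem hb hb')
      rwa [← e, ← e', show b + d + (b' + d') - (b + b') = d + d' by abel] at this
    have hd'' : d = -d' := eq_neg_of_add_eq_zero_left hdd
    have hac' : ω a c = - ω b d + ω b' d' := by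
      have s := hω.neg_eq d' b'
      rw [← e, ← e', hd'']
      simp only [map_neg, map_add, LinearMap.add_apply, LinearMap.neg_apply, hω.self_eq_zero,
        hy.2 b hb b' hb']
      linarith
    rw [hac']
    have hc0 : 0 ≤ ω b' d' := by
      by_cases h : c = 0
      · have : b' = -d' := eq_neg_of_add_eq_zero_left (e'.trans h)
        rw [this, map_neg, LinearMap.neg_apply, hω.self_eq_zero, neg_zero]
      · exact (h₂.2 b' hb' d' hd' (by rw [e']; exact hc) (by rw [e']; exact h)).le
    by_cases h : a = 0
    · have hc1 : c ≠ 0 := by rintro rfl; simp [h] at h0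
      have := h₂.2 b' hb' d' hd' (by rw [e']; exact hc) (by rw [e']; exact hc1)
      have : b = -d := eq_neg_of_add_eq_zero_left (e.trans h)
      rw [this, map_neg, LinearMap.neg_apply, hω.self_eq_zero]
      linarith
    · linarith [hneg h]
  · obtain ⟨b, hb, d, hd, e, hneg⟩ := hdec a ha
    -- Again a difference of a value on `z`, at `b + (d + c) = a + c`, and a value on `x`, at `b + d
    -- = a`.
    have hac' : ω a c = ω b (d + c) - ω b d := by
      rw [← e]
      simp only [map_add, LinearMap.add_apply, hw.2 d hd c hc]
      linarith
    rw [hac']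
    have hsum : b + (d + c) = a + c := by rw [← e]; abel
    have h2 := h₂.2 b hb (d + c) (w.add_mem hd hc) (by rw [hsum]; exact hac)
      (by rw [hsum]; exact h0)
    by_cases h : a = 0
    · have : b = -d := eq_neg_of_add_eq_zero_left (e.trans h)
      have h3 : ω b d = 0 := by rw [this, map_neg, LinearMap.neg_apply, hω.self_eq_zero, neg_zero]
      linarith
    · linarith [hneg h]

/-- `Span(e₁ + f₁, …, eₙ + fₙ)`. -/
def stdD (n : ℕ) : Submodule ℝ (R2 n) where
  carrier := {x | ∀ i, x (Sum.inl i) = x (Sum.inr i)}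
  zero_mem' := fun _ => rfl
  add_mem' := fun hx hy i => congrArg₂ (· + ·) (hx i) (hy i)
  smul_mem' := fun c _ hx i => congrArg (c * ·) (hx i)

lemma mem_stdD {n : ℕ} {x : R2 n} : x ∈ stdD n ↔ ∀ i, x (Sum.inl i) = x (Sum.inr i) := Iff.rfl

/-- The triple `(Span(e), Span(e + f), Span(f))` is a normal form for positive triples. -/
theorem PosTriple.exists_frame (hn : Module.finrank ℝ F = 2 * n) (hω : ω.IsAlt)
    {L₁ M L₂ : Submodule ℝ F}
    (h₁ : IsLagrangian ω n L₁) (hM : IsLagrangian ω n M) (h₂ : IsLagrangian ω n L₂)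
    (h : PosTriple ω L₁ M L₂) :
    ∃ ψ : R2 n ≃ₗ[ℝ] F, (∀ x y, ω (ψ x) (ψ y) = stdForm n x y) ∧
      (∀ x ∈ stdE n, ψ x ∈ L₁) ∧ (∀ x ∈ stdD n, ψ x ∈ M) ∧ ∀ x ∈ stdF n, ψ x ∈ L₂ := by
  have hc := h₁.isCompl hn h₂ h.1
  let π := L₁.projection L₂ hc
  let π' := L₂.projection L₁ hc.symm
  have hπ : ∀ x, π x ∈ L₁ := fun x => Submodule.projection_apply_mem hc _
  have hπ' : ∀ x, π' x ∈ L₂ := fun x => Submodule.projection_apply_mem hc.symm _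
  have hadd : ∀ x, π x + π' x = x := fun x => Submodule.projection_add_projection_eq_self hc x
  -- The polarization of `a + c ↦ ω(a, c)`; its symmetry is the isotropy of `M`, and its positivity
  -- is that of the triple.
  let B : LinearMap.BilinForm ℝ M := ω.compl₁₂ (π ∘ₗ M.subtype) (π' ∘ₗ M.subtype)
  have hB : ∀ x y, B x y = ω (π x) (π' y) := fun _ _ => rfl
  obtain ⟨m, hm⟩ := exists_orthonormal_basis hM.1 B
    (fun x y => by
      have e := hM.2 x x.2 y y.2
      rw [← hadd x, ← hadd y] at e
      have s := hω.neg_eq (π' x) (π y)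
      simp only [map_add, LinearMap.add_apply, h₁.2 _ (hπ x) _ (hπ y),
        h₂.2 _ (hπ' x) _ (hπ' y)] at e
      rw [hB, hB]
      linarith)
    (fun x hx => h.2 (π x) (hπ x) (π' x) (hπ' x) (by rw [hadd]; exact x.2) (by
      rw [hadd]; simpa using hx))
  -- The components in `L₁` and `L₂` of an orthonormal basis of `M` form a symplectic basis, and `eᵢ
  -- + fᵢ` is sent to the basis vector `mᵢ` of `M`.
  let f : R2 n →ₗ[ℝ] F := Fintype.linearCombination ℝ
    (Sum.elim (fun i => π (m i)) (fun i => π' (m i)))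
  have hf : ∀ x, f x = ∑ i, x (Sum.inl i) • π (m i) + ∑ i, x (Sum.inr i) • π' (m i) := by
    intro x
    simp [f, Fintype.linearCombination_apply, Fintype.sum_sum_type]
  have hsum : ∀ x y, ω (f x) (f y) = stdForm n x y := by
    intro x y
    have a₁ : ∀ i j, ω (π (m i)) (π (m j)) = 0 := fun i j => h₁.2 _ (hπ _) _ (hπ _)
    have a₂ : ∀ i j, ω (π' (m i)) (π' (m j)) = 0 := fun i j => h₂.2 _ (hπ' _) _ (hπ' _)
    have a₃ : ∀ i j, ω (π (m i)) (π' (m j)) = if i = j then 1 else 0 := fun i j => hm i j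
    have a₄ : ∀ i j, ω (π' (m i)) (π (m j)) = -if j = i then 1 else 0 := fun i j => by
      rw [← hω.neg_eq, a₃]
    rw [stdForm_apply, hf, hf]
    simp [LinearMap.sum_apply, map_sum, a₁, a₂, a₃, a₄, sub_eq_add_neg]
  have hinj : Function.Injective f := by
    rw [injective_iff_map_eq_zero]
    intro x hx
    apply (stdForm_nondegenerate n).1 x
    intro y
    rw [← hsum, hx, map_zero, LinearMap.zero_apply]
  let ψ : R2 n ≃ₗ[ℝ] F := LinearEquiv.ofInjectiveOfFinrankEq f hinj (by rw [hn, finrank_R2])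
  have hψ : ∀ x, ψ x = f x := fun _ => rfl
  refine ⟨ψ, fun x y => hsum x y, fun x hx => ?_, fun x hx => ?_, fun x hx => ?_⟩
  · rw [mem_stdE] at hx
    rw [hψ, hf]
    simp only [hx, zero_smul, Finset.sum_const_zero, add_zero]
    exact L₁.sum_mem fun i _ => L₁.smul_mem _ (hπ _)
  · rw [mem_stdD] at hx
    rw [hψ, hf]
    simp only [hx, ← Finset.sum_add_distrib, ← smul_add, hadd]
    exact M.sum_mem fun i _ => M.smul_mem _ (m i).2
  · rw [mem_stdF] at hx
    rw [hψ, hf]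
    simp only [hx, zero_smul, Finset.sum_const_zero, zero_add]
    exact L₂.sum_mem fun i _ => L₂.smul_mem _ (hπ' _)

end PosTriple

/-! ### Symplectic matrices and the standard positive triple -/

section Matrices

variable {n : ℕ}

lemma stdD_isLagrangian (n : ℕ) : IsLagrangian (stdForm n) n (stdD n) := by
  have h : (stdE n).map (spEquiv (turnMat (1 : OO n))).toLinearMap = stdD n := by
    apply le_antisymm
    · rintro _ ⟨x, hx, rfl⟩
      rw [SetLike.mem_coe, mem_stdE] at hx
      intro i
      simp [spEquiv_apply, turnMat, Matrix.mulVec, dotProduct, hx]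
    · intro x hx
      refine ⟨Sum.elim (fun i => x (Sum.inl i)) 0, ?_, ?_⟩
      · rw [SetLike.mem_coe, mem_stdE]; simp
      · ext (i | i)
        · simp [spEquiv_apply, turnMat, Matrix.mulVec, dotProduct, Matrix.one_apply]
        · simp [spEquiv_apply, turnMat, Matrix.mulVec, dotProduct, Matrix.one_apply, hx i]
  rw [← h]
  refine ⟨(LinearEquiv.finrank_map_eq _ _).trans (stdE_isLagrangian n).1, ?_⟩
  rintro _ ⟨u, hu, rfl⟩ _ ⟨v, hv, rfl⟩
  exact (stdForm_spEquiv _ u v).trans ((stdE_isLagrangian n).2 u hu v hv)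

/-- The Lagrangian `Span(f₁, …, fₙ)`. -/
def lagF (n : ℕ) : Lag n := ⟨stdF n, stdF_isLagrangian n⟩

/-- The Lagrangian `Span(e₁ + f₁, …, eₙ + fₙ)`. -/
def lagD (n : ℕ) : Lag n := ⟨stdD n, stdD_isLagrangian n⟩

lemma smul_lag_eq_iff (g : Sp n) (L L' : Lag n) :
    g • L = L' ↔ ∀ x ∈ L.1, Matrix.mulVec g.1 x ∈ L'.1 := by
  constructor
  · rintro rfl x hx
    exact ⟨x, hx, rfl⟩
  · intro h
    exact Subtype.ext (map_eq_of_le g L.2 L'.2 h)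

lemma fromBlocks_toBlocks_mulVec (g : Matrix (Fin n ⊕ Fin n) (Fin n ⊕ Fin n) ℝ)
    (x : R2 n) : Matrix.mulVec g x = Sum.elim
      (Matrix.mulVec g.toBlocks₁₁ (x ∘ Sum.inl) + Matrix.mulVec g.toBlocks₁₂ (x ∘ Sum.inr))
      (Matrix.mulVec g.toBlocks₂₁ (x ∘ Sum.inl) + Matrix.mulVec g.toBlocks₂₂ (x ∘ Sum.inr)) := by
  conv_lhs => rw [← Matrix.fromBlocks_toBlocks g, Matrix.fromBlocks_mulVec]

lemma elim_mem_stdE {a b : Fin n → ℝ} : (Sum.elim a b : R2 n) ∈ stdE n ↔ b = 0 := by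
  rw [mem_stdE, funext_iff]; rfl

lemma elim_mem_stdF {a b : Fin n → ℝ} : (Sum.elim a b : R2 n) ∈ stdF n ↔ a = 0 := by
  rw [mem_stdF, funext_iff]; rfl

lemma elim_mem_stdD {a b : Fin n → ℝ} : (Sum.elim a b : R2 n) ∈ stdD n ↔ a = b := by
  rw [mem_stdD, funext_iff]; rfl

lemma forall_mem_stdE {P : R2 n → Prop} :
    (∀ x ∈ stdE n, P x) ↔ ∀ a : Fin n → ℝ, P (Sum.elim a 0) := by
  refine ⟨fun h a => h _ (elim_mem_stdE.mpr rfl), fun h x hx => ?_⟩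
  have : x = Sum.elim (x ∘ Sum.inl) (x ∘ Sum.inr) := (Sum.elim_comp_inl_inr x).symm
  rw [this] at hx ⊢
  rw [elim_mem_stdE.mp hx]
  exact h _

lemma forall_mem_stdF {P : R2 n → Prop} :
    (∀ x ∈ stdF n, P x) ↔ ∀ a : Fin n → ℝ, P (Sum.elim 0 a) := by
  refine ⟨fun h a => h _ (elim_mem_stdF.mpr rfl), fun h x hx => ?_⟩
  have : x = Sum.elim (x ∘ Sum.inl) (x ∘ Sum.inr) := (Sum.elim_comp_inl_inr x).symm
  rw [this] at hx ⊢
  rw [elim_mem_stdF.mp hx]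
  exact h _

lemma forall_mem_stdD {P : R2 n → Prop} :
    (∀ x ∈ stdD n, P x) ↔ ∀ a : Fin n → ℝ, P (Sum.elim a a) := by
  refine ⟨fun h a => h _ (elim_mem_stdD.mpr rfl), fun h x hx => ?_⟩
  have : x = Sum.elim (x ∘ Sum.inl) (x ∘ Sum.inr) := (Sum.elim_comp_inl_inr x).symm
  rw [this] at hx ⊢
  rw [elim_mem_stdD.mp hx]
  exact h _

lemma forall_mulVec_eq_zero_iff {A : Matrix (Fin n) (Fin n) ℝ} :
    (∀ a, Matrix.mulVec A a = 0) ↔ A = 0 := by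
  refine ⟨fun h => Matrix.ext_of_mulVec_single fun i => ?_, ?_⟩
  · rw [h, Matrix.zero_mulVec]
  · rintro rfl a; exact Matrix.zero_mulVec a

lemma forall_mulVec_eq_iff {A B : Matrix (Fin n) (Fin n) ℝ} :
    (∀ a, Matrix.mulVec A a = Matrix.mulVec B a) ↔ A = B := by
  rw [← sub_eq_zero (a := A), ← forall_mulVec_eq_zero_iff]
  simp only [Matrix.sub_mulVec, sub_eq_zero]

/-- This lemma and the following ones translate the action of a symplectic matrix on `Span(e)`,
`Span(f)` and `Span(e + f)` into linear relations between its blocks. -/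
lemma smul_lagE_eq_lagE (g : Sp n) : g • lagE n = lagE n ↔ g.1.toBlocks₂₁ = 0 := by
  rw [smul_lag_eq_iff, ← forall_mulVec_eq_zero_iff]
  refine forall_mem_stdE.trans (forall_congr' fun a => ?_)
  rw [fromBlocks_toBlocks_mulVec]
  exact elim_mem_stdE.trans (by simp)

lemma smul_lagE_eq_lagF (g : Sp n) : g • lagE n = lagF n ↔ g.1.toBlocks₁₁ = 0 := by
  rw [smul_lag_eq_iff, ← forall_mulVec_eq_zero_iff]
  refine forall_mem_stdE.trans (forall_congr' fun a => ?_)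
  rw [fromBlocks_toBlocks_mulVec]
  exact elim_mem_stdF.trans (by simp)

lemma smul_lagE_eq_lagD (g : Sp n) :
    g • lagE n = lagD n ↔ g.1.toBlocks₁₁ = g.1.toBlocks₂₁ := by
  rw [smul_lag_eq_iff, ← forall_mulVec_eq_iff]
  refine forall_mem_stdE.trans (forall_congr' fun a => ?_)
  rw [fromBlocks_toBlocks_mulVec]
  exact elim_mem_stdD.trans (by simp)

lemma smul_lagF_eq_lagE (g : Sp n) : g • lagF n = lagE n ↔ g.1.toBlocks₂₂ = 0 := by
  rw [smul_lag_eq_iff, ← forall_mulVec_eq_zero_iff]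
  refine forall_mem_stdF.trans (forall_congr' fun a => ?_)
  rw [fromBlocks_toBlocks_mulVec]
  exact elim_mem_stdE.trans (by simp)

lemma smul_lagF_eq_lagF (g : Sp n) : g • lagF n = lagF n ↔ g.1.toBlocks₁₂ = 0 := by
  rw [smul_lag_eq_iff, ← forall_mulVec_eq_zero_iff]
  refine forall_mem_stdF.trans (forall_congr' fun a => ?_)
  rw [fromBlocks_toBlocks_mulVec]
  exact elim_mem_stdF.trans (by simp)

lemma smul_lagD_eq_lagD (g : Sp n) : g • lagD n = lagD n ↔
    g.1.toBlocks₁₁ + g.1.toBlocks₁₂ = g.1.toBlocks₂₁ + g.1.toBlocks₂₂ := by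
  rw [smul_lag_eq_iff, ← forall_mulVec_eq_iff]
  refine forall_mem_stdD.trans (forall_congr' fun a => ?_)
  rw [fromBlocks_toBlocks_mulVec]
  exact elim_mem_stdD.trans (by simp [Matrix.add_mulVec])

lemma smul_lagD_eq_lagF (g : Sp n) : g • lagD n = lagF n ↔
    g.1.toBlocks₁₁ + g.1.toBlocks₁₂ = 0 := by
  rw [smul_lag_eq_iff, ← forall_mulVec_eq_zero_iff]
  refine forall_mem_stdD.trans (forall_congr' fun a => ?_)
  rw [fromBlocks_toBlocks_mulVec]
  exact elim_mem_stdF.trans (by simp [Matrix.add_mulVec])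

lemma Sp.blocks (g : Sp n) :
    g.1.toBlocks₁₁.transpose * g.1.toBlocks₂₁ = g.1.toBlocks₂₁.transpose * g.1.toBlocks₁₁ ∧
    g.1.toBlocks₁₂.transpose * g.1.toBlocks₂₂ = g.1.toBlocks₂₂.transpose * g.1.toBlocks₁₂ ∧
    g.1.toBlocks₁₁.transpose * g.1.toBlocks₂₂ - g.1.toBlocks₂₁.transpose * g.1.toBlocks₁₂ = 1 :=
  SymplecticGroup.fromBlocks_mem_iff.mp (by rw [Matrix.fromBlocks_toBlocks]; exact g.2)

lemma Sp.ext_blocks {g h : Sp n} (h₁₁ : g.1.toBlocks₁₁ = h.1.toBlocks₁₁)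
    (h₁₂ : g.1.toBlocks₁₂ = h.1.toBlocks₁₂) (h₂₁ : g.1.toBlocks₂₁ = h.1.toBlocks₂₁)
    (h₂₂ : g.1.toBlocks₂₂ = h.1.toBlocks₂₂) : g = h :=
  Subtype.ext (Matrix.ext_iff_blocks.mpr ⟨h₁₁, h₁₂, h₂₁, h₂₂⟩)

lemma OO.transpose_mul (u : OO n) : u.1.transpose * u.1 = 1 :=
  (Matrix.mem_orthogonalGroup_iff' (Fin n) ℝ).mp u.2

lemma OO.mul_transpose (u : OO n) : u.1 * u.1.transpose = 1 :=
  (Matrix.mem_orthogonalGroup_iff (Fin n) ℝ).mp u.2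

lemma OO.coe_inv (u : OO n) : (u⁻¹ : OO n).1 = u.1.transpose := rfl

lemma OO.coe_inv_mul (u : OO n) : (u⁻¹ : OO n).1 * u.1 = 1 := OO.transpose_mul u

lemma OO.coe_mul_inv (u : OO n) : u.1 * (u⁻¹ : OO n).1 = 1 := OO.mul_transpose u

/-- The symplectic matrix `(u 0; 0 u)`. -/
def diagO : OO n →* Sp n where
  toFun u := ⟨Matrix.fromBlocks u.1 0 0 u.1, by
    rw [SymplecticGroup.fromBlocks_mem_iff]
    simp [OO.transpose_mul u]⟩
  map_one' := Subtype.ext (by simp)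
  map_mul' u v := Subtype.ext (by simp [Matrix.fromBlocks_multiply])

lemma coe_diagO (u : OO n) : (diagO u).1 = Matrix.fromBlocks u.1 0 0 u.1 := rfl

lemma diagO_smul_lagE (u : OO n) : diagO u • lagE n = lagE n := by
  rw [smul_lagE_eq_lagE]; simp [coe_diagO]

lemma diagO_smul_lagF (u : OO n) : diagO u • lagF n = lagF n := by
  rw [smul_lagF_eq_lagF]; simp [coe_diagO]

/-- The stabilizer of the standard triple is the orthogonal group. -/
lemma exists_eq_diagO {g : Sp n} (hE : g • lagE n = lagE n) (hD : g • lagD n = lagD n)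
    (hF : g • lagF n = lagF n) : ∃ u : OO n, g = diagO u := by
  rw [smul_lagE_eq_lagE] at hE
  rw [smul_lagD_eq_lagD] at hD
  rw [smul_lagF_eq_lagF] at hF
  have hb := (Sp.blocks g).2.2
  have hD' : g.1.toBlocks₂₂ = g.1.toBlocks₁₁ := by rw [hE, hF] at hD; simpa using hD.symm
  rw [hE, hD'] at hb
  refine ⟨⟨g.1.toBlocks₁₁, (Matrix.mem_orthogonalGroup_iff' (Fin n) ℝ).mpr (by simpa using hb)⟩,
    Sp.ext_blocks ?_ ?_ ?_ ?_⟩ <;> simp [coe_diagO, hE, hF, hD']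

lemma turnMat_smul_lagE (u : OO n) : turnMat u • lagE n = lagD n := by
  rw [smul_lagE_eq_lagD]; simp [turnMat]

lemma turnMat_smul_lagF (u : OO n) : turnMat u • lagF n = lagE n := by
  rw [smul_lagF_eq_lagE]; simp [turnMat]

lemma turnMat_smul_lagD (u : OO n) : turnMat u • lagD n = lagF n := by
  rw [smul_lagD_eq_lagF]; simp [turnMat]

lemma crossMat_smul_lagE (A : SymPos n) : crossMat A • lagE n = lagF n := by
  rw [smul_lagE_eq_lagF]; simp [crossMat]

lemma crossMat_smul_lagF (A : SymPos n) : crossMat A • lagF n = lagE n := by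
  rw [smul_lagF_eq_lagE]; simp [crossMat]

lemma toBlocks₁₁_turnMat (u : OO n) : (turnMat u).1.toBlocks₁₁ = u.1 := by simp [turnMat]

lemma toBlocks₂₁_crossMat (A : SymPos n) : (crossMat A).1.toBlocks₂₁ = symSqrt A := by
  simp [crossMat]

lemma turnMat_injective : Function.Injective (turnMat : OO n → Sp n) := by
  intro u v h
  have := congrArg (fun g : Sp n => g.1.toBlocks₁₁) h
  exact Subtype.ext (by simpa [toBlocks₁₁_turnMat] using this)

/-- The matrices that permute the standard triple cyclically form a coset of its stabilizer `O(n)`;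
this is why the coordinate of an arrow of `A₃` is an orthogonal matrix. -/
lemma exists_eq_turnMat {g : Sp n} (hE : g • lagE n = lagD n) (hD : g • lagD n = lagF n)
    (hF : g • lagF n = lagE n) : ∃ u : OO n, g = turnMat u := by
  rw [smul_lagE_eq_lagD] at hE
  rw [smul_lagD_eq_lagF] at hD
  rw [smul_lagF_eq_lagE] at hF
  have hb := (Sp.blocks g).2.2
  have hD' : g.1.toBlocks₁₂ = -g.1.toBlocks₁₁ := by rw [eq_neg_iff_add_eq_zero, add_comm]; exact hD
  rw [hF, hD', ← hE] at hb
  refine ⟨⟨g.1.toBlocks₁₁, (Matrix.mem_orthogonalGroup_iff' (Fin n) ℝ).mpr (by simpa using hb)⟩,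
    Sp.ext_blocks ?_ ?_ ?_ ?_⟩ <;> simp [turnMat, hE, hF, hD']

lemma diagO_mul_turnMat_mul (k u k' : OO n) :
    diagO k * turnMat u * diagO k' = turnMat (k * u * k') := by
  apply Subtype.ext
  simp [coe_diagO, turnMat, Matrix.fromBlocks_multiply]

/-! ### Square roots, polar decomposition, and matrices that exchange `Span(e)` and `Span(f)`. -/

open scoped MatrixOrder in
lemma symSqrt_posDef (A : SymPos n) : (symSqrt A).PosDef := by
  have h := Matrix.nonneg_iff_posSemidef.mp (CFC.sqrt_nonneg A.1)
  exact h.posDef_iff_det_ne_zero.mpr (symSqrt_isUnit_det A).ne_zero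

open scoped MatrixOrder in
lemma symSqrt_eq_of_mul_self {A : SymPos n} {P : Matrix (Fin n) (Fin n) ℝ} (hP : P.PosSemidef)
    (h : P * P = A.1) : symSqrt A = P :=
  CFC.sqrt_unique h hP.nonneg

lemma posDef_conj {A : Matrix (Fin n) (Fin n) ℝ} (hA : A.PosDef) (u : OO n) :
    (u.1 * A * (u⁻¹ : OO n).1).PosDef := by
  have h := hA.mul_mul_conjTranspose_same (B := u.1) (by
    apply Matrix.vecMul_injective_of_isUnit
    exact (Matrix.isUnit_iff_isUnit_det _).mpr
      (Matrix.isUnit_det_of_right_inverse (OO.mul_transpose u)))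
  exact h

/-- The conjugate `u A u⁻¹` of a positive definite matrix. -/
def conjSym (u : OO n) (A : SymPos n) : SymPos n := ⟨u.1 * A.1 * (u⁻¹ : OO n).1, posDef_conj A.2 u⟩

lemma OO.conj_mul_conj (u : OO n) (A B : Matrix (Fin n) (Fin n) ℝ) :
    u.1 * A * (u⁻¹ : OO n).1 * (u.1 * B * (u⁻¹ : OO n).1) = u.1 * (A * B) * (u⁻¹ : OO n).1 := by
  calc _ = u.1 * A * ((u⁻¹ : OO n).1 * u.1) * B * (u⁻¹ : OO n).1 := by simp only [mul_assoc]
    _ = _ := by rw [OO.coe_inv_mul, mul_one]; simp only [mul_assoc]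

lemma symSqrt_conjSym (u : OO n) (A : SymPos n) :
    symSqrt (conjSym u A) = u.1 * symSqrt A * (u⁻¹ : OO n).1 := by
  apply symSqrt_eq_of_mul_self (posDef_conj (symSqrt_posDef A) u).posSemidef
  rw [OO.conj_mul_conj, symSqrt_mul_self]
  rfl

/-- A symplectic matrix that exchanges `Span(e)` and `Span(f)` is determined by its lower left
block. -/
lemma swap_blocks {g : Sp n} (hE : g • lagE n = lagF n) (hF : g • lagF n = lagE n) :
    g.1.toBlocks₁₁ = 0 ∧ g.1.toBlocks₂₂ = 0 ∧
      -g.1.toBlocks₁₂.transpose * g.1.toBlocks₂₁ = 1 ∧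
      g.1.toBlocks₁₂ = -(g.1.toBlocks₂₁⁻¹).transpose := by
  rw [smul_lagE_eq_lagF] at hE
  rw [smul_lagF_eq_lagE] at hF
  have hb := (Sp.blocks g).2.2
  rw [hE, hF] at hb
  have h : -g.1.toBlocks₁₂.transpose * g.1.toBlocks₂₁ = 1 := by
    have := congrArg Matrix.transpose hb
    simpa using this
  refine ⟨hE, hF, h, ?_⟩
  have := Matrix.inv_eq_left_inv h
  rw [this]; simp

lemma eq_of_swap {g h : Sp n} (hE : g • lagE n = lagF n) (hF : g • lagF n = lagE n)
    (hE' : h • lagE n = lagF n) (hF' : h • lagF n = lagE n)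
    (e : g.1.toBlocks₂₁ = h.1.toBlocks₂₁) : g = h := by
  obtain ⟨a, b, -, c⟩ := swap_blocks hE hF
  obtain ⟨a', b', -, c'⟩ := swap_blocks hE' hF'
  exact Sp.ext_blocks (a.trans a'.symm) (by rw [c, c', e]) e (b.trans b'.symm)

lemma toBlocks₂₁_diagO_mul_mul (k k' : OO n) (g : Sp n) :
    (diagO k * g * diagO k').1.toBlocks₂₁ = k.1 * g.1.toBlocks₂₁ * k'.1 := by
  have : (diagO k * g * diagO k').1 = Matrix.fromBlocks k.1 0 0 k.1 *
    Matrix.fromBlocks g.1.toBlocks₁₁ g.1.toBlocks₁₂ g.1.toBlocks₂₁ g.1.toBlocks₂₂ *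
    Matrix.fromBlocks k'.1 0 0 k'.1 := by
    rw [Matrix.fromBlocks_toBlocks]; rfl
  rw [this]
  simp [Matrix.fromBlocks_multiply]

lemma diagO_mul_crossMat_mul (u : OO n) (A : SymPos n) :
    diagO u * crossMat A * diagO u⁻¹ = crossMat (conjSym u A) := by
  apply eq_of_swap
  · simp only [mul_smul, diagO_smul_lagE, crossMat_smul_lagE, diagO_smul_lagF]
  · simp only [mul_smul, diagO_smul_lagE, crossMat_smul_lagF, diagO_smul_lagF]
  · exact crossMat_smul_lagE _
  · exact crossMat_smul_lagF _
  · rw [toBlocks₂₁_diagO_mul_mul, toBlocks₂₁_crossMat, toBlocks₂₁_crossMat, symSqrt_conjSym]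

/-- Uniqueness of the polar decomposition. -/
lemma eq_of_diagO_mul_crossMat {k k' : OO n} {A B : SymPos n}
    (h : diagO k * crossMat A = crossMat B * diagO k') : k' = k ∧ B = conjSym k A := by
  -- Comparison of the lower left blocks. Multiplying by the transpose eliminates `k'` and gives `B
  -- = k A k⁻¹`; then `k √A` can be cancelled, which leaves `k = k'`.
  have e : symSqrt B = k.1 * symSqrt A * (k'⁻¹ : OO n).1 := by
    have h1 : diagO k * crossMat A * diagO k'⁻¹ = crossMat B := by
      rw [h, mul_assoc, ← map_mul, mul_inv_cancel, map_one, mul_one]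
    rw [← toBlocks₂₁_crossMat, ← h1, toBlocks₂₁_diagO_mul_mul, toBlocks₂₁_crossMat]
  have eB : B = conjSym k A := by
    apply Subtype.ext
    rw [← symSqrt_mul_self B]
    nth_rw 2 [← symSqrt_transpose B]
    rw [e, Matrix.transpose_mul, Matrix.transpose_mul, symSqrt_transpose, OO.coe_inv,
      Matrix.transpose_transpose]
    calc _ = k.1 * symSqrt A * (k'.1.transpose * k'.1) * symSqrt A * k.1.transpose := by
          simp only [mul_assoc]
      _ = k.1 * (symSqrt A * symSqrt A) * k.1.transpose := by
          rw [OO.transpose_mul, mul_one]; simp only [mul_assoc]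
      _ = _ := by rw [symSqrt_mul_self]; rfl
  refine ⟨?_, eB⟩
  rw [eB, symSqrt_conjSym] at e
  have hu : IsUnit (k.1 * symSqrt A) := by
    rw [Matrix.isUnit_iff_isUnit_det, Matrix.det_mul]
    exact (Matrix.isUnit_det_of_right_inverse (OO.mul_transpose k)).mul (symSqrt_isUnit_det A)
  have := hu.mul_left_cancel e
  exact (inv_injective (Subtype.ext this)).symm

lemma posDef_transpose_mul_self {C D : Matrix (Fin n) (Fin n) ℝ} (h : D * C = 1) :
    (C.transpose * C).PosDef := by
  have := Matrix.PosDef.conjTranspose_mul_self C (Matrix.mulVec_injective_of_isUnit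
    ((Matrix.isUnit_iff_isUnit_det _).mpr (Matrix.isUnit_det_of_left_inverse h)))
  simpa using this

/-- The orthogonal matrix `u` such that `u C` is symmetric positive definite, where `D = C⁻¹`. -/
def polarFactor (C D : Matrix (Fin n) (Fin n) ℝ) (h : D * C = 1) : OO n :=
  ⟨symSqrt ⟨C.transpose * C, posDef_transpose_mul_self h⟩ * D, by
    set A : SymPos n := ⟨C.transpose * C, posDef_transpose_mul_self h⟩
    have h' : C * D = 1 := mul_eq_one_comm.mp h
    rw [Matrix.mem_orthogonalGroup_iff', Matrix.transpose_mul, symSqrt_transpose]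
    calc _ = D.transpose * (symSqrt A * symSqrt A) * D := by simp only [mul_assoc]
      _ = D.transpose * (C.transpose * C) * D := by rw [symSqrt_mul_self]
      _ = (C * D).transpose * (C * D) := by rw [Matrix.transpose_mul]; simp only [mul_assoc]
      _ = 1 := by rw [h']; simp⟩

lemma polarFactor_mul (C D : Matrix (Fin n) (Fin n) ℝ) (h : D * C = 1) :
    (polarFactor C D h).1 * C = symSqrt ⟨C.transpose * C, posDef_transpose_mul_self h⟩ := by
  rw [polarFactor, mul_assoc, h, mul_one]

lemma posDef_mul_self {P : Matrix (Fin n) (Fin n) ℝ} (h : P.PosDef) : (P * P).PosDef := by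
  have e : P.transpose = P := by simpa [Matrix.IsHermitian] using h.isHermitian
  have := posDef_transpose_mul_self (C := P) (D := P⁻¹)
    (Matrix.nonsing_inv_mul _ (isUnit_iff_ne_zero.mpr h.det_pos.ne'))
  rwa [e] at this

/-- A matrix exchanging `Span(e)` and `Span(f)` is determined by its lower left block, and a
positive definite block is the square root of its square. -/
lemma eq_crossMat {g : Sp n} (hE : g • lagE n = lagF n) (hF : g • lagF n = lagE n)
    (h : g.1.toBlocks₂₁.PosDef) :
    g = crossMat ⟨g.1.toBlocks₂₁ * g.1.toBlocks₂₁, posDef_mul_self h⟩ := by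
  apply eq_of_swap hE hF (crossMat_smul_lagE _) (crossMat_smul_lagF _)
  rw [toBlocks₂₁_crossMat, symSqrt_eq_of_mul_self h.posSemidef rfl]

/-! ### Moving positive triples to the standard position. -/

/-- A linear symplectic automorphism of `ℝ²ⁿ` is given by a symplectic matrix. -/
lemma exists_spEquiv_eq (ψ : R2 n →ₗ[ℝ] R2 n)
    (hψ : ∀ x y, stdForm n (ψ x) (ψ y) = stdForm n x y) :
    ∃ g : Sp n, ∀ x, spEquiv g x = ψ x := by
  refine ⟨⟨LinearMap.toMatrix' ψ, ?_⟩, fun x => ?_⟩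
  · rw [SymplecticGroup.mem_iff']
    have h : (Matrix.fromBlocks 0 1 (-1) 0 : Matrix (Fin n ⊕ Fin n) (Fin n ⊕ Fin n) ℝ)
        = - Matrix.J (Fin n) ℝ := by
      simp [Matrix.J, Matrix.fromBlocks_neg]
    have h2 : (stdForm n).comp ψ ψ = stdForm n := by
      ext x y; simp [hψ]
    rw [stdForm, h, ← Matrix.toLin'_toMatrix' ψ, Matrix.toBilin'_comp] at h2
    have h3 := Matrix.toBilin'.injective h2
    simpa using h3
  · rw [spEquiv_apply, LinearMap.toMatrix'_mulVec]

lemma spEquiv_injective : Function.Injective (spEquiv : Sp n → (R2 n ≃ₗ[ℝ] R2 n)) := by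
  intro g h e
  apply Subtype.ext
  apply Matrix.toLin'.injective
  exact congrArg LinearEquiv.toLinearMap e

/-- Positive triples of Lagrangians of `ℝ²ⁿ` can be moved to the standard triple. -/
lemma PosTriple.exists_smul_eq {L₁ M L₂ : Lag n} (h : PosTriple (stdForm n) L₁.1 M.1 L₂.1) :
    ∃ g : Sp n, g • L₁ = lagE n ∧ g • M = lagD n ∧ g • L₂ = lagF n := by
  obtain ⟨ψ, hψ, hE, hD, hF⟩ := h.exists_frame (finrank_R2 n) (stdForm_isAlt n) L₁.2 M.2 L₂.2
  obtain ⟨g, hg⟩ := exists_spEquiv_eq ψ.toLinearMap hψ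
  simp only [LinearEquiv.coe_coe, spEquiv_apply] at hg
  refine ⟨g⁻¹, ?_, ?_, ?_⟩ <;> rw [inv_smul_eq_iff, eq_comm, smul_lag_eq_iff]
  · intro x hx; rw [hg]; exact hE x hx
  · intro x hx; rw [hg]; exact hD x hx
  · intro x hx; rw [hg]; exact hF x hx

lemma posTriple_std (n : ℕ) : PosTriple (stdForm n) (stdE n) (stdD n) (stdF n) := by
  constructor
  · intro a h₁ h₂
    rw [mem_stdE] at h₁
    rw [mem_stdF] at h₂
    ext (i | i)
    · exact h₂ i
    · exact h₁ i
  · intro a ha c hc hac h0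
    rw [mem_stdE] at ha
    rw [mem_stdF] at hc
    rw [mem_stdD] at hac
    have e : ∀ i, a (Sum.inl i) = c (Sum.inr i) := fun i => by simpa [ha, hc] using hac i
    rw [stdForm_apply]
    simp only [e, ha, zero_mul, Finset.sum_const_zero, sub_zero]
    refine Finset.sum_pos' (fun i _ => mul_self_nonneg _) ?_
    by_contra hne
    push Not at hne
    apply h0
    have hz : ∀ i, c (Sum.inr i) = 0 := fun i =>
      mul_self_eq_zero.mp (le_antisymm (hne i (Finset.mem_univ i)) (mul_self_nonneg _))
    ext (i | i)
    · simp [e, hz, hc]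
    · simp [ha, hz]

lemma PosTriple.map {F F' : Type*} [AddCommGroup F] [Module ℝ F] [AddCommGroup F'] [Module ℝ F']
    {ω : LinearMap.BilinForm ℝ F} {ω' : LinearMap.BilinForm ℝ F'} (ψ : F ≃ₗ[ℝ] F')
    (hψ : ∀ x y, ω' (ψ x) (ψ y) = ω x y) {L₁ M L₂ : Submodule ℝ F} (h : PosTriple ω L₁ M L₂) :
    PosTriple ω' (L₁.map ψ.toLinearMap) (M.map ψ.toLinearMap) (L₂.map ψ.toLinearMap) := by
  constructor
  · rintro _ ⟨a, ha, rfl⟩ ⟨b, hb, e⟩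
    have : b = a := ψ.injective e
    subst this
    rw [h.1 b ha hb]
    simp
  · rintro _ ⟨a, ha, rfl⟩ _ ⟨c, hc, rfl⟩ ⟨m, hm, e⟩ h0
    have e' : m = a + c := ψ.injective (by rw [map_add]; exact e)
    subst e'
    exact (h.2 a ha c hc hm (by rintro h1; apply h0; rw [← e, h1]; simp)).trans_eq (hψ a c).symm

lemma PosTriple.smul {L₁ M L₂ : Lag n} (h : PosTriple (stdForm n) L₁.1 M.1 L₂.1) (g : Sp n) :
    PosTriple (stdForm n) (g • L₁).1 (g • M).1 (g • L₂).1 :=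
  h.map (spEquiv g) (stdForm_spEquiv g)

end Matrices

/-! ### Continuity of the square root and of the transition matrices -/

section Continuity

open Topology Filter

variable {n : ℕ}

/-- The square of the Frobenius norm. -/
def frobSq (A : Matrix (Fin n) (Fin n) ℝ) : ℝ := ∑ i, ∑ j, A i j ^ 2

lemma frobSq_eq_trace (A : Matrix (Fin n) (Fin n) ℝ) : frobSq A = (A.transpose * A).trace := by
  simp only [frobSq, Matrix.trace, Matrix.diag, Matrix.mul_apply, Matrix.transpose_apply]
  rw [Finset.sum_comm]
  simp only [sq]

lemma frobSq_mul_le (A B : Matrix (Fin n) (Fin n) ℝ) : frobSq (A * B) ≤ frobSq A * frobSq B := by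
  have h : ∀ i j, (A * B) i j ^ 2 ≤ (∑ k, A i k ^ 2) * ∑ k, B k j ^ 2 := fun i j => by
    rw [Matrix.mul_apply]
    exact Finset.sum_mul_sq_le_sq_mul_sq _ _ _
  calc frobSq (A * B) ≤ ∑ i, ∑ j, (∑ k, A i k ^ 2) * ∑ k, B k j ^ 2 :=
        Finset.sum_le_sum fun i _ => Finset.sum_le_sum fun j _ => h i j
    _ = frobSq A * frobSq B := by
        simp only [← Finset.mul_sum, ← Finset.sum_mul]
        rw [frobSq, frobSq, Finset.sum_comm (f := fun i j => B i j ^ 2)]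

lemma sq_apply_le_frobSq (A : Matrix (Fin n) (Fin n) ℝ) (i j : Fin n) : A i j ^ 2 ≤ frobSq A :=
  (Finset.single_le_sum (f := fun j => A i j ^ 2) (fun _ _ => sq_nonneg _)
    (Finset.mem_univ j)).trans
  (Finset.single_le_sum (f := fun i => ∑ j, A i j ^ 2)
    (fun _ _ => Finset.sum_nonneg fun _ _ => sq_nonneg _) (Finset.mem_univ i))

lemma frobSq_nonneg (A : Matrix (Fin n) (Fin n) ℝ) : 0 ≤ frobSq A :=
  Finset.sum_nonneg fun _ _ => Finset.sum_nonneg fun _ _ => sq_nonneg _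

lemma two_mul_trace_transpose_mul_le (A B : Matrix (Fin n) (Fin n) ℝ) {K : ℝ} (hK : 0 < K) :
    2 * (A.transpose * B).trace ≤ K⁻¹ * frobSq A + K * frobSq B := by
  have e : (A.transpose * B).trace = ∑ i, ∑ j, A i j * B i j := by
    simp only [Matrix.trace, Matrix.diag, Matrix.mul_apply, Matrix.transpose_apply]
    rw [Finset.sum_comm]
  rw [e, frobSq, frobSq]
  simp only [Finset.mul_sum, ← Finset.sum_add_distrib]
  refine Finset.sum_le_sum fun i _ => Finset.sum_le_sum fun j _ => ?_
  have h := mul_nonneg (inv_pos.mpr hK).le (sq_nonneg (A i j - K * B i j))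
  have e2 : K⁻¹ * (A i j - K * B i j) ^ 2
      = K⁻¹ * A i j ^ 2 + K * B i j ^ 2 - 2 * (A i j * B i j) := by
    field_simp
    ring
  linarith

/-- The square root is locally Lipschitz for the Frobenius norm. -/
lemma exists_frobSq_symSqrt_sub_le (A : SymPos n) :
    ∃ K : ℝ, 0 < K ∧ ∀ B : SymPos n,
      frobSq (symSqrt A - symSqrt B) ≤ K * frobSq (A.1 - B.1) := by
  -- With `P = √A`, `Q = √B`, `D = P - Q` one has `A - B = PD + DQ`. Hence `tr(D(A - B)) = tr(DPD) +
  -- tr(DQD) ≥ tr(DPD) = ‖RD‖²`, where `R` is the square root of `P`, and `‖RD‖² ≥ K⁻¹‖D‖²`. The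
  -- inequality between arithmetic and geometric means bounds `2 tr(D(A - B))` by `K⁻¹‖D‖² + K‖A -
  -- B‖²`, whose first term is absorbed.
  set P := symSqrt A with hP
  let R := symSqrt ⟨P, symSqrt_posDef A⟩
  have hR : R * R = P := symSqrt_mul_self _
  have hRt : R.transpose = R := symSqrt_transpose _
  -- The summand `1` keeps `K` positive also for `n = 0`.
  set K := frobSq R⁻¹ + 1 with hKdef
  have hK : 0 < K := by have := frobSq_nonneg R⁻¹; linarith
  refine ⟨K ^ 2, by positivity, fun B => ?_⟩
  set Q := symSqrt B with hQ
  set D := P - Q with hD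
  have hPt : P.transpose = P := symSqrt_transpose A
  have hQt : Q.transpose = Q := symSqrt_transpose B
  have hDt : D.transpose = D := by rw [hD, Matrix.transpose_sub, hPt, hQt]
  have h1 : frobSq D ≤ K * frobSq (R * D) := by
    have : D = R⁻¹ * (R * D) := by
      rw [← mul_assoc, Matrix.nonsing_inv_mul _ (symSqrt_isUnit_det _), one_mul]
    calc frobSq D = frobSq (R⁻¹ * (R * D)) := by rw [← this]
      _ ≤ frobSq R⁻¹ * frobSq (R * D) := frobSq_mul_le _ _
      _ ≤ K * frobSq (R * D) :=
        mul_le_mul_of_nonneg_right (by linarith) (frobSq_nonneg _)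
  have h2 : frobSq (R * D) = (D * P * D).trace := by
    rw [frobSq_eq_trace, Matrix.transpose_mul, hRt, hDt, ← hR]
    simp only [mul_assoc]
  have h3 : 0 ≤ (D * Q * D).trace := by
    have := (symSqrt_posDef B).posSemidef.conjTranspose_mul_mul_same D
    rw [Matrix.conjTranspose_eq_transpose_of_trivial, hDt] at this
    exact this.trace_nonneg
  have h4 : (D.transpose * (A.1 - B.1)).trace = (D * P * D).trace + (D * Q * D).trace := by
    have e : A.1 - B.1 = P * D + D * Q := by
      rw [← symSqrt_mul_self A, ← symSqrt_mul_self B, ← hP, ← hQ, hD]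
      noncomm_ring
    rw [e, hDt, mul_add, Matrix.trace_add, ← mul_assoc]
    congr 1
    rw [Matrix.trace_mul_comm, mul_assoc, Matrix.trace_mul_comm D (Q * D), mul_assoc,
      Matrix.trace_mul_comm, mul_assoc, Matrix.trace_mul_comm]
  have h5 := two_mul_trace_transpose_mul_le D (A.1 - B.1) hK
  have h6 : K⁻¹ * frobSq D ≤ frobSq (R * D) := by
    rw [inv_mul_le_iff₀ hK]; exact h1
  have h7 : frobSq (R * D) ≤ K * frobSq (A.1 - B.1) := by
    rw [h4] at h5; linarith
  calc frobSq D ≤ K * frobSq (R * D) := h1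
    _ ≤ K * (K * frobSq (A.1 - B.1)) := mul_le_mul_of_nonneg_left h7 hK.le
    _ = K ^ 2 * frobSq (A.1 - B.1) := by ring

lemma continuous_symSqrt : Continuous (symSqrt : SymPos n → Matrix (Fin n) (Fin n) ℝ) := by
  refine continuous_matrix fun i j => continuous_iff_continuousAt.mpr fun A => ?_
  obtain ⟨K, hK, h⟩ := exists_frobSq_symSqrt_sub_le A
  have hc : Continuous fun B : SymPos n => Real.sqrt (K * frobSq (A.1 - B.1)) := by
    have : ∀ i j, Continuous fun B : SymPos n => B.1 i j :=
      fun i j => continuous_subtype_val.matrix_elem i j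
    unfold frobSq
    simp only [Matrix.sub_apply]
    exact (continuous_const.mul (continuous_finsetSum _ fun i _ => continuous_finsetSum _
      fun j _ => (continuous_const.sub (this i j)).pow 2)).sqrt
  have h0 : Tendsto (fun B : SymPos n => Real.sqrt (K * frobSq (A.1 - B.1))) (𝓝 A) (𝓝 0) := by
    have := hc.tendsto A
    simpa [frobSq] using this
  rw [ContinuousAt, tendsto_iff_norm_sub_tendsto_zero]
  refine squeeze_zero (fun _ => norm_nonneg _) (fun B => ?_) h0
  rw [Real.norm_eq_abs, ← Real.sqrt_sq_eq_abs]
  apply Real.sqrt_le_sqrt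
  have := sq_apply_le_frobSq (symSqrt A - symSqrt B) i j
  rw [Matrix.sub_apply] at this
  calc _ = (symSqrt A i j - symSqrt B i j) ^ 2 := by ring
    _ ≤ _ := this.trans (h B)

lemma Continuous.matrix_inv_of_isUnit {X : Type*} [TopologicalSpace X]
    {f : X → Matrix (Fin n) (Fin n) ℝ} (hf : Continuous f) (h : ∀ x, IsUnit (f x).det) :
    Continuous fun x => (f x)⁻¹ := by
  have e : (fun x => (f x)⁻¹) = fun x => ((f x).det)⁻¹ • (f x).adjugate := by
    funext x
    rw [Matrix.inv_def, Ring.inverse_eq_inv']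
  rw [e]
  exact (hf.matrix_det.inv₀ fun x => (h x).ne_zero).smul hf.matrix_adjugate

lemma continuous_crossMat : Continuous (crossMat : SymPos n → Sp n) := by
  apply Continuous.subtype_mk
  exact continuous_const.matrix_fromBlocks
    (continuous_symSqrt.matrix_inv_of_isUnit symSqrt_isUnit_det).neg continuous_symSqrt
    continuous_const

lemma continuous_turnMat : Continuous (turnMat : OO n → Sp n) := by
  apply Continuous.subtype_mk
  exact continuous_subtype_val.matrix_fromBlocks continuous_subtype_val.neg continuous_subtype_val
    continuous_const

instance : IsTopologicalGroup (Sp n) where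
  continuous_inv := by
    apply Continuous.subtype_mk
    exact (continuous_const.matrix_mul continuous_subtype_val.matrix_transpose).matrix_mul
      continuous_const

lemma continuous_polarFactor {X : Type*} [TopologicalSpace X]
    {C D : X → Matrix (Fin n) (Fin n) ℝ} (hC : Continuous C) (hD : Continuous D)
    (h : ∀ x, D x * C x = 1) : Continuous fun x => polarFactor (C x) (D x) (h x) := by
  apply Continuous.subtype_mk
  refine Continuous.matrix_mul (continuous_symSqrt.comp ?_) hD
  exact Continuous.subtype_mk (hC.matrix_transpose.matrix_mul hC) _

lemma continuous_toBlocks₁₁ : Continuous fun g : Sp n => g.1.toBlocks₁₁ :=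
  continuous_subtype_val.matrix_submatrix Sum.inl Sum.inl

lemma continuous_toBlocks₁₂ : Continuous fun g : Sp n => g.1.toBlocks₁₂ :=
  continuous_subtype_val.matrix_submatrix Sum.inl Sum.inr

lemma continuous_toBlocks₂₁ : Continuous fun g : Sp n => g.1.toBlocks₂₁ :=
  continuous_subtype_val.matrix_submatrix Sum.inr Sum.inl

/-! ### The Lagrangian Grassmannian -/

/-- The symplectic matrix `(0 -1; 1 0)`. -/
def spJ (n : ℕ) : Sp n := SymplecticGroup.symJ (Fin n) ℝ

lemma coe_spJ : (spJ n).1 = Matrix.fromBlocks 0 (-1) 1 0 := rfl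

lemma spJ_smul_lagE : spJ n • lagE n = lagF n := by
  rw [smul_lagE_eq_lagF]; simp [coe_spJ]

lemma spJ_smul_lagF : spJ n • lagF n = lagE n := by
  rw [smul_lagF_eq_lagE]; simp [coe_spJ]

/-- The matrix `spJ` is the standard complex structure compatible with the symplectic form: `ω(x,
Jx)` is the square of the Euclidean norm. -/
lemma stdForm_spJ_pos {x : R2 n} (hx : x ≠ 0) : 0 < stdForm n x (spEquiv (spJ n) x) := by
  have e : stdForm n x (spEquiv (spJ n) x) = ∑ k, x k * x k := by
    rw [stdForm_apply, Fintype.sum_sum_type, spEquiv_apply, coe_spJ, ← Sum.elim_comp_inl_inr x,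
      Matrix.fromBlocks_mulVec]
    simp [Matrix.neg_mulVec]
  rw [e]
  refine Finset.sum_pos' (fun i _ => mul_self_nonneg _) ?_
  obtain ⟨k, hk⟩ := Function.ne_iff.mp hx
  exact ⟨k, Finset.mem_univ k, mul_self_pos.mpr hk⟩

lemma spJ_spJ (x : R2 n) : spEquiv (spJ n) (spEquiv (spJ n) x) = -x := by
  rw [← spEquiv_mul, spEquiv_apply]
  have : (spJ n * spJ n).1 = -1 := Matrix.J_squared (Fin n) ℝ
  rw [this, Matrix.neg_mulVec, Matrix.one_mulVec]

/-- The symplectic group acts transitively on the Lagrangian Grassmannian. -/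
lemma exists_smul_lagE_eq (L : Lag n) : ∃ g : Sp n, g • lagE n = L := by
  have hd : ∀ x ∈ L.1, x + spEquiv (spJ n) x = 0 → x = 0 := by
    intro x hx h
    by_contra h0
    have := stdForm_spJ_pos h0
    rw [eq_neg_of_add_eq_zero_right h, map_neg, stdForm_isAlt n x] at this
    simp at this
  -- Writing `J` for `spJ n`, the triple `(L, (1 + J)L, JL)` is positive because `ω(x, Jx) = |x|²`.
  -- Positive triples being movable to the standard one, `L` is in the orbit of `Span(e)`.
  let f : R2 n →ₗ[ℝ] R2 n := LinearMap.id + (spEquiv (spJ n)).toLinearMap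
  let M : Lag n := ⟨L.1.map f, by
    constructor
    · refine Eq.trans ?_ L.2.1
      let g : L.1 ≃ₗ[ℝ] L.1.map f := LinearEquiv.ofBijective (f.submoduleMap L.1)
        ⟨by
          rw [injective_iff_map_eq_zero]
          rintro ⟨x, hx⟩ h
          have : f x = 0 := congrArg Subtype.val h
          exact Subtype.ext (hd x hx this), f.submoduleMap_surjective L.1⟩
      exact g.finrank_eq.symm
    · rintro _ ⟨x, hx, rfl⟩ _ ⟨y, hy, rfl⟩
      have h1 := L.2.2 x hx y hy
      have h2 := stdForm_spEquiv (spJ n) x y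
      have h3 := stdForm_spEquiv (spJ n) (spEquiv (spJ n) x) y
      rw [spJ_spJ, map_neg, LinearMap.neg_apply] at h3
      simp only [f, LinearMap.add_apply, LinearMap.id_apply, LinearEquiv.coe_coe, map_add]
      linarith⟩
  have hpos : PosTriple (stdForm n) L.1 M.1 (spJ n • L).1 := by
    constructor
    · rintro _ ha ⟨x, hx, rfl⟩
      have : x = 0 := by
        by_contra h0
        exact (stdForm_spJ_pos h0).ne' (L.2.2 x hx _ ha)
      rw [this]; simp
    · rintro a ha _ ⟨c, hc, rfl⟩ ⟨m, hm, hmc⟩ h0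
      -- From `m + Jm = a + Jc` it follows that `m - a = J(c - m)` is in `L ∩ JL = 0`.
      have h1 : m - a = 0 := by
        by_contra h1
        apply (stdForm_spJ_pos h1).ne'
        have e : m - a = spEquiv (spJ n) c - spEquiv (spJ n) m := by
          have : m + spEquiv (spJ n) m = a + spEquiv (spJ n) c := hmc
          rw [sub_eq_sub_iff_add_eq_add, this, add_comm]
        have e2 : spEquiv (spJ n) (m - a) = m - c := by
          rw [e, map_sub, spJ_spJ, spJ_spJ]; abel
        rw [e2]
        exact L.2.2 _ (L.1.sub_mem hm ha) _ (L.1.sub_mem hm hc)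
      have h2 : m = a := sub_eq_zero.mp h1
      have h3 : spEquiv (spJ n) m = spEquiv (spJ n) c := by
        have : m + spEquiv (spJ n) m = a + spEquiv (spJ n) c := hmc
        rw [h2] at this ⊢
        exact add_left_cancel this
      have h4 : a = c := h2 ▸ (spEquiv (spJ n)).injective h3
      subst h4
      apply stdForm_spJ_pos
      rintro rfl
      simp at h0
  obtain ⟨g, hg, -, -⟩ := hpos.exists_smul_eq
  exact ⟨g⁻¹, by rw [← hg, inv_smul_smul]⟩

/-- The saturation of an open set is the union of its right translates by the stabilizer of
`Span(e)`. Openness, and not only the quotient property, is what allows products with other spaces.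
-/
lemma isOpenQuotientMap_smul_lagE : IsOpenQuotientMap fun g : Sp n => g • lagE n where
  surjective := exists_smul_lagE_eq
  continuous := continuous_coinduced_rng
  isOpenMap := by
    intro V hV
    rw [isOpen_coinduced]
    have e : (fun g : Sp n => g • lagE n) ⁻¹' ((fun g : Sp n => g • lagE n) '' V)
        = ⋃ h : {h : Sp n // h • lagE n = lagE n}, (fun g => g * h.1) ⁻¹' V := by
      ext g
      simp only [Set.mem_preimage, Set.mem_image, Set.mem_iUnion]
      constructor
      · rintro ⟨g', hg', e⟩
        refine ⟨⟨g⁻¹ * g', ?_⟩, ?_⟩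
        · rw [mul_smul, e, inv_smul_smul]
        · simpa using hg'
      · rintro ⟨⟨h, hh⟩, hg⟩
        exact ⟨g * h, hg, by rw [mul_smul, hh]⟩
    rw [e]
    exact isOpen_iUnion fun h => hV.preimage (continuous_mul_const h.1)

instance : ContinuousSMul (Sp n) (Lag n) where
  continuous_smul := by
    -- Open quotient maps are stable under products, so continuity can be checked after lifting the
    -- Lagrangian to a matrix, where the action becomes multiplication.
    rw [← (IsOpenQuotientMap.id.prodMap isOpenQuotientMap_smul_lagE).continuous_comp_iff]
    have : ((fun p : Sp n × Lag n => p.1 • p.2) ∘ Prod.map id fun g : Sp n => g • lagE n)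
        = (fun g : Sp n => g • lagE n) ∘ fun p : Sp n × Sp n => p.1 * p.2 := by
      funext p
      exact (mul_smul _ _ _).symm
    rw [this]
    exact isOpenQuotientMap_smul_lagE.continuous.comp continuous_mul

/-! ### The chart of Lagrangians transverse to `Span(f)`, and continuous frames. -/

/-- Symmetric matrices. -/
abbrev SymMat (n : ℕ) := {A : Matrix (Fin n) (Fin n) ℝ // A.transpose = A}

/-- The symplectic matrix `(1 0; A 1)`. -/
def lowerMat (A : SymMat n) : Sp n :=
  ⟨Matrix.fromBlocks 1 0 A.1 1, by
    rw [SymplecticGroup.fromBlocks_mem_iff]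
    simp [A.2]⟩

lemma continuous_lowerMat : Continuous (lowerMat : SymMat n → Sp n) := by
  apply Continuous.subtype_mk
  exact continuous_const.matrix_fromBlocks continuous_const continuous_subtype_val continuous_const

lemma lowerMat_smul_lagF (A : SymMat n) : lowerMat A • lagF n = lagF n := by
  rw [smul_lagF_eq_lagF]; simp [lowerMat]

lemma inv_lowerMat (A : SymMat n) : (lowerMat A)⁻¹ = lowerMat ⟨-A.1, by simp [A.2]⟩ := by
  rw [inv_eq_iff_mul_eq_one]
  apply Subtype.ext
  simp [lowerMat, Matrix.fromBlocks_multiply]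

lemma lowerMat_smul_lagE_eq (A : SymMat n) (g : Sp n) :
    lowerMat A • lagE n = g • lagE n ↔ g.1.toBlocks₂₁ = A.1 * g.1.toBlocks₁₁ := by
  rw [eq_comm, ← inv_smul_eq_iff, ← mul_smul, smul_lagE_eq_lagE, inv_lowerMat]
  have : (lowerMat (⟨-A.1, by simp [A.2]⟩ : SymMat n) * g).1 = Matrix.fromBlocks 1 0 (-A.1) 1 *
    Matrix.fromBlocks g.1.toBlocks₁₁ g.1.toBlocks₁₂ g.1.toBlocks₂₁ g.1.toBlocks₂₂ := by
    rw [Matrix.fromBlocks_toBlocks]; rfl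
  rw [this]
  simp only [Matrix.fromBlocks_multiply, Matrix.toBlocks_fromBlocks₂₁, Matrix.one_mul,
    Matrix.neg_mul]
  rw [neg_add_eq_zero, eq_comm]

/-- The Lagrangians that are graphs of symmetric matrices over `Span(e)`. -/
def graphLag (n : ℕ) : Set (Lag n) := Set.range fun A : SymMat n => lowerMat A • lagE n

open Classical in
/-- The symmetric matrix of which the Lagrangian is the graph. -/
def graphSlope (L : Lag n) : SymMat n :=
  if h : ∃ A : SymMat n, lowerMat A • lagE n = L then h.choose else ⟨0, by simp⟩

lemma lowerMat_slope {L : Lag n} (h : L ∈ graphLag n) : lowerMat (graphSlope L) • lagE n = L := by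
  have h' : ∃ A : SymMat n, lowerMat A • lagE n = L := h
  rw [graphSlope, dif_pos h']
  exact h'.choose_spec

/-- The Lagrangian `g • Span(e)` is spanned by the first block column `(a; c)` of `g`. If `a` is
invertible, this is the graph of `c a⁻¹`, which is symmetric because `ᵗa c = ᵗc a`. -/
lemma smul_lagE_mem_graphLag (g : Sp n) :
    g • lagE n ∈ graphLag n ↔ IsUnit g.1.toBlocks₁₁.det := by
  constructor
  · rintro ⟨A, hA⟩
    replace hA := (lowerMat_smul_lagE_eq A g).mp hA
    have hb := (Sp.blocks g).2.2
    rw [hA, Matrix.transpose_mul, mul_assoc, ← mul_sub] at hb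
    rw [← Matrix.det_transpose]
    exact Matrix.isUnit_det_of_right_inverse hb
  · intro h
    have hb := (Sp.blocks g).1
    set a := g.1.toBlocks₁₁
    set c := g.1.toBlocks₂₁
    have ht : IsUnit a.transpose.det := by rwa [Matrix.det_transpose]
    refine ⟨⟨c * a⁻¹, ?_⟩, ?_⟩
    · rw [Matrix.transpose_mul, Matrix.transpose_nonsing_inv]
      calc a.transpose⁻¹ * c.transpose = a.transpose⁻¹ * (c.transpose * a) * a⁻¹ := by
            rw [mul_assoc, mul_assoc, Matrix.mul_nonsing_inv _ h, mul_one]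
        _ = a.transpose⁻¹ * a.transpose * c * a⁻¹ := by rw [← hb]; simp only [mul_assoc]
        _ = c * a⁻¹ := by rw [Matrix.nonsing_inv_mul _ ht, one_mul]
    · change lowerMat _ • lagE n = g • lagE n
      rw [lowerMat_smul_lagE_eq]
      change c = c * a⁻¹ * a
      rw [mul_assoc, Matrix.nonsing_inv_mul _ h, mul_one]

lemma slope_smul_lagE {g : Sp n} (h : IsUnit g.1.toBlocks₁₁.det) :
    (graphSlope (g • lagE n)).1 = g.1.toBlocks₂₁ * g.1.toBlocks₁₁⁻¹ := by
  have := (lowerMat_smul_lagE_eq _ g).mp (lowerMat_slope ((smul_lagE_mem_graphLag g).mpr h))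
  rw [this, mul_assoc, Matrix.mul_nonsing_inv _ h, mul_one]

lemma isOpen_graphLag : IsOpen (graphLag n) := by
  rw [isOpen_coinduced]
  have : (fun g : Sp n => g • lagE n) ⁻¹' graphLag n
      = {g : Sp n | g.1.toBlocks₁₁.det ≠ 0} := by
    ext g
    rw [Set.mem_preimage, smul_lagE_mem_graphLag, isUnit_iff_ne_zero]
    rfl
  rw [this]
  exact isOpen_ne_fun continuous_toBlocks₁₁.matrix_det continuous_const

lemma continuousOn_slope : ContinuousOn (graphSlope : Lag n → SymMat n) (graphLag n) := by
  rw [isOpenQuotientMap_smul_lagE.isQuotientMap.continuousOn_isOpen_iff isOpen_graphLag,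
    continuousOn_iff_continuous_domRestrict]
  rw [continuous_induced_rng]
  have h : ∀ g : ((fun g : Sp n => g • lagE n) ⁻¹' graphLag n), IsUnit g.1.1.toBlocks₁₁.det :=
    fun g => (smul_lagE_mem_graphLag g.1).mp g.2
  have e : (fun g : ((fun g : Sp n => g • lagE n) ⁻¹' graphLag n) => (graphSlope (g.1 • lagE n)).1)
      = fun g => g.1.1.toBlocks₂₁ * g.1.1.toBlocks₁₁⁻¹ := funext fun g => slope_smul_lagE (h g)
  change Continuous fun g : ((fun g : Sp n => g • lagE n) ⁻¹' graphLag n) =>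
    (graphSlope (g.1 • lagE n)).1
  rw [e]
  exact (continuous_toBlocks₂₁.comp continuous_subtype_val).matrix_mul
    ((continuous_toBlocks₁₁.comp continuous_subtype_val).matrix_inv_of_isUnit h)

/-- A kernel vector of the upper left block of `g` is sent by `g` to a vector of `Span(f)`, which
must be `0`. -/
lemma mem_graphLag_of_disjoint {L : Lag n} (h : ∀ x ∈ L.1, x ∈ stdF n → x = 0) :
    L ∈ graphLag n := by
  obtain ⟨g, rfl⟩ := exists_smul_lagE_eq L
  rw [smul_lagE_mem_graphLag, isUnit_iff_ne_zero]
  intro h0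
  obtain ⟨a, ha, ha'⟩ := Matrix.exists_mulVec_eq_zero_iff.mpr h0
  have hm : (Sum.elim a 0 : R2 n) ∈ (lagE n).1 := elim_mem_stdE.mpr rfl
  have h1 : spEquiv g (Sum.elim a 0) = 0 := by
    refine h _ ⟨_, hm, rfl⟩ ?_
    rw [spEquiv_apply, fromBlocks_toBlocks_mulVec, elim_mem_stdF]
    simpa using ha'
  have h2 : (Sum.elim a 0 : R2 n) = 0 := by simpa using h1
  exact ha (by simpa using congrArg (fun x : R2 n => x ∘ Sum.inl) h2)

/-- A continuous choice of frames for a continuous family of positive triples whose first member is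
transverse to `Span(f)`. -/
lemma exists_continuous_frame_of_mem_graphLag {X : Type*} [TopologicalSpace X]
    {L₁ M L₂ : X → Lag n} (h₁ : Continuous L₁) (hM : Continuous M) (h₂ : Continuous L₂)
    (hpos : ∀ x, PosTriple (stdForm n) (L₁ x).1 (M x).1 (L₂ x).1)
    (hg : ∀ x, L₁ x ∈ graphLag n) :
    ∃ φ : X → Sp n, Continuous φ ∧
      ∀ x, φ x • L₁ x = lagE n ∧ φ x • M x = lagD n ∧ φ x • L₂ x = lagF n := by
  have hcomp : ∀ L : X → Lag n, Continuous L → (∀ x, L x ∈ graphLag n) →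
      Continuous fun x => lowerMat (graphSlope (L x)) := fun L hL hL' =>
    continuous_lowerMat.comp (continuousOn_slope.comp_continuous hL hL')
  -- The frame is a product of three matrices: `g₁` takes `L₁` to `Span(e)`; `g₂` fixes `Span(e)`
  -- and takes the image of `L₂` to `Span(f)`; `g₃` fixes both and takes the image of `M` to `Span(e
  -- + f)`. Each depends continuously on slopes in the chart.
  set g₁ : X → Sp n := fun x => (lowerMat (graphSlope (L₁ x)))⁻¹ with hg₁
  have cg₁ : Continuous g₁ := (hcomp L₁ h₁ hg).inv
  have e₁ : ∀ x, g₁ x • L₁ x = lagE n := fun x => by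
    rw [hg₁, inv_smul_eq_iff, lowerMat_slope (hg x)]
  -- Applying `J⁻¹`, where `J = spJ n`, turns transversality to `Span(e)` into transversality to
  -- `Span(f)`, so that the chart can be used.
  set L' : X → Lag n := fun x => (spJ n)⁻¹ • g₁ x • L₂ x with hL'
  have cL' : Continuous L' := (continuous_const_smul (spJ n)⁻¹).comp (cg₁.smul h₂)
  have mL' : ∀ x, L' x ∈ graphLag n := by
    intro x
    apply mem_graphLag_of_disjoint
    have hp := ((hpos x).smul (g₁ x)).smul (spJ n)⁻¹
    rw [e₁, inv_smul_eq_iff.mpr (spJ_smul_lagF (n := n)).symm] at hp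
    exact fun y hy hy' => hp.1 y hy' hy
  -- The conjugate of a lower shear by `J` is an upper shear; it fixes `Span(e)`.
  set g₂ : X → Sp n := fun x => spJ n * (lowerMat (graphSlope (L' x)))⁻¹ * (spJ n)⁻¹ with hg₂
  have cg₂ : Continuous g₂ := ((continuous_const.mul (hcomp L' cL' mL').inv)).mul continuous_const
  have e₂ : ∀ x, g₂ x • g₁ x • L₂ x = lagF n := fun x => by
    have := lowerMat_slope (mL' x)
    rw [hg₂, mul_smul, mul_smul]
    change spJ n • (lowerMat (graphSlope (L' x)))⁻¹ • L' x = _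
    rw [inv_smul_eq_iff.mpr this.symm, spJ_smul_lagE]
  have e₂' : ∀ x, g₂ x • lagE n = lagE n := fun x => by
    rw [hg₂, mul_smul, mul_smul, inv_smul_eq_iff.mpr (spJ_smul_lagF (n := n)).symm,
      inv_smul_eq_iff.mpr (lowerMat_smul_lagF _).symm, spJ_smul_lagF]
  set M' : X → Lag n := fun x => g₂ x • g₁ x • M x with hM'
  have cM' : Continuous M' := cg₂.smul (cg₁.smul hM)
  have pM' : ∀ x, PosTriple (stdForm n) (lagE n).1 (M' x).1 (lagF n).1 := fun x => by
    have hp := ((hpos x).smul (g₁ x)).smul (g₂ x)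
    rwa [e₁, e₂, e₂'] at hp
  have mM' : ∀ x, M' x ∈ graphLag n := fun x =>
    mem_graphLag_of_disjoint (pM' x).disjoint_right
  -- The vectors of `M'` are `(a, Ya)`, with `Y` the slope, and positivity of the triple reads `ᵗa Y
  -- a > 0`.
  have hY : ∀ x, (graphSlope (M' x)).1.PosDef := by
    intro x
    have hs := lowerMat_slope (mM' x)
    rw [smul_lag_eq_iff] at hs
    refine Matrix.PosDef.of_dotProduct_mulVec_pos (by
      simpa [Matrix.IsHermitian] using (graphSlope (M' x)).2) fun a ha => ?_
    have hm := hs (Sum.elim a 0) (elim_mem_stdE.mpr rfl)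
    have hm2 : Matrix.mulVec (lowerMat (graphSlope (M' x))).1 (Sum.elim a 0)
        = (Sum.elim a 0 : R2 n) + (Sum.elim 0 (Matrix.mulVec (graphSlope (M' x)).1 a) : R2 n) := by
      rw [lowerMat, Matrix.fromBlocks_mulVec]
      ext (i | i) <;> simp
    rw [hm2] at hm
    have := (pM' x).2 (Sum.elim a 0) (elim_mem_stdE.mpr rfl) _ (elim_mem_stdF.mpr rfl) hm (by
      intro h0
      exact ha (by simpa [funext_iff] using congrArg (fun x : R2 n => x ∘ Sum.inl) h0))
    rw [stdForm_apply] at this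
    simpa [dotProduct] using this
  -- This is the block diagonal matrix with blocks `Y^{1/2}` and `Y^{-1/2}`; it takes `(a, Ya)` to
  -- `(Y^{1/2}a, Y^{1/2}a)`.
  set g₃ : X → Sp n := fun x => (spJ n)⁻¹ * crossMat ⟨(graphSlope (M' x)).1, hY x⟩ with hg₃
  have cg₃ : Continuous g₃ := continuous_const.mul (continuous_crossMat.comp
    (Continuous.subtype_mk (continuous_subtype_val.comp
      (continuousOn_slope.comp_continuous cM' mM')) _))
  have e₃E : ∀ x, g₃ x • lagE n = lagE n := fun x => by
    rw [hg₃, mul_smul, crossMat_smul_lagE, inv_smul_eq_iff, spJ_smul_lagE]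
  have e₃F : ∀ x, g₃ x • lagF n = lagF n := fun x => by
    rw [hg₃, mul_smul, crossMat_smul_lagF, inv_smul_eq_iff, spJ_smul_lagF]
  have e₃ : ∀ x, g₃ x • M' x = lagD n := by
    intro x
    rw [← lowerMat_slope (mM' x), ← mul_smul, smul_lagE_eq_lagD]
    set Y : SymPos n := ⟨(graphSlope (M' x)).1, hY x⟩ with hYdef
    have h1 : ((spJ n)⁻¹ : Sp n).1 = Matrix.fromBlocks 0 1 (-1) 0 := by
      rw [SymplecticGroup.coe_inv, coe_spJ, Matrix.J]
      simp [Matrix.fromBlocks_multiply, Matrix.fromBlocks_transpose, Matrix.fromBlocks_neg]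
    have h2 : (g₃ x * lowerMat (graphSlope (M' x))).1 = Matrix.fromBlocks 0 1 (-1) 0 *
        Matrix.fromBlocks 0 (-(symSqrt Y)⁻¹) (symSqrt Y) 0 * Matrix.fromBlocks 1 0 Y.1 1 := by
      rw [← h1]; rfl
    rw [h2, ← symSqrt_mul_self Y]
    simp [Matrix.fromBlocks_multiply, ← mul_assoc,
      Matrix.nonsing_inv_mul _ (symSqrt_isUnit_det Y)]
  refine ⟨fun x => g₃ x * g₂ x * g₁ x, (cg₃.mul cg₂).mul cg₁, fun x => ⟨?_, ?_, ?_⟩⟩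
  · rw [mul_smul, mul_smul, e₁, e₂', e₃E]
  · rw [mul_smul, mul_smul]; exact e₃ x
  · rw [mul_smul, mul_smul, e₂, e₃F]

/-- Local continuous frames for a continuous family of positive triples. -/
lemma exists_continuous_frame {X : Type*} [TopologicalSpace X]
    {L₁ M L₂ : X → Lag n} (h₁ : Continuous L₁) (hM : Continuous M) (h₂ : Continuous L₂)
    (hpos : ∀ x, PosTriple (stdForm n) (L₁ x).1 (M x).1 (L₂ x).1) (x₀ : X) :
    ∃ U : Set X, IsOpen U ∧ x₀ ∈ U ∧ ∃ φ : X → Sp n, ContinuousOn φ U ∧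
      ∀ x ∈ U, φ x • L₁ x = lagE n ∧ φ x • M x = lagD n ∧ φ x • L₂ x = lagF n := by
  classical
  obtain ⟨g, hgE, -, -⟩ := (hpos x₀).exists_smul_eq
  -- The matrix `g` takes `L₁ x₀` to `Span(e)`, which is transverse to `Span(f)`; this remains so on
  -- an open set. Outside it the frame below has the arbitrary value `1`.
  let U : Set X := {x | g • L₁ x ∈ graphLag n}
  have hU : IsOpen U := isOpen_graphLag.preimage (h₁.const_smul g)
  obtain ⟨φ, hφ, h⟩ := exists_continuous_frame_of_mem_graphLag (X := U)
    (L₁ := fun x => g • L₁ x) (M := fun x => g • M x) (L₂ := fun x => g • L₂ x)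
    ((h₁.comp continuous_subtype_val).const_smul g) ((hM.comp continuous_subtype_val).const_smul g)
    ((h₂.comp continuous_subtype_val).const_smul g) (fun x => (hpos x).smul g) (fun x => x.2)
  refine ⟨U, hU, ?_, fun x => if hx : x ∈ U then φ ⟨x, hx⟩ * g else 1, ?_, fun x hx => ?_⟩
  · change g • L₁ x₀ ∈ graphLag n
    rw [hgE]
    exact mem_graphLag_of_disjoint (posTriple_std n).1
  · rw [continuousOn_iff_continuous_domRestrict]
    have : (U.domRestrict fun x => if hx : x ∈ U then φ ⟨x, hx⟩ * g else 1) = fun x => φ x * g := by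
      funext x
      simp [Set.domRestrict_apply, x.2]
    rw [this]
    exact hφ.mul continuous_const
  · simp only [dif_pos hx, mul_smul]
    exact h ⟨x, hx⟩

end Continuity

/-! ### The fundamental groupoid -/

namespace IdealTriangulation

variable {T : IdealTriangulation}

lemma hc_nil (v : T.Side) : hc (Quiver.Path.nil : Quiver.Path v v) = 𝟙 (pt v) := rfl

lemma hc_cons {u v w : T.Side} (p : Quiver.Path u v) (a : v ⟶ w) :
    hc (p.cons a) = hc p ≫ hc a.toPath := rfl

lemma exists_hc_eq {v w : T.Side} (f : pt v ⟶ pt w) : ∃ p : Quiver.Path v w, hc p = f :=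
  Quot.exists_rep f

lemma next_ne (v : T.Side) : next v ≠ v := by
  intro h
  have h2 : v.2 + 1 = v.2 := congrArg Prod.snd h
  have h3 : (1 : ZMod 3) = 0 := left_eq_add.mp h2.symm
  exact absurd h3 (by decide)

lemma opp_ne_of_eq {v w : T.Side} (hv : opp v ≠ v) (h : w = opp v) : opp w ≠ w := by
  subst h
  rw [opp_opp]
  exact hv.symm

lemma eq_opp_of_eq {v w : T.Side} (h : w = opp v) : v = opp w := by
  rw [h, opp_opp]

/-- The class of an arrow that crosses an edge. -/
def crossHom {v w : T.Side} (hv : opp v ≠ v) (h : w = opp v) : pt v ⟶ pt w :=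
  hc (Quiver.Hom.toPath (V := T.Side) (Arrow.cross hv h))

/-- The class of an arrow inside a face. -/
def turnHom {v w : T.Side} (h : w = next v) : pt v ⟶ pt w :=
  hc (Quiver.Hom.toPath (V := T.Side) (Arrow.turn h))

lemma crossHom_comp {v w : T.Side} (hv : opp v ≠ v) (h : w = opp v) (hw : opp w ≠ w)
    (h' : v = opp w) : crossHom hv h ≫ crossHom hw h' = 𝟙 (pt v) :=
  CategoryTheory.Quotient.sound _ (Homotopy.two hv h hw h')

lemma turnHom_comp {u v w : T.Side} (h₁ : v = next u) (h₂ : w = next v) (h₃ : u = next w) :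
    turnHom h₁ ≫ turnHom h₂ ≫ turnHom h₃ = 𝟙 (pt u) :=
  CategoryTheory.Quotient.sound _ (Homotopy.three h₁ h₂ h₃)

lemma eq_next_of_eq {u v w : T.Side} (h₁ : v = next u) (h₂ : w = next v) : u = next w := by
  rw [h₂, h₁, next_next_next]

lemma isIso_crossHom {v w : T.Side} (hv : opp v ≠ v) (h : w = opp v) :
    IsIso (crossHom hv h) :=
  ⟨crossHom (opp_ne_of_eq hv h) (eq_opp_of_eq h), crossHom_comp _ _ _ _, crossHom_comp _ _ _ _⟩

lemma isIso_turnHom {v w : T.Side} (h : w = next v) : IsIso (turnHom h) :=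
  ⟨turnHom rfl ≫ turnHom (eq_next_of_eq h rfl), turnHom_comp _ _ _, by
    rw [Category.assoc]; exact turnHom_comp _ _ _⟩

lemma isIso_hc_toPath {v w : T.Side} (a : T.Arrow v w) :
    IsIso (hc (Quiver.Hom.toPath (V := T.Side) a)) := by
  cases a with
  | cross hv h => exact isIso_crossHom hv h
  | turn h => exact isIso_turnHom h

/-- The inverse of an arrow across an edge is the opposite arrow, and the inverse of an arrow inside
a face is the path made up of the other two; so paths up to homotopy form a groupoid. -/
instance isIso_hom {v w : T.Side} (f : pt v ⟶ pt w) : IsIso f := by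
  obtain ⟨p, rfl⟩ := exists_hc_eq f
  induction p with
  | nil => rw [hc_nil]; infer_instance
  | cons p a ih =>
    rw [hc_cons]
    have := isIso_hc_toPath a
    infer_instance

lemma exists_path_of_eqvGen {r : T.Side → T.Side → Prop}
    (hr : ∀ x y, r x y → Nonempty (pt x ⟶ pt y)) {v w : T.Side} (h : Relation.EqvGen r v w) :
    Nonempty (pt v ⟶ pt w) := by
  induction h with
  | rel x y h => exact hr x y h
  | refl x => exact ⟨𝟙 _⟩
  | symm x y _ ih => obtain ⟨f⟩ := ih; exact ⟨inv f⟩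
  | trans x y z _ _ ih₁ ih₂ => obtain ⟨f⟩ := ih₁; obtain ⟨g⟩ := ih₂; exact ⟨f ≫ g⟩

lemma nonempty_hom_opp (v : T.Side) : Nonempty (pt v ⟶ pt (opp v)) := by
  by_cases h : opp v = v
  · rw [h]; exact ⟨𝟙 _⟩
  · exact ⟨crossHom h rfl⟩

lemma nonempty_hom_of_connects {S : Set T.A₃} (hS : T.Connects S) (v w : T.Side) :
    Nonempty (pt v ⟶ pt w) := by
  refine exists_path_of_eqvGen ?_ (hS v w)
  rintro x y (rfl | ⟨-, rfl⟩)
  · exact nonempty_hom_opp x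
  · exact ⟨turnHom rfl⟩

/-! ### The components of the boundary of the universal cover -/

variable {v₀ : T.Side}

lemma tCover_cross_turn {u v w : T.Side} (p : pt v₀ ⟶ pt u) (hu : opp u ≠ u) (h : v = opp u)
    (h' : w = next v) : tCover (p ≫ crossHom hu h ≫ turnHom h') = tCover p := by
  subst h
  exact (Quot.sound ⟨hu, h', rfl⟩ : tCover p = _).symm

lemma act_tCover {v : T.Side} (p : pt v₀ ⟶ pt v) (γ : π₁ v₀) :
    act (tCover p) γ = tCover (γ.hom ≫ p) := rfl

lemma exists_tCover_eq (x : BdryCover v₀) :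
    ∃ (v : T.Side) (p : pt v₀ ⟶ pt v), tCover p = x := by
  induction x using Quot.ind with
  | mk x => exact ⟨x.1, x.2, rfl⟩

lemma act_one (x : BdryCover v₀) : act x 1 = x := by
  obtain ⟨v, p, rfl⟩ := exists_tCover_eq x
  rw [act_tCover]
  congr 1
  exact Category.id_comp p

lemma mem_liftedTriangles {u v w : T.Side} (h₁ : v = next u) (h₂ : w = next v)
    (p : pt v₀ ⟶ pt u) : (tCover p, tCover (p ≫ turnHom h₁ ≫ turnHom h₂), tCover (p ≫ turnHom h₁))
      ∈ liftedTriangles v₀ := ⟨u, v, w, h₁, h₂, p, rfl⟩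

/-- If all the triangles of some triangulation have maximal Maslov index, so do all the triangles of
the initial triangulation: this is preserved by flips. -/
theorem IsTriangulation.maslovIndex_liftedTriangles {F : Type*} [AddCommGroup F] [Module ℝ F]
    [FiniteDimensional ℝ F] {n : ℕ} {ω : LinearMap.BilinForm ℝ F}
    (hn : Module.finrank ℝ F = 2 * n) (hω : ω.IsAlt) (hω' : ω.Nondegenerate)
    {ξ : BdryCover v₀ → Submodule ℝ F} (hξ : ∀ x, IsLagrangian ω n (ξ x))
    (heq : ∀ γ : π₁ v₀, ∃ ψ : F ≃ₗ[ℝ] F, (∀ x y, ω (ψ x) (ψ y) = ω x y) ∧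
      ∀ x, ξ (act x γ) = (ξ x).map ψ.toLinearMap)
    {𝒯 : Set (BdryCover v₀ × BdryCover v₀ × BdryCover v₀)} (h𝒯 : IsTriangulation 𝒯)
    (h : ∀ x y z, (x, y, z) ∈ 𝒯 → maslovIndex ω (ξ x) (ξ y) (ξ z) = n) :
    ∀ x y z, (x, y, z) ∈ liftedTriangles v₀ → maslovIndex ω (ξ x) (ξ y) (ξ z) = n := by
  have hiff : ∀ x y z, maslovIndex ω (ξ x) (ξ y) (ξ z) = n ↔ PosTriple ω (ξ x) (ξ y) (ξ z) :=
    fun x y z => maslovIndex_eq_iff hn hω hω' (hξ x) (hξ y) (hξ z)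
  simp only [hiff] at h ⊢
  induction h𝒯 with
  | refl => exact h
  | tail _ hflip ih =>
    -- The flips are undone from the last one. The only triangles of the previous triangulation that
    -- may be missing from the new one are those in the orbits of `xyz` and `xzw`; they are positive
    -- by `PosTriple.flip`, equivariance and cyclic invariance.
    apply ih
    obtain ⟨x, y, z, w, -, -, -, rfl⟩ := hflip
    have horb : ∀ {x y z}, PosTriple ω (ξ x) (ξ y) (ξ z) → ∀ x' y' z',
        (x', y', z') ∈ triOrbit x y z → PosTriple ω (ξ x') (ξ y') (ξ z') := by
      intro x y z hp x' y' z' hm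
      obtain ⟨γ, hγ⟩ := hm
      obtain ⟨ψ, hψ, e⟩ := heq γ
      simp only [Prod.mk.injEq] at hγ
      rcases hγ with ⟨rfl, rfl, rfl⟩ | ⟨rfl, rfl, rfl⟩ | ⟨rfl, rfl, rfl⟩ <;> simp only [e]
      · exact hp.map ψ hψ
      · exact (hp.cyclic hω).map ψ hψ
      · exact ((hp.cyclic hω).cyclic hω).map ψ hψ
    have hself : ∀ x y z : BdryCover v₀, (x, y, z) ∈ triOrbit x y z := fun x y z =>
      ⟨1, Or.inl (by simp only [act_one])⟩
    have h₁ := h x y w (Or.inr (Or.inl (hself x y w)))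
    have h₂ := h y z w (Or.inr (Or.inr (hself y z w)))
    obtain ⟨h₃, h₄⟩ := PosTriple.flip hn hω (hξ y) (hξ w) h₁ h₂
    intro x' y' z' hm
    by_cases h₅ : (x', y', z') ∈ triOrbit x y z ∪ triOrbit x z w
    · rcases h₅ with h₅ | h₅
      · exact horb h₃ _ _ _ h₅
      · exact horb h₄ _ _ _ h₅
    · exact h _ _ _ (Or.inl ⟨hm, h₅⟩)

end IdealTriangulation

/-! ### Parallel transport of Lagrangians -/

namespace FramedLocSys

variable {T : IdealTriangulation} {n : ℕ} (X : FramedLocSys.{u} T n)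

/-- Subspaces are stable under `-Id`, so the twist is invisible to them. Their transport therefore
depends only on homotopy classes of paths, without any untwisting. -/
lemma map_map_eq_of_neg {F F' : Type*} [AddCommGroup F] [Module ℝ F] [AddCommGroup F']
    [Module ℝ F'] (f : F →ₗ[ℝ] F') (g : F' →ₗ[ℝ] F) (h : ∀ x, g (f x) = -x)
    (L : Submodule ℝ F) : (L.map f).map g = L := by
  apply le_antisymm
  · rintro _ ⟨_, ⟨x, hx, rfl⟩, rfl⟩
    rw [h]; exact L.neg_mem hx
  · intro x hx
    exact ⟨_, ⟨-x, L.neg_mem hx, rfl⟩, by rw [h, neg_neg]⟩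

/-- Parallel transport of subspaces, as a functor on the fundamental groupoid. -/
def subFunctor (Z : FramedLocSys.{u} T n) : T.FundGpd ⥤ Type u :=
  CategoryTheory.Quotient.lift T.Homotopy
    (Paths.lift
      { obj := fun v : T.Side => Submodule ℝ (Z.F v)
        map := fun {v w} (a : v ⟶ w) => TypeCat.ofHom fun L => L.map (Z.g a).toLinearMap })
    (by
      rintro _ _ _ _ (⟨hv, h, hw, h'⟩ | ⟨h₁, h₂, h₃⟩)
      · ext L
        exact map_map_eq_of_neg _ _ (Z.twisted_two hv h hw h') L
      · ext L
        have := map_map_eq_of_neg (Z.g (Arrow.turn h₁)).toLinearMap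
          ((Z.g (Arrow.turn h₃)).toLinearMap ∘ₗ (Z.g (Arrow.turn h₂)).toLinearMap)
          (Z.twisted_three h₁ h₂ h₃) L
        rw [Submodule.map_comp] at this
        exact this)

/-- Parallel transport of subspaces. -/
def subMap {v w : T.Side} (f : pt v ⟶ pt w) : Submodule ℝ (X.F v) → Submodule ℝ (X.F w) :=
  fun L => X.subFunctor.map f L

lemma subMap_id {v : T.Side} (L : Submodule ℝ (X.F v)) : X.subMap (𝟙 (pt v)) L = L := by
  rw [subMap, X.subFunctor.map_id]; rfl

lemma subMap_comp {u v w : T.Side} (f : pt u ⟶ pt v) (g : pt v ⟶ pt w)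
    (L : Submodule ℝ (X.F u)) : X.subMap (f ≫ g) L = X.subMap g (X.subMap f L) := by
  rw [subMap, X.subFunctor.map_comp]; rfl

lemma subMap_toPath {v w : T.Side} (a : v ⟶ w) (L : Submodule ℝ (X.F v)) :
    X.subMap (hc a.toPath) L = L.map (X.g a).toLinearMap := rfl

lemma subMap_hc {v w : T.Side} (p : Quiver.Path v w) (L : Submodule ℝ (X.F v)) :
    X.subMap (hc p) L = L.map (X.transport p).toLinearMap := by
  induction p with
  | nil => rw [hc_nil, subMap_id]; exact (Submodule.map_id L).symm
  | cons p a ih =>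
    rw [hc_cons, subMap_comp, ih, subMap_toPath]
    exact (Submodule.map_comp _ _ L).symm

lemma subMap_inv_eq_iff {v w : T.Side} (f : pt v ⟶ pt w) {L : Submodule ℝ (X.F w)}
    {K : Submodule ℝ (X.F v)} : X.subMap (inv f) L = K ↔ L = X.subMap f K := by
  constructor
  · rintro rfl
    rw [← subMap_comp, IsIso.inv_hom_id, subMap_id]
  · rintro rfl
    rw [← subMap_comp, IsIso.hom_inv_id, subMap_id]

lemma lag_eq {v w : T.Side} (p : Quiver.Path v w) : X.lag p = X.subMap (inv (hc p)) (X.Lt w) := by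
  rw [eq_comm, subMap_inv_eq_iff, subMap_hc, lag]
  exact (Submodule.map_comap_eq_of_surjective (X.transport p).surjective _).symm

lemma subMap_turn {v w : T.Side} (h : w = next v) :
    X.subMap (turnHom h) (X.Lb v) = X.Lt w := X.turn_lb h

lemma subMap_cross_lt {v w : T.Side} (hv : opp v ≠ v) (h : w = opp v) :
    X.subMap (crossHom hv h) (X.Lt v) = X.Lb w := X.cross_lt hv h

/-- The Lagrangian of the fibre at the base point attached to a component of the boundary of the
universal cover. -/
def xi {v₀ : T.Side} : BdryCover v₀ → Submodule ℝ (X.F v₀) :=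
  Quot.lift (fun x => X.subMap (inv x.2) (X.Lt x.1)) (by
    rintro ⟨v, p⟩ ⟨w, q⟩ ⟨hne, h, e⟩
    dsimp only at h e hne ⊢
    subst e
    apply Eq.symm
    rw [subMap_inv_eq_iff]
    change X.Lt w = X.subMap (p ≫ crossHom hne rfl ≫ turnHom h) _
    rw [subMap_comp, ← subMap_comp (g := p), IsIso.inv_hom_id, subMap_id, subMap_comp,
      subMap_cross_lt, subMap_turn])

lemma xi_tCover {v₀ v : T.Side} (p : pt v₀ ⟶ pt v) :
    X.xi (tCover p) = X.subMap (inv p) (X.Lt v) := rfl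

lemma lag_eq_xi {v₀ v : T.Side} (p : Quiver.Path v₀ v) : X.lag p = X.xi (tCover (hc p)) :=
  X.lag_eq p

lemma transport_symplectic {v w : T.Side} (p : Quiver.Path v w) (x y : X.F v) :
    X.ω w (X.transport p x) (X.transport p y) = X.ω v x y := by
  induction p with
  | nil => rfl
  | cons p a ih => exact (X.symplectic a _ _).trans ih

lemma exists_subMap_eq_map {v w : T.Side} (f : pt v ⟶ pt w) :
    ∃ ψ : X.F v ≃ₗ[ℝ] X.F w, (∀ x y, X.ω w (ψ x) (ψ y) = X.ω v x y) ∧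
      ∀ L, X.subMap f L = L.map ψ.toLinearMap := by
  obtain ⟨p, rfl⟩ := exists_hc_eq f
  exact ⟨X.transport p, X.transport_symplectic p, X.subMap_hc p⟩

lemma isLagrangian_subMap {v w : T.Side} (f : pt v ⟶ pt w) {L : Submodule ℝ (X.F v)}
    (hL : IsLagrangian (X.ω v) n L) : IsLagrangian (X.ω w) n (X.subMap f L) := by
  obtain ⟨ψ, hψ, e⟩ := X.exists_subMap_eq_map f
  rw [e]
  refine ⟨(LinearEquiv.finrank_map_eq ψ L).trans hL.1, ?_⟩
  rintro _ ⟨x, hx, rfl⟩ _ ⟨y, hy, rfl⟩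
  exact (hψ x y).trans (hL.2 x hx y hy)

lemma maslovIndex_subMap {v w : T.Side} (f : pt v ⟶ pt w) (L₁ M L₂ : Submodule ℝ (X.F v)) :
    maslovIndex (X.ω w) (X.subMap f L₁) (X.subMap f M) (X.subMap f L₂)
      = maslovIndex (X.ω v) L₁ M L₂ := by
  obtain ⟨ψ, hψ, e⟩ := X.exists_subMap_eq_map f
  rw [e, e, e]
  exact maslovIndex_map ψ hψ _ _ _

lemma isLagrangian_xi {v₀ : T.Side} (x : BdryCover v₀) : IsLagrangian (X.ω v₀) n (X.xi x) := by
  obtain ⟨v, p, rfl⟩ := exists_tCover_eq x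
  exact X.isLagrangian_subMap _ (X.lt_lagrangian v)

/-- The framing at the third vertex of the face of `v`, in the fibre at `v`. -/
def L3 (v : T.Side) : Submodule ℝ (X.F v) :=
  X.subMap (inv (turnHom (rfl : next v = next v))) (X.Lb (next v))

lemma isLagrangian_L3 (v : T.Side) : IsLagrangian (X.ω v) n (X.L3 v) :=
  X.isLagrangian_subMap _ (X.lb_lagrangian _)

/-- An arrow inside a face transports the framing at `b(v)` to the framing at `t(next v)`, these
being the same vertex. The vertices of the face of `v` are thus `t(v)`, the third vertex of `L3`,
and `b(v)`. -/
lemma xi_turn {v₀ v w : T.Side} (p : pt v₀ ⟶ pt v) (h : w = next v) :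
    X.xi (tCover (p ≫ turnHom h)) = X.subMap (inv p) (X.Lb v) := by
  rw [xi_tCover, subMap_inv_eq_iff, subMap_comp, ← subMap_comp (g := p), IsIso.inv_hom_id,
    subMap_id, subMap_turn]

lemma xi_turn_turn {v₀ u v w : T.Side} (p : pt v₀ ⟶ pt u) (h₁ : v = next u) (h₂ : w = next v) :
    X.xi (tCover (p ≫ turnHom h₁ ≫ turnHom h₂)) = X.subMap (inv p) (X.L3 u) := by
  subst h₁
  rw [← Category.assoc, xi_turn, subMap_inv_eq_iff, subMap_comp, ← subMap_comp (g := p),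
    IsIso.inv_hom_id, subMap_id]
  exact ((X.subMap_inv_eq_iff _).mp rfl)

/-- All the faces of the triangulation have maximal Maslov index. -/
def FacesMaximal : Prop := ∀ v : T.Side, maslovIndex (X.ω v) (X.Lt v) (X.L3 v) (X.Lb v) = n

lemma maslovIndex_xi {v₀ u v w : T.Side} (p : pt v₀ ⟶ pt u) (h₁ : v = next u) (h₂ : w = next v) :
    maslovIndex (X.ω v₀) (X.xi (tCover p)) (X.xi (tCover (p ≫ turnHom h₁ ≫ turnHom h₂)))
      (X.xi (tCover (p ≫ turnHom h₁))) = maslovIndex (X.ω u) (X.Lt u) (X.L3 u) (X.Lb u) := by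
  rw [xi_turn, xi_turn_turn, xi_tCover, maslovIndex_subMap]

lemma FacesMaximal.isMaximal (h : X.FacesMaximal) (v₀ : T.Side) : X.IsMaximal v₀ := by
  refine ⟨liftedTriangles v₀, Relation.ReflTransGen.refl, ?_⟩
  rintro v₁ v₂ v₃ p₁ p₂ p₃ ⟨u, v, w, h₁, h₂, p, e⟩
  simp only [Prod.mk.injEq] at e
  rw [lag_eq_xi, lag_eq_xi, lag_eq_xi, e.1, e.2.1, e.2.2]
  exact (X.maslovIndex_xi p h₁ h₂).trans (h u)

lemma xi_act {v₀ : T.Side} (x : BdryCover v₀) (γ : π₁ v₀) :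
    X.xi (act x γ) = X.subMap (inv γ.hom) (X.xi x) := by
  obtain ⟨v, p, rfl⟩ := exists_tCover_eq x
  rw [act_tCover, xi_tCover, xi_tCover, ← subMap_comp, IsIso.inv_comp]

/-- Invariance under flips replaces the unknown triangulation by the lift of `T`. Each face has a
lift reachable from the base point, and transport there does not change the index. -/
lemma IsMaximal.facesMaximal {v₀ : T.Side} (h : X.IsMaximal v₀)
    (hT : ∀ v, Nonempty (pt v₀ ⟶ pt v)) : X.FacesMaximal := by
  obtain ⟨𝒯, h𝒯, h⟩ := h
  have h' : ∀ x y z, (x, y, z) ∈ 𝒯 →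
      maslovIndex (X.ω v₀) (X.xi x) (X.xi y) (X.xi z) = n := by
    intro x y z hm
    obtain ⟨v₁, p₁, rfl⟩ := exists_tCover_eq x
    obtain ⟨v₂, p₂, rfl⟩ := exists_tCover_eq y
    obtain ⟨v₃, p₃, rfl⟩ := exists_tCover_eq z
    obtain ⟨p₁, rfl⟩ := exists_hc_eq p₁
    obtain ⟨p₂, rfl⟩ := exists_hc_eq p₂
    obtain ⟨p₃, rfl⟩ := exists_hc_eq p₃
    rw [← lag_eq_xi, ← lag_eq_xi, ← lag_eq_xi]
    exact h p₁ p₂ p₃ hm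
  have key := h𝒯.maslovIndex_liftedTriangles (X.finrank_eq v₀) (X.isAlt v₀) (X.nondegenerate v₀)
    X.isLagrangian_xi (fun γ => by
      obtain ⟨ψ, hψ, e⟩ := X.exists_subMap_eq_map (inv γ.hom)
      exact ⟨ψ, hψ, fun x => by rw [xi_act, e]⟩) h'
  intro v
  obtain ⟨p⟩ := hT v
  rw [← X.maslovIndex_xi p rfl rfl]
  exact key _ _ _ (mem_liftedTriangles rfl rfl p)

end FramedLocSys

/-! ### Spanning trees -/

/-- `TreeGrow src tgt r C S`: the set `S` of edges is a tree with set of vertices `C`, obtained from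
the root `r` by adding one edge and one vertex at a time. -/
inductive TreeGrow {V ι : Type*} (src tgt : ι → V) (r : V) : Set V → Set ι → Prop
  | base : TreeGrow src tgt r {r} ∅
  | fwd {C : Set V} {S : Set ι} (a : ι) (h : TreeGrow src tgt r C S) (ha : src a ∈ C)
      (ha' : tgt a ∉ C) : TreeGrow src tgt r (insert (tgt a) C) (insert a S)
  | bwd {C : Set V} {S : Set ι} (a : ι) (h : TreeGrow src tgt r C S) (ha : tgt a ∈ C)
      (ha' : src a ∉ C) : TreeGrow src tgt r (insert (src a) C) (insert a S)

namespace TreeGrow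

variable {V ι : Type*} {src tgt : ι → V} {r : V} {C : Set V} {S : Set ι}

lemma mem_of_mem (h : TreeGrow src tgt r C S) : ∀ a ∈ S, src a ∈ C ∧ tgt a ∈ C := by
  induction h with
  | base => simp
  | fwd a _ ha ha' ih =>
    rintro b (rfl | hb)
    · exact ⟨Or.inr ha, Or.inl rfl⟩
    · exact ⟨Or.inr (ih b hb).1, Or.inr (ih b hb).2⟩
  | bwd a _ ha ha' ih =>
    rintro b (rfl | hb)
    · exact ⟨Or.inl rfl, Or.inr ha⟩
    · exact ⟨Or.inr (ih b hb).1, Or.inr (ih b hb).2⟩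

lemma root_mem (h : TreeGrow src tgt r C S) : r ∈ C := by
  induction h with
  | base => rfl
  | fwd a _ ha ha' ih => exact Or.inr ih
  | bwd a _ ha ha' ih => exact Or.inr ih

lemma ncard_eq [Finite V] [Finite ι] (h : TreeGrow src tgt r C S) : C.ncard = S.ncard + 1 := by
  induction h with
  | base => simp
  | fwd a h ha ha' ih =>
    rw [Set.ncard_insert_of_notMem ha', Set.ncard_insert_of_notMem fun ha'' =>
      ha' (h.mem_of_mem a ha'').2, ih]
  | bwd a h ha ha' ih =>
    rw [Set.ncard_insert_of_notMem ha', Set.ncard_insert_of_notMem fun ha'' =>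
      ha' (h.mem_of_mem a ha'').1, ih]

/-- A connected graph has a spanning tree. -/
lemma exists_univ [Finite V] [Finite ι] {S : Set ι} (r : V)
    (hS : ∀ x y, Relation.EqvGen (fun x y => ∃ a ∈ S, src a = x ∧ tgt a = y) x y) :
    ∃ S' ⊆ S, TreeGrow src tgt r Set.univ S' := by
  by_contra hno
  push Not at hno
  -- As long as a grown tree is not spanning, some edge of `S` joins its vertex set to the
  -- complement and can be added. Without a spanning tree, trees with more vertices than `V` would
  -- appear.
  have key : ∀ k : ℕ, ∃ C S', S' ⊆ S ∧ TreeGrow src tgt r C S' ∧ k + 1 ≤ C.ncard := by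
    intro k
    induction k with
    | zero => exact ⟨{r}, ∅, Set.empty_subset _, base, by simp⟩
    | succ k ih =>
      obtain ⟨C, S', hS', h, hk⟩ := ih
      have hcross : ∃ a ∈ S, ¬ (src a ∈ C ↔ tgt a ∈ C) := by
        by_contra hcl
        push Not at hcl
        have hcl' : ∀ x y, Relation.EqvGen (fun x y => ∃ a ∈ S, src a = x ∧ tgt a = y) x y →
            (x ∈ C ↔ y ∈ C) := by
          intro x y hxy
          induction hxy with
          | rel x y h => obtain ⟨a, ha, rfl, rfl⟩ := h; exact hcl a ha
          | refl x => rfl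
          | symm x y _ ih => exact ih.symm
          | trans x y z _ _ ih₁ ih₂ => exact ih₁.trans ih₂
        have hu : C = Set.univ := Set.eq_univ_of_forall fun y => (hcl' r y (hS r y)).mp h.root_mem
        subst hu
        exact hno S' hS' h
      obtain ⟨a, ha, hc⟩ := hcross
      by_cases hsrc : src a ∈ C
      · have htgt : tgt a ∉ C := fun ht => hc ⟨fun _ => ht, fun _ => hsrc⟩
        exact ⟨_, _, Set.insert_subset ha hS', h.fwd a hsrc htgt, by
          rw [Set.ncard_insert_of_notMem htgt]; omega⟩
      · have htgt : tgt a ∈ C := by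
          by_contra ht
          exact hc ⟨fun h => absurd h hsrc, fun h => absurd h ht⟩
        exact ⟨_, _, Set.insert_subset ha hS', h.bwd a htgt hsrc, by
          rw [Set.ncard_insert_of_notMem hsrc]; omega⟩
  obtain ⟨C, S', -, -, hk⟩ := key (Nat.card V)
  have := Set.ncard_le_card C
  omega

end TreeGrow

namespace IdealTriangulation

variable {T : IdealTriangulation}

/-- The edge of which `v` is a side. -/
def edge (v : T.Side) : T.Edge := Quot.mk _ v

instance : Finite T.Edge := inferInstanceAs (Finite (Quot _))

lemma edge_opp (v : T.Side) : edge (opp v) = edge v := (Quot.sound rfl : edge v = _).symm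

lemma edge_eq_iff {v w : T.Side} : edge v = edge w ↔ w = v ∨ w = opp v := by
  constructor
  · intro h
    have h' := Quot.eqvGen_exact h
    clear h
    induction h' with
    | rel x y h => exact Or.inr h
    | refl x => exact Or.inl rfl
    | symm x y _ ih =>
      rcases ih with rfl | rfl
      · exact Or.inl rfl
      · exact Or.inr (opp_opp T x).symm
    | trans x y z _ _ ih₁ ih₂ =>
      rcases ih₁ with rfl | rfl <;> rcases ih₂ with rfl | rfl
      · exact Or.inl rfl
      · exact Or.inr rfl
      · exact Or.inr rfl
      · exact Or.inl (opp_opp T x)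
  · rintro (rfl | rfl)
    · rfl
    · exact (edge_opp v).symm

/-- A spanning tree can be grown from any of its vertices. -/
lemma IsSpanningTree.treeGrow {S : Set T.A₃} (hS : T.IsSpanningTree S) (v₀ : T.Side) :
    TreeGrow (fun a : T.Side => edge a) (fun a => edge (next a)) (edge v₀) Set.univ S := by
  -- The vertices of `Γ_T / A₂` are the edges of the triangulation, and the arrow `a` of `A₃` joins
  -- `edge a` to `edge (next a)`.
  obtain ⟨S', hS', h⟩ := TreeGrow.exists_univ (src := fun a : T.Side => edge a)
    (tgt := fun a => edge (next a)) (S := S) (edge v₀) (by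
      intro x y
      induction x using Quot.ind with | mk x => ?_
      induction y using Quot.ind with | mk y => ?_
      have := hS.1 x y
      induction this with
      | rel x y h =>
        rcases h with rfl | ⟨hx, rfl⟩
        · have := edge_opp x
          unfold edge at this
          rw [this]
          exact Relation.EqvGen.refl _
        · exact Relation.EqvGen.rel _ _ ⟨x, hx, rfl, rfl⟩
      | refl x => exact Relation.EqvGen.refl _
      | symm x y _ ih => exact Relation.EqvGen.symm _ _ ih
      | trans x y z _ _ ih₁ ih₂ => exact Relation.EqvGen.trans _ _ _ ih₁ ih₂)
  have hconn : T.Connects S' := by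
    have key : ∀ {C : Set T.Edge} {S' : Set T.A₃}, TreeGrow (fun a : T.Side => edge a)
        (fun a => edge (next a)) (edge v₀) C S' → ∀ v, edge v ∈ C →
        Relation.EqvGen (fun x y => y = opp x ∨ (x ∈ S' ∧ y = next x)) v₀ v := by
      intro C S' h
      have hedge : ∀ {S'' : Set T.A₃} {x y z : T.Side},
          Relation.EqvGen (fun x y => y = opp x ∨ (x ∈ S'' ∧ y = next x)) x y → edge y = edge z →
          Relation.EqvGen (fun x y => y = opp x ∨ (x ∈ S'' ∧ y = next x)) x z := by
        intro S'' x y z hxy hyz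
        rcases edge_eq_iff.mp hyz with rfl | rfl
        · exact hxy
        · exact hxy.trans _ _ _ (Relation.EqvGen.rel _ _ (Or.inl rfl))
      have hmono : ∀ {S'' : Set T.A₃} {x y : T.Side} (a : T.A₃),
          Relation.EqvGen (fun x y => y = opp x ∨ (x ∈ S'' ∧ y = next x)) x y →
          Relation.EqvGen (fun x y => y = opp x ∨ (x ∈ insert a S'' ∧ y = next x)) x y :=
        fun a h => h.mono fun x y hxy => hxy.imp id fun hxy =>
          ⟨Set.mem_insert_of_mem a hxy.1, hxy.2⟩
      induction h with
      | base => exact fun v hv => hedge (Relation.EqvGen.refl v₀) hv.symm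
      | fwd a _ ha _ ih =>
        have mono := fun v hv => hmono a (ih v hv)
        rintro v (hv | hv)
        · exact hedge ((mono a ha).trans _ _ _ (Relation.EqvGen.rel _ _
            (Or.inr ⟨Set.mem_insert a _, rfl⟩))) hv.symm
        · exact mono v hv
      | bwd a _ ha _ ih =>
        have mono := fun v hv => hmono a (ih v hv)
        rintro v (hv | hv)
        · exact hedge ((mono (next a) ha).trans _ _ _ (Relation.EqvGen.symm _ _
            (Relation.EqvGen.rel _ _ (Or.inr ⟨Set.mem_insert a _, rfl⟩)))) hv.symm
        · exact mono v hv
    exact fun v w => (key h v trivial).symm.trans _ _ _ (key h w trivial)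
  -- The grown tree is contained in `S` and already connects all the vertices, so the minimality of
  -- `S` gives equality.
  have e : S' = S := by
    apply hS'.antisymm
    intro a ha
    by_contra ha'
    refine hS.2 a ha fun v w => (hconn v w).mono fun x y hxy => hxy.imp id fun hxy =>
      ⟨⟨hS' hxy.1, ?_⟩, hxy.2⟩
    rintro rfl
    exact ha' hxy.1
  rwa [e] at h

end IdealTriangulation

/-! ### Fixing the gauge -/

/-- A continuous family of systems of transition matrices of framed twisted local systems, in frames
that bring the triple of Lagrangians of each face to the standard position. -/
structure TransFamily (T : IdealTriangulation) (n : ℕ) (U : Type*) [TopologicalSpace U] where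
  G : ∀ {v w : T.Side}, (v ⟶ w) → U → Sp n
  cont : ∀ {v w : T.Side} (a : v ⟶ w), Continuous (G a)
  cross_lagE : ∀ {v w : T.Side} (hv : opp v ≠ v) (h : w = opp v) (x : U),
    G (Arrow.cross hv h) x • lagE n = lagF n
  cross_lagF : ∀ {v w : T.Side} (hv : opp v ≠ v) (h : w = opp v) (x : U),
    G (Arrow.cross hv h) x • lagF n = lagE n
  turn_lagE : ∀ {v w : T.Side} (h : w = next v) (x : U), G (Arrow.turn h) x • lagE n = lagD n
  turn_lagD : ∀ {v w : T.Side} (h : w = next v) (x : U), G (Arrow.turn h) x • lagD n = lagF n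
  turn_lagF : ∀ {v w : T.Side} (h : w = next v) (x : U), G (Arrow.turn h) x • lagF n = lagE n
  two : ∀ {v w : T.Side} (hv : opp v ≠ v) (h : w = opp v) (hw : opp w ≠ w) (h' : v = opp w)
    (x : U), (G (Arrow.cross hw h') x * G (Arrow.cross hv h) x).1 = -1
  three : ∀ {u v w : T.Side} (h₁ : v = next u) (h₂ : w = next v) (h₃ : u = next w) (x : U),
    (G (Arrow.turn h₃) x * (G (Arrow.turn h₂) x * G (Arrow.turn h₁) x)).1 = -1

namespace TransFamily

variable {T : IdealTriangulation} {n : ℕ} {U : Type*} [TopologicalSpace U]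
  (Y : TransFamily T n U)

/-- The orthogonal matrix attached to an arrow inside a face. -/
def turnO (v : T.Side) (x : U) : OO n :=
  ⟨(Y.G (Arrow.turn (rfl : next v = next v)) x).1.toBlocks₁₁, by
    obtain ⟨u, hu⟩ := exists_eq_turnMat (Y.turn_lagE (rfl : next v = next v) x)
      (Y.turn_lagD rfl x) (Y.turn_lagF rfl x)
    rw [hu, toBlocks₁₁_turnMat]
    exact u.2⟩

lemma G_turn {v w : T.Side} (h : w = next v) (x : U) :
    Y.G (Arrow.turn h) x = turnMat (Y.turnO v x) := by
  subst h
  obtain ⟨u, hu⟩ := exists_eq_turnMat (Y.turn_lagE (rfl : next v = next v) x)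
    (Y.turn_lagD rfl x) (Y.turn_lagF rfl x)
  have : Y.turnO v x = u := Subtype.ext (by
    change (Y.G _ x).1.toBlocks₁₁ = _
    rw [hu, toBlocks₁₁_turnMat])
  rw [this, hu]

lemma continuous_turnO (v : T.Side) : Continuous (Y.turnO v) :=
  Continuous.subtype_mk (continuous_toBlocks₁₁.comp (Y.cont _)) _

/-- Let `b` and `c` be the off-diagonal blocks of the matrix of one direction and `c'` the lower
left block of the other. The product being `-1` gives `c' b = -1`, while the symplectic relation
gives `-ᵗb c = 1`; hence `c' = ᵗc`. Positivity of the block is thus the same condition for both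
arrows of a 2-cycle. -/
lemma toBlocks₂₁_cross_transpose {v w : T.Side} (hv : opp v ≠ v) (h : w = opp v)
    (hw : opp w ≠ w) (h' : v = opp w) (x : U) :
    (Y.G (Arrow.cross hw h') x).1.toBlocks₂₁
      = (Y.G (Arrow.cross hv h) x).1.toBlocks₂₁.transpose := by
  obtain ⟨a, b, c, d⟩ := swap_blocks (Y.cross_lagE hv h x) (Y.cross_lagF hv h x)
  have e := Y.two hv h hw h' x
  set g := Y.G (Arrow.cross hv h) x
  set g' := Y.G (Arrow.cross hw h') x
  have e' : Matrix.fromBlocks g'.1.toBlocks₁₁ g'.1.toBlocks₁₂ g'.1.toBlocks₂₁ g'.1.toBlocks₂₂ *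
      Matrix.fromBlocks g.1.toBlocks₁₁ g.1.toBlocks₁₂ g.1.toBlocks₂₁ g.1.toBlocks₂₂
      = -Matrix.fromBlocks 1 0 0 1 := by
    rw [Matrix.fromBlocks_toBlocks, Matrix.fromBlocks_toBlocks, Matrix.fromBlocks_one]
    exact e
  rw [Matrix.fromBlocks_multiply, Matrix.fromBlocks_neg, Matrix.fromBlocks_inj] at e'
  have e₄ := e'.2.2.2
  rw [b, mul_zero, add_zero] at e₄
  have c' : g.1.toBlocks₂₁.transpose * -g.1.toBlocks₁₂ = 1 := by
    have := congrArg Matrix.transpose c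
    simpa using this
  have c'' : -g.1.toBlocks₁₂ * g.1.toBlocks₂₁.transpose = 1 := mul_eq_one_comm.mp c'
  calc g'.1.toBlocks₂₁ = g'.1.toBlocks₂₁ * (-g.1.toBlocks₁₂ * g.1.toBlocks₂₁.transpose) := by
        rw [c'', mul_one]
    _ = -(g'.1.toBlocks₂₁ * g.1.toBlocks₁₂) * g.1.toBlocks₂₁.transpose := by
        simp only [mul_assoc, neg_mul, mul_neg]
    _ = g.1.toBlocks₂₁.transpose := by rw [e₄, neg_neg, one_mul]

/-- The lower left block of the transition matrix across an edge after a change of gauge. -/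
def crossP (k : T.Side → U → OO n) (v : T.Side) (hv : opp v ≠ v) (x : U) :
    Matrix (Fin n) (Fin n) ℝ :=
  (k (opp v) x).1 * (Y.G (Arrow.cross hv (rfl : opp v = opp v)) x).1.toBlocks₂₁ *
    ((k v x)⁻¹ : OO n).1

lemma crossP_opp (k : T.Side → U → OO n) {v w : T.Side} (hv : opp v ≠ v) (hw : opp w ≠ w)
    (h : w = opp v) (x : U) : Y.crossP k w hw x = (Y.crossP k v hv x).transpose := by
  subst h
  have key : ∀ (w : T.Side) (hw : w = opp (opp v)),
      (k w x).1 * (Y.G (Arrow.cross (v := opp v) ‹_› hw) x).1.toBlocks₂₁ *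
        ((k (opp v) x)⁻¹ : OO n).1 = (k w x).1 *
        (Y.G (Arrow.cross hv (rfl : opp v = opp v)) x).1.toBlocks₂₁.transpose
          * ((k (opp v) x)⁻¹ : OO n).1 := by
    intro w hw'
    have : w = v := hw'.trans (opp_opp T v)
    subst this
    rw [Y.toBlocks₂₁_cross_transpose hv rfl]
  have h1 := key _ rfl
  have h2 : k (opp (opp v)) x = k v x := by rw [opp_opp]
  rw [crossP, crossP, h1, h2, Matrix.transpose_mul, Matrix.transpose_mul, OO.coe_inv, OO.coe_inv,
    Matrix.transpose_transpose]
  simp only [mul_assoc]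

/-- The gauge `κ` on one side of an edge is free; for an internal edge, the polar decomposition then
provides the gauge on the other side. This is the step by which the gauge is extended along a tree.
-/
lemma exists_extend_gauge (k : T.Side → U → OO n) (hk : ∀ v, Continuous (k v)) (w : T.Side)
    {κ : U → OO n} (hκ : Continuous κ) :
    ∃ k' : T.Side → U → OO n, (∀ v, Continuous (k' v)) ∧
      (∀ v, edge v ≠ edge w → k' v = k v) ∧ k' w = κ ∧
      ∀ v (hv : opp v ≠ v), edge v = edge w → ∀ x, (Y.crossP k' v hv x).PosDef := by
  classical
  by_cases hw : opp w = w
  · refine ⟨Function.update k w κ, fun v => ?_, fun v hv => ?_, by simp, fun v hv hvw => ?_⟩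
    · by_cases h : v = w
      · subst h; simpa using hκ
      · rw [Function.update_of_ne h]; exact hk v
    · rw [Function.update_of_ne]
      rintro rfl
      exact hv rfl
    · rcases edge_eq_iff.mp hvw with rfl | rfl
      · exact absurd hw hv
      · rw [opp_opp] at hw; exact absurd hw.symm hv
  · let G := Y.G (Arrow.cross hw (rfl : opp w = opp w))
    -- `C` is the lower left block after the change of gauge at `w`, and `D` is its inverse, read
    -- off from the upper right block by the symplectic relation; this keeps the construction
    -- visibly continuous.
    let C : U → Matrix (Fin n) (Fin n) ℝ := fun x => (G x).1.toBlocks₂₁ * ((κ x)⁻¹ : OO n).1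
    let D : U → Matrix (Fin n) (Fin n) ℝ := fun x => (κ x).1 * -(G x).1.toBlocks₁₂.transpose
    have hDC : ∀ x, D x * C x = 1 := fun x => by
      have := (swap_blocks (Y.cross_lagE hw rfl x) (Y.cross_lagF hw rfl x)).2.2.1
      calc D x * C x = (κ x).1 * (-(G x).1.toBlocks₁₂.transpose * (G x).1.toBlocks₂₁)
            * ((κ x)⁻¹ : OO n).1 := by simp only [D, C, mul_assoc]
        _ = 1 := by rw [this, mul_one, OO.coe_mul_inv]
    have cC : Continuous C := (continuous_toBlocks₂₁.comp (Y.cont _)).matrix_mul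
      (continuous_subtype_val.comp hκ.inv)
    have cD : Continuous D := (continuous_subtype_val.comp hκ).matrix_mul
      (continuous_toBlocks₁₂.comp (Y.cont _)).matrix_transpose.neg
    let k' := Function.update (Function.update k (opp w) fun x => polarFactor (C x) (D x) (hDC x)) w κ
    have k'w : k' w = κ := by simp [k']
    have k'o : k' (opp w) = fun x => polarFactor (C x) (D x) (hDC x) := by
      simp only [k']
      rw [Function.update_of_ne hw, Function.update_self]
    have hpos : ∀ x, (Y.crossP k' w hw x).PosDef := fun x => by
      have e : Y.crossP k' w hw x = symSqrt ⟨_, posDef_transpose_mul_self (hDC x)⟩ := by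
        rw [← polarFactor_mul, crossP, k'w, k'o, mul_assoc]
      rw [e]
      exact symSqrt_posDef _
    refine ⟨k', fun v => ?_, fun v hv => ?_, k'w, fun v hv hvw x => ?_⟩
    · by_cases h : v = w
      · subst h; rw [k'w]; exact hκ
      · by_cases h' : v = opp w
        · subst h'; rw [k'o]; exact continuous_polarFactor cC cD hDC
        · simp only [k']
          rw [Function.update_of_ne h, Function.update_of_ne h']
          exact hk v
    · have h : v ≠ w := by rintro rfl; exact hv rfl
      have h' : v ≠ opp w := by rintro rfl; exact hv (edge_opp w)
      simp only [k']
      rw [Function.update_of_ne h, Function.update_of_ne h']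
    · rcases edge_eq_iff.mp hvw.symm with rfl | h
      · exact hpos x
      · rw [Y.crossP_opp k' hw hv h]
        exact (hpos x).transpose

/-- The gauge can be chosen such that the transition matrices are in normal form and trivial along a
spanning tree. -/
lemma exists_gauge_of_treeGrow {r : T.Edge} {C : Set T.Edge} {S : Set T.A₃}
    (h : TreeGrow (fun a : T.Side => edge a) (fun a => edge (next a)) r C S) :
    ∃ k : T.Side → U → OO n, (∀ v, Continuous (k v)) ∧
      (∀ v (hv : opp v ≠ v), edge v ∈ C → ∀ x, (Y.crossP k v hv x).PosDef) ∧
      ∀ a ∈ S, ∀ x, k (next a) x * Y.turnO a x * (k a x)⁻¹ = 1 := by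
  have hcongr : ∀ {k k' : T.Side → U → OO n} {w : T.Side},
      (∀ v, edge v ≠ edge w → k' v = k v) → ∀ v (hv : opp v ≠ v), edge v ≠ edge w →
      ∀ x, Y.crossP k' v hv x = Y.crossP k v hv x := by
    intro k k' w h v hv hvw x
    rw [crossP, crossP, h v hvw, h (opp v) (by rwa [edge_opp])]
  induction h with
  | base =>
    induction r using Quot.ind with | mk w => ?_
    obtain ⟨k, hk, -, -, hp⟩ := Y.exists_extend_gauge (fun _ _ => 1) (fun _ => continuous_const) w
      (κ := fun _ => 1) continuous_const
    exact ⟨k, hk, fun v hv hvw => hp v hv hvw, by simp⟩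
  | fwd a hg ha ha' ih =>
    obtain ⟨k, hk, hp, ht⟩ := ih
    -- This `κ` is the solution of `k (next a) * turnO a * (k a)⁻¹ = 1` for `k (next a)`. The new
    -- edge is outside `C`, so nothing already normalized is altered.
    obtain ⟨k', hk', he, hw, hp'⟩ := Y.exists_extend_gauge k hk (next a)
      (κ := fun x => k a x * (Y.turnO a x)⁻¹) ((hk a).mul (Y.continuous_turnO a).inv)
    have hne : ∀ v, edge v ∈ _ → edge v ≠ edge (next a) := fun v hv e => ha' (e ▸ hv)
    refine ⟨k', hk', ?_, ?_⟩
    · intro v hv hvC x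
      by_cases e : edge v = edge (next a)
      · exact hp' v hv e x
      · rw [hcongr he v hv e]
        exact hp v hv (hvC.resolve_left e) x
    · rintro b (rfl | hb) x
      · rw [hw, he b (hne b ha)]; group
      · rw [he b (hne b (hg.mem_of_mem b hb).1), he _ (hne _ (hg.mem_of_mem b hb).2)]
        exact ht b hb x
  | bwd a hg ha ha' ih =>
    obtain ⟨k, hk, hp, ht⟩ := ih
    -- The same equation, now solved for `k a`.
    obtain ⟨k', hk', he, hw, hp'⟩ := Y.exists_extend_gauge k hk a
      (κ := fun x => k (next a) x * Y.turnO a x) ((hk _).mul (Y.continuous_turnO a))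
    have hne : ∀ v, edge v ∈ _ → edge v ≠ edge a := fun v hv e => ha' (e ▸ hv)
    refine ⟨k', hk', ?_, ?_⟩
    · intro v hv hvC x
      by_cases e : edge v = edge a
      · exact hp' v hv e x
      · rw [hcongr he v hv e]
        exact hp v hv (hvC.resolve_left e) x
    · rintro b (rfl | hb) x
      · rw [hw, he _ (hne _ ha)]; group
      · rw [he b (hne b (hg.mem_of_mem b hb).1), he _ (hne _ (hg.mem_of_mem b hb).2)]
        exact ht b hb x

lemma mul_eq_one_of_turnMat_mul {a b c : OO n}
    (h : (turnMat c * (turnMat b * turnMat a)).1 = -1) : c * b * a = 1 := by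
  have e : (turnMat c * (turnMat b * turnMat a)).1
      = Matrix.fromBlocks (-(c.1 * (b.1 * a.1))) 0 0 (-(c.1 * (b.1 * a.1))) := by
    rw [Submonoid.coe_mul, Submonoid.coe_mul, turnMat, turnMat, turnMat,
      Matrix.fromBlocks_multiply, Matrix.fromBlocks_multiply]
    simp
  rw [e, ← Matrix.fromBlocks_one, Matrix.fromBlocks_neg, Matrix.fromBlocks_inj] at h
  apply Subtype.ext
  rw [Submonoid.coe_mul, Submonoid.coe_mul, mul_assoc]
  exact neg_injective h.1

/-- This combines the polar normalization at every edge with the tree normalization. A one-point `U`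
serves for the surjectivity of the holonomy, and neighbourhoods in the space of framed
representations serve for the continuity of its inverse. -/
theorem exists_coord {S : Set T.A₃} (hS : T.IsSpanningTree S) (v₀ : T.Side) :
    ∃ (k : T.Side → U → OO n) (z : U → CoordS T n S), (∀ v, Continuous (k v)) ∧ Continuous z ∧
      ∀ {v w : T.Side} (a : v ⟶ w) (x : U),
        diagO (k w x) * Y.G a x * (diagO (k v x))⁻¹ = transMat (z x).1 a := by
  obtain ⟨k, hk, hp, ht⟩ := Y.exists_gauge_of_treeGrow (hS.treeGrow v₀)
  let z₁ : U → T.A₂ → SymPos n := fun x v =>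
    ⟨Y.crossP k v.1 v.2 x * Y.crossP k v.1 v.2 x, posDef_mul_self (hp v.1 v.2 trivial x)⟩
  let z₂ : U → T.A₃ → OO n := fun x v => k (next v) x * Y.turnO v x * (k v x)⁻¹
  have hturn : ∀ {v w : T.Side} (h : w = next v) (x : U),
      diagO (k w x) * Y.G (Arrow.turn h) x * (diagO (k v x))⁻¹ = turnMat (z₂ x v) := by
    intro v w h x
    rw [Y.G_turn, ← map_inv, diagO_mul_turnMat_mul]
    subst h
    rfl
  have hcross : ∀ {v w : T.Side} (hv : opp v ≠ v) (h : w = opp v) (x : U),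
      diagO (k w x) * Y.G (Arrow.cross hv h) x * (diagO (k v x))⁻¹
        = crossMat (z₁ x ⟨v, hv⟩) := by
    intro v w hv h x
    subst h
    have hE : (diagO (k (opp v) x) * Y.G (Arrow.cross hv rfl) x * diagO (k v x)⁻¹) • lagE n
        = lagF n := by
      rw [mul_smul, mul_smul, diagO_smul_lagE, Y.cross_lagE, diagO_smul_lagF]
    have hF : (diagO (k (opp v) x) * Y.G (Arrow.cross hv rfl) x * diagO (k v x)⁻¹) • lagF n
        = lagE n := by
      rw [mul_smul, mul_smul, diagO_smul_lagF, Y.cross_lagF, diagO_smul_lagE]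
    have e := toBlocks₂₁_diagO_mul_mul (k (opp v) x) (k v x)⁻¹ (Y.G (Arrow.cross hv rfl) x)
    have h := eq_crossMat hE hF (by rw [e]; exact hp v hv trivial x)
    rw [← map_inv, h]
    congr 1
    apply Subtype.ext
    change _ * _ = Y.crossP k v hv x * Y.crossP k v hv x
    rw [e]
    rfl
  have hz : ∀ x, (z₁ x, z₂ x) ∈ CoordS T n S := by
    intro x
    refine ⟨⟨fun v w h => ?_, fun v => ?_⟩, fun a ha => ht a ha x⟩
    · apply Subtype.ext
      change Y.crossP k w.1 w.2 x * Y.crossP k w.1 w.2 x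
        = Y.crossP k v.1 v.2 x * Y.crossP k v.1 v.2 x
      have e : (Y.crossP k v.1 v.2 x).transpose = Y.crossP k v.1 v.2 x := by
        simpa [Matrix.IsHermitian] using (hp v.1 v.2 trivial x).isHermitian
      rw [Y.crossP_opp k v.2 w.2 h, e]
    · apply mul_eq_one_of_turnMat_mul
      rw [← hturn (rfl : next v = next v), ← hturn (rfl : next (next v) = next (next v)),
        ← hturn (next_next_next T v).symm]
      set g₁ := Y.G (Arrow.turn (rfl : next v = next v)) x
      set g₂ := Y.G (Arrow.turn (rfl : next (next v) = next (next v))) x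
      set g₃ := Y.G (Arrow.turn (next_next_next T v).symm) x
      have e : diagO (k v x) * g₃ * (diagO (k (next (next v)) x))⁻¹ *
          (diagO (k (next (next v)) x) * g₂ * (diagO (k (next v) x))⁻¹ *
            (diagO (k (next v) x) * g₁ * (diagO (k v x))⁻¹))
          = diagO (k v x) * (g₃ * (g₂ * g₁)) * (diagO (k v x))⁻¹ := by group
      rw [e, Submonoid.coe_mul, Submonoid.coe_mul, Y.three, mul_neg, mul_one, neg_mul,
        ← Submonoid.coe_mul, mul_inv_cancel]
      rfl
  refine ⟨k, fun x => ⟨(z₁ x, z₂ x), hz x⟩, hk, ?_, ?_⟩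
  · refine Continuous.subtype_mk (Continuous.prodMk ?_ ?_) _
    · refine continuous_pi fun v => Continuous.subtype_mk ?_ _
      have : Continuous (Y.crossP k v.1 v.2) :=
        ((continuous_subtype_val.comp (hk _)).matrix_mul
          (continuous_toBlocks₂₁.comp (Y.cont _))).matrix_mul
          (continuous_subtype_val.comp (hk _).inv)
      exact this.matrix_mul this
    · exact continuous_pi fun v => ((hk _).mul (Y.continuous_turnO v)).mul (hk v).inv
  · have key : ∀ {v w : T.Side} (a : T.Arrow v w) x,
        diagO (k w x) * Y.G (show v ⟶ w from a) x * (diagO (k v x))⁻¹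
          = transMat (z₁ x, z₂ x) a := by
      intro v w a x
      cases a with
      | cross hv h => exact hcross hv h x
      | turn h => exact hturn h x
    intro v w a x
    exact key a x

end TransFamily

/-! ### Holonomy of framed twisted local systems -/

lemma IsLagrangian.map_eq {F F' : Type*} [AddCommGroup F] [Module ℝ F] [AddCommGroup F']
    [Module ℝ F'] [FiniteDimensional ℝ F'] {n : ℕ} {ω : LinearMap.BilinForm ℝ F}
    {ω' : LinearMap.BilinForm ℝ F'} (ψ : F ≃ₗ[ℝ] F') {L : Submodule ℝ F} {L' : Submodule ℝ F'}
    (hL : IsLagrangian ω n L) (hL' : IsLagrangian ω' n L') (h : ∀ x ∈ L, ψ x ∈ L') :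
    L.map ψ.toLinearMap = L' := by
  apply Submodule.eq_of_le_of_finrank_eq
  · rintro _ ⟨x, hx, rfl⟩
    exact h x hx
  · exact ((LinearEquiv.finrank_map_eq ψ L).trans hL.1).trans hL'.1.symm

lemma coe_eq_neg_one {n : ℕ} {g : Sp n} (h : ∀ x, spEquiv g x = -x) : g.1 = -1 := by
  apply Matrix.toLin'.injective
  ext1 x
  rw [map_neg, Matrix.toLin'_one]
  exact LinearMap.ext fun y => h _

section Coordinates

variable {T : IdealTriangulation} {n : ℕ}

lemma transMat_turn_smul_lagE (x : (T.A₂ → SymPos n) × (T.A₃ → OO n)) {v w : T.Side}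
    (h : w = next v) : transMat x (Arrow.turn h) • lagE n = lagD n := turnMat_smul_lagE _

lemma transMat_turn_smul_lagF (x : (T.A₂ → SymPos n) × (T.A₃ → OO n)) {v w : T.Side}
    (h : w = next v) : transMat x (Arrow.turn h) • lagF n = lagE n := turnMat_smul_lagF _

lemma transMat_turn_smul_lagD (x : (T.A₂ → SymPos n) × (T.A₃ → OO n)) {v w : T.Side}
    (h : w = next v) : transMat x (Arrow.turn h) • lagD n = lagF n := turnMat_smul_lagD _

lemma transMat_cross_smul_lagE (x : (T.A₂ → SymPos n) × (T.A₃ → OO n)) {v w : T.Side}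
    (hv : opp v ≠ v) (h : w = opp v) : transMat x (Arrow.cross hv h) • lagE n = lagF n :=
  crossMat_smul_lagE _

/-- Since `turnMat` takes `Span(e + f)` to `Span(f)`, the triple of each face is the standard one.
-/
lemma hol_facesMaximal (z : (T.A₂ → SymPos n) × (T.A₃ → OO n)) (hz : z ∈ Coord T n) :
    (hol z hz).FacesMaximal := by
  intro v
  have h : (hol z hz).L3 v = stdD n := by
    refine ((hol z hz).subMap_inv_eq_iff _).mpr ?_
    exact (congrArg Subtype.val (turnMat_smul_lagD (z.2 v))).symm
  rw [h]
  exact PosTriple.maslovIndex_eq (finrank_R2 n) (stdForm_isAlt n) (stdForm_nondegenerate n)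
    (stdE_isLagrangian n) (stdD_isLagrangian n) (stdF_isLagrangian n) (posTriple_std n)

/-- Symplectic matrices that intertwine the transition matrices and respect the framing come from a
single orthogonal matrix. -/
theorem exists_conj_of_intertwine {S : Set T.A₃} (hS : T.Connects S) (v₀ : T.Side)
    {z z' : (T.A₂ → SymPos n) × (T.A₃ → OO n)} (hz : z ∈ CoordS T n S) (hz' : z' ∈ CoordS T n S)
    (g : T.Side → Sp n) (hE : ∀ v, g v • lagE n = lagE n) (hF : ∀ v, g v • lagF n = lagF n)
    (hg : ∀ {v w : T.Side} (a : T.Arrow v w), transMat z' a * g v = g w * transMat z a) :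
    ∃ w : OO n, (∀ a, (z'.1 a).1 = w.1 * (z.1 a).1 * (w⁻¹ : OO n).1) ∧
      ∀ a, z'.2 a = w * z.2 a * w⁻¹ := by
  -- The arrow that ends at `v` inside the face takes `Span(e)` to `Span(e + f)`, so the
  -- intertwining relation transfers invariance from the first to the second.
  have hD : ∀ v, g v • lagD n = lagD n := by
    intro v
    have e := hg (Arrow.turn (next_next_next T v).symm)
    calc g v • lagD n = (g v * transMat z (Arrow.turn (next_next_next T v).symm)) • lagE n := by
          rw [mul_smul, transMat_turn_smul_lagE]
      _ = lagD n := by rw [← e, mul_smul, hE, transMat_turn_smul_lagE]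
  choose u hu using fun v => exists_eq_diagO (hE v) (hD v) (hF v)
  -- Uniqueness of the polar decomposition: the orthogonal matrices on the two sides of an edge
  -- agree and conjugate one coordinate into the other.
  have hcross : ∀ v : T.A₂, u v.1 = u (opp v.1) ∧ z'.1 v = conjSym (u (opp v.1)) (z.1 v) := by
    intro v
    have e := hg (Arrow.cross v.2 rfl)
    rw [hu, hu] at e
    exact eq_of_diagO_mul_crossMat e.symm
  have hturn : ∀ v, z'.2 v * u v = u (next v) * z.2 v := by
    intro v
    have e := hg (Arrow.turn (rfl : next v = next v))
    rw [hu, hu] at e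
    apply turnMat_injective
    have e₁ := diagO_mul_turnMat_mul 1 (z'.2 v) (u v)
    have e₂ := diagO_mul_turnMat_mul (u (next v)) (z.2 v) 1
    rw [map_one, one_mul, one_mul] at e₁
    rw [map_one, mul_one, mul_one] at e₂
    rw [← e₁, ← e₂]
    exact e
  -- Across edges this is `hcross`; along the arrows of `S` both orthogonal coordinates are `1`.
  -- These arrows connect everything.
  have hconst : ∀ v, u v = u v₀ := by
    intro v
    have h := hS v v₀
    induction h with
    | rel x y h =>
      rcases h with rfl | ⟨hx, rfl⟩
      · by_cases hx : opp x = x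
        · rw [hx]
        · exact (hcross ⟨x, hx⟩).1
      · have := hturn x
        rwa [hz.2 x hx, hz'.2 x hx, one_mul, mul_one] at this
    | refl x => rfl
    | symm x y _ ih => exact ih.symm
    | trans x y z _ _ ih₁ ih₂ => exact ih₁.trans ih₂
  refine ⟨u v₀, fun a => ?_, fun a => ?_⟩
  · rw [(hcross a).2, hconst]; rfl
  · rw [eq_mul_inv_iff_mul_eq]
    have := hturn a
    rwa [hconst a, hconst (next a)] at this

lemma diagO_mul_transMat {z z' : (T.A₂ → SymPos n) × (T.A₃ → OO n)} (w : OO n)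
    (h₁ : ∀ a, (z'.1 a).1 = w.1 * (z.1 a).1 * (w⁻¹ : OO n).1)
    (h₂ : ∀ a, z'.2 a = w * z.2 a * w⁻¹) {v v' : T.Side} (a : T.Arrow v v') :
    transMat z' a = diagO w * transMat z a * (diagO w)⁻¹ := by
  rw [← map_inv]
  cases a with
  | cross hv h =>
    have e : z'.1 ⟨v, hv⟩ = conjSym w (z.1 ⟨v, hv⟩) := Subtype.ext (h₁ _)
    change crossMat _ = diagO w * crossMat _ * _
    rw [diagO_mul_crossMat_mul, e]
  | turn h =>
    change turnMat _ = diagO w * turnMat _ * _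
    rw [diagO_mul_turnMat_mul, h₂]

theorem hol_equivalent_iff {S : Set T.A₃} (hS : T.Connects S) (v₀ : T.Side)
    {z z' : (T.A₂ → SymPos n) × (T.A₃ → OO n)} (hz : z ∈ CoordS T n S) (hz' : z' ∈ CoordS T n S) :
    (hol z hz.1).Equivalent (hol z' hz'.1) ↔
      ∃ w : OO n, (∀ a, (z'.1 a).1 = w.1 * (z.1 a).1 * (w⁻¹ : OO n).1) ∧
        ∀ a, z'.2 a = w * z.2 a * w⁻¹ := by
  constructor
  · rintro ⟨ψ, hψ, hcomm, hL⟩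
    choose g hg using fun v => exists_spEquiv_eq (n := n) (ψ v).toLinearMap (hψ v)
    have hmap : ∀ v (L : Submodule ℝ (R2 n)),
        L.map (spEquiv (g v)).toLinearMap = L.map (ψ v).toLinearMap := by
      intro v L
      congr 1
      exact LinearMap.ext (hg v)
    refine exists_conj_of_intertwine hS v₀ hz hz' g (fun v => Subtype.ext ((hmap v _).trans (hL v).1))
      (fun v => Subtype.ext ((hmap v _).trans (hL v).2)) fun {v w} a => ?_
    apply spEquiv_injective
    ext1 x
    rw [spEquiv_mul, spEquiv_mul, hg, hg]
    exact hcomm v w a x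
  · rintro ⟨w, h₁, h₂⟩
    refine ⟨fun _ => spEquiv (diagO w), fun _ => stdForm_spEquiv _, fun v v' a (x : R2 n) => ?_, fun v =>
      ⟨congrArg Subtype.val (diagO_smul_lagE w), congrArg Subtype.val (diagO_smul_lagF w)⟩⟩
    change spEquiv (transMat z' a) (spEquiv (diagO w) x) = spEquiv (diagO w) (spEquiv (transMat z a) x)
    rw [diagO_mul_transMat w h₁ h₂, ← spEquiv_mul, ← spEquiv_mul, inv_mul_cancel_right]

end Coordinates

namespace FramedLocSys

variable {T : IdealTriangulation} {n : ℕ} (X : FramedLocSys.{u} T n)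

lemma map_turn_L3 {v w : T.Side} (h : w = next v) :
    (X.L3 v).map (X.g (Arrow.turn h)).toLinearMap = X.Lb w := by
  subst h
  exact ((X.subMap_inv_eq_iff (turnHom (rfl : next v = next v))).mp rfl).symm

lemma map_turn_Lt {v w : T.Side} (h : w = next v) :
    (X.Lt v).map (X.g (Arrow.turn h)).toLinearMap = X.L3 w := by
  subst h
  refine ((X.subMap_inv_eq_iff _).mpr ?_).symm
  have e := X.subMap_turn (next_next_next T v).symm
  rw [← e, ← X.subMap_toPath (Arrow.turn rfl), ← X.subMap_comp, ← X.subMap_comp]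
  change X.Lb _ = X.subMap (turnHom (next_next_next T v).symm ≫ turnHom rfl ≫ turnHom rfl) _
  rw [turnHom_comp, X.subMap_id]

variable {X}

/-- Each face triple is positive, so every fibre has a frame in which it is standard; a change of
gauge by orthogonal matrices then brings the transition matrices to the form `transMat z`. -/
theorem FacesMaximal.exists_hol_equivalent (h : X.FacesMaximal) {S : Set T.A₃}
    (hS : T.IsSpanningTree S) (v₀ : T.Side) :
    ∃ z, ∃ hz : z ∈ CoordS T n S, (hol z hz.1).Equivalent X := by
  have hpos : ∀ v, PosTriple (X.ω v) (X.Lt v) (X.L3 v) (X.Lb v) := fun v =>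
    posTriple_of_maslovIndex_eq (X.finrank_eq v) (X.isAlt v) (X.nondegenerate v)
      (X.lt_lagrangian v) (X.isLagrangian_L3 v) (X.lb_lagrangian v) (h v)
  choose φ hφ hE hD hF using fun v => (hpos v).exists_frame (X.finrank_eq v) (X.isAlt v)
    (X.lt_lagrangian v) (X.isLagrangian_L3 v) (X.lb_lagrangian v)
  have mE : ∀ v, (lagE n).1.map (φ v).toLinearMap = X.Lt v := fun v =>
    (stdE_isLagrangian n).map_eq (φ v) (X.lt_lagrangian v) (hE v)
  have mD : ∀ v, (lagD n).1.map (φ v).toLinearMap = X.L3 v := fun v =>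
    (stdD_isLagrangian n).map_eq (φ v) (X.isLagrangian_L3 v) (hD v)
  have mF : ∀ v, (lagF n).1.map (φ v).toLinearMap = X.Lb v := fun v =>
    (stdF_isLagrangian n).map_eq (φ v) (X.lb_lagrangian v) (hF v)
  have hG : ∀ (v w : T.Side) (a : v ⟶ w), ∃ g : Sp n, ∀ x, φ w (spEquiv g x) = X.g a (φ v x) := by
    intro v w a
    obtain ⟨g, hg⟩ := exists_spEquiv_eq
      (((φ v).trans (X.g a)).trans (φ w).symm).toLinearMap (fun x y => by
        rw [← hφ w, ← hφ v, ← X.symplectic a]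
        simp)
    exact ⟨g, fun x => by rw [hg]; simp⟩
  choose G hG using hG
  have key : ∀ {v w : T.Side} (a : v ⟶ w) {L L' : Lag n} {K : Submodule ℝ (X.F v)}
      {K' : Submodule ℝ (X.F w)}, L.1.map (φ v).toLinearMap = K → L'.1.map (φ w).toLinearMap = K' →
      K.map (X.g a).toLinearMap = K' → G v w a • L = L' := by
    rintro v w a L L' _ _ rfl rfl e
    rw [smul_lag_eq_iff]
    intro x hx
    have hm : X.g a (φ v x) ∈ L'.1.map (φ w).toLinearMap := e ▸ ⟨_, ⟨x, hx, rfl⟩, rfl⟩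
    rw [← hG] at hm
    obtain ⟨y, hy, e'⟩ := hm
    rw [← spEquiv_apply, ← (φ w).injective e']
    exact hy
  -- A single local system is a family over a point, so the continuity conditions are empty.
  let Y : TransFamily T n PUnit.{1} :=
    { G := fun {v w} a _ => G v w a
      cont := fun _ => continuous_const
      cross_lagE := fun hv h _ => key _ (mE _) (mF _) (X.cross_lt hv h)
      cross_lagF := fun hv h _ => key _ (mF _) (mE _) (X.cross_lb hv h)
      turn_lagE := fun h _ => key _ (mE _) (mD _) (X.map_turn_Lt h)
      turn_lagD := fun h _ => key _ (mD _) (mF _) (X.map_turn_L3 h)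
      turn_lagF := fun h _ => key _ (mF _) (mE _) (X.turn_lb h)
      two := fun {v w} hv h hw h' _ => coe_eq_neg_one fun x => (φ v).injective (by
        rw [spEquiv_mul, hG, hG, X.twisted_two, map_neg])
      three := fun {u v w} h₁ h₂ h₃ _ => coe_eq_neg_one fun x => (φ u).injective (by
        rw [spEquiv_mul, spEquiv_mul, hG, hG, hG, X.twisted_three, map_neg]) }
  obtain ⟨k, z, -, -, hz⟩ := Y.exists_coord hS v₀
  refine ⟨(z ⟨⟩).1, (z ⟨⟩).2, fun v => (spEquiv (diagO (k v ⟨⟩))⁻¹).trans (φ v), ?_, ?_, ?_⟩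
  · intro v x y
    exact (hφ v _ _).trans (stdForm_spEquiv _ x y)
  · intro v w a (x : R2 n)
    change X.g a (φ v (spEquiv _ x)) = φ w (spEquiv _ (spEquiv (transMat (z ⟨⟩).1 a) x))
    rw [← hG, ← hz a ⟨⟩, ← spEquiv_mul, ← spEquiv_mul]
    congr 3
    change _ = (diagO (k w ⟨⟩))⁻¹ * (diagO (k w ⟨⟩) * G v w a * (diagO (k v ⟨⟩))⁻¹)
    group
  · intro v
    have hinv : ∀ {L : Lag n}, diagO (k v ⟨⟩) • L = L →
        L.1.map (spEquiv (diagO (k v ⟨⟩))⁻¹).toLinearMap = L.1 := by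
      intro L hL
      exact congrArg Subtype.val (inv_smul_eq_iff.mpr hL.symm : (diagO (k v ⟨⟩))⁻¹ • L = L)
    constructor
    · rw [← mE v]
      conv_rhs => rw [← hinv (diagO_smul_lagE (k v ⟨⟩))]
      exact Submodule.map_comp _ _ _
    · rw [← mF v]
      conv_rhs => rw [← hinv (diagO_smul_lagF (k v ⟨⟩))]
      exact Submodule.map_comp _ _ _

end FramedLocSys

/-! ### Signs -/

section Signs

variable {n : ℕ}

/-- The central elements `± Id` of the symplectic group. -/
def signSp (n : ℕ) : ℤˣ →* Sp n where
  toFun s := ⟨((s : ℤ) : ℝ) • 1, by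
    have h : (((s : ℤ) : ℝ)) * ((s : ℤ) : ℝ) = 1 := by
      rw [← Int.cast_mul, Int.units_coe_mul_self, Int.cast_one]
    rw [SymplecticGroup.mem_iff]
    simp [Matrix.transpose_smul, smul_smul, h]⟩
  map_one' := Subtype.ext (by simp)
  map_mul' s t := Subtype.ext (by simp [smul_smul, mul_comm])

lemma coe_signSp (s : ℤˣ) : (signSp n s).1 = ((s : ℤ) : ℝ) • 1 := rfl

lemma coe_signSp_mul (s : ℤˣ) (g : Sp n) : (signSp n s * g).1 = ((s : ℤ) : ℝ) • g.1 := by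
  rw [Submonoid.coe_mul, coe_signSp, smul_mul_assoc, one_mul]

lemma signSp_mul_comm (s : ℤˣ) (g : Sp n) : signSp n s * g = g * signSp n s := by
  apply Subtype.ext
  rw [coe_signSp_mul, Submonoid.coe_mul, coe_signSp, mul_smul_comm, mul_one]

/-- Untwisting multiplies transition matrices by `± Id`, which does not affect the framing. -/
lemma signSp_smul (s : ℤˣ) (L : Lag n) : signSp n s • L = L := by
  rw [smul_lag_eq_iff]
  intro x hx
  rw [coe_signSp, Matrix.smul_mulVec, Matrix.one_mulVec]
  exact L.1.smul_mem _ hx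

lemma signSp_neg_one : (signSp n (-1)).1 = -1 := by
  rw [coe_signSp]; simp

lemma signSp_mul_self (s : ℤˣ) : signSp n s * signSp n s = 1 := by
  rw [← map_mul, Int.units_mul_self, map_one]

lemma signSp_mul_mul (s t : ℤˣ) (g h : Sp n) :
    signSp n s * g * (signSp n t * h) = signSp n (s * t) * (g * h) := by
  rw [map_mul, mul_assoc, ← mul_assoc g, ← signSp_mul_comm]
  simp only [mul_assoc]

lemma signSp_conj (s : ℤˣ) (a b g : Sp n) :
    signSp n s * a * g * (signSp n s * b)⁻¹ * b = a * g := by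
  rw [signSp_mul_comm s b, mul_assoc (signSp n s) a g, signSp_mul_comm, mul_inv_rev]
  group

lemma mul_eq_one_of_sign {s : ℤˣ} {g : Sp n} (hs : s = -1) (h : g.1 = -1) :
    signSp n s * g = 1 := by
  apply Subtype.ext
  rw [Submonoid.coe_mul, hs, signSp_neg_one, h]
  simp

end Signs

/-! ### The framed representation defined by coordinates -/

section Holonomy

variable {T : IdealTriangulation} {n : ℕ} (E : Untwisting T)

/-- The transition matrices of the local system obtained from `hol(x)` by untwisting. -/
def untwMat (x : (T.A₂ → SymPos n) × (T.A₃ → OO n)) {v w : T.Side} (a : v ⟶ w) : Sp n :=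
  signSp n (E.ε a) * transMat x a

lemma transMat_two {x : (T.A₂ → SymPos n) × (T.A₃ → OO n)} (hx : x ∈ Coord T n) {v w : T.Side}
    (hv : opp v ≠ v) (h : w = opp v) (hw : opp w ≠ w) (h' : v = opp w) :
    (transMat x (Arrow.cross hw h') * transMat x (Arrow.cross hv h)).1 = -1 :=
  coe_eq_neg_one fun y => by
    rw [spEquiv_mul]
    exact (hol x hx).twisted_two hv h hw h' y

lemma transMat_three {x : (T.A₂ → SymPos n) × (T.A₃ → OO n)} (hx : x ∈ Coord T n)
    {u v w : T.Side} (h₁ : v = next u) (h₂ : w = next v) (h₃ : u = next w) :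
    (transMat x (Arrow.turn h₃) * (transMat x (Arrow.turn h₂) * transMat x (Arrow.turn h₁))).1
      = -1 :=
  coe_eq_neg_one fun y => by
    rw [spEquiv_mul, spEquiv_mul]
    exact (hol x hx).twisted_three h₁ h₂ h₃ y

/-- The parallel transport of the untwisted local system. -/
def holFunctor {x : (T.A₂ → SymPos n) × (T.A₃ → OO n)} (hx : x ∈ Coord T n) :
    T.FundGpd ⥤ SingleObj (Sp n) :=
  CategoryTheory.Quotient.lift T.Homotopy
    (Paths.lift
      { obj := fun _ : T.Side => SingleObj.star (Sp n)
        map := fun {v w} (a : v ⟶ w) => (untwMat E x a : Sp n) })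
    (by
      rintro _ _ _ _ (⟨hv, h, hw, h'⟩ | ⟨h₁, h₂, h₃⟩)
      · change untwMat E x (Arrow.cross hw h') * (untwMat E x (Arrow.cross hv h) * 1) = 1
        rw [mul_one, untwMat, untwMat, signSp_mul_mul]
        exact mul_eq_one_of_sign (E.two hv h hw h') (transMat_two hx hv h hw h')
      · change untwMat E x (Arrow.turn h₃) * (untwMat E x (Arrow.turn h₂) *
          (untwMat E x (Arrow.turn h₁) * 1)) = 1
        rw [mul_one, untwMat, untwMat, untwMat, signSp_mul_mul, signSp_mul_mul,
          ← mul_assoc (E.ε _)]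
        exact mul_eq_one_of_sign (E.three h₁ h₂ h₃) (transMat_three hx h₁ h₂ h₃))

variable {x : (T.A₂ → SymPos n) × (T.A₃ → OO n)} (hx : x ∈ Coord T n)

/-- The parallel transport of the untwisted local system along a homotopy class of paths. -/
def holMap {v w : T.Side} (f : pt v ⟶ pt w) : Sp n := (holFunctor E hx).map f

lemma holMap_id (v : T.Side) : holMap E hx (𝟙 (pt v)) = 1 := (holFunctor E hx).map_id _

lemma holMap_comp {u v w : T.Side} (f : pt u ⟶ pt v) (g : pt v ⟶ pt w) :
    holMap E hx (f ≫ g) = holMap E hx g * holMap E hx f := (holFunctor E hx).map_comp f g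

lemma holMap_toPath {v w : T.Side} (a : v ⟶ w) :
    holMap E hx (hc a.toPath) = untwMat E x a :=
  mul_one _

lemma holMap_hc {v w : T.Side} (p : Quiver.Path v w) :
    holMap E hx (hc p) = signSp n (E.pathSign p) * pathMat x p := by
  induction p with
  | nil => rw [hc_nil, holMap_id]; simp [Untwisting.pathSign, pathMat]
  | cons p a ih =>
    rw [hc_cons, holMap_comp, ih, holMap_toPath, untwMat, signSp_mul_mul]
    rfl

lemma holMap_cross_turn {u v w : T.Side} (hu : opp u ≠ u) (h : v = opp u) (h' : w = next v) :
    holMap E hx (crossHom hu h ≫ turnHom h') • lagE n = lagE n := by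
  rw [holMap_comp, crossHom, turnHom, holMap_toPath, holMap_toPath, untwMat, untwMat,
    signSp_mul_mul, mul_smul, signSp_smul, mul_smul, transMat_cross_smul_lagE,
    transMat_turn_smul_lagF]

lemma holMap_turn_lagF {v w : T.Side} (h : w = next v) :
    holMap E hx (turnHom h) • lagF n = lagE n := by
  rw [turnHom, holMap_toPath, untwMat, mul_smul, signSp_smul, transMat_turn_smul_lagF]

lemma holMap_turn_lagD {v w : T.Side} (h : w = next v) :
    holMap E hx (turnHom h) • lagD n = lagF n := by
  rw [turnHom, holMap_toPath, untwMat, mul_smul, signSp_smul, transMat_turn_smul_lagD]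

variable (v₀ : T.Side)

/-- The framing of the representation defined by coordinates. -/
def holXi : BdryCover v₀ → Lag n :=
  Quot.lift (fun y => (holMap E hx y.2)⁻¹ • lagE n) (by
    rintro ⟨v, p⟩ ⟨w, q⟩ ⟨hne, h, e⟩
    dsimp only at h e hne ⊢
    subst e
    change _ = (holMap E hx (p ≫ crossHom hne rfl ≫ turnHom h))⁻¹ • _
    rw [holMap_comp, mul_inv_rev, mul_smul]
    congr 1
    rw [eq_inv_smul_iff, holMap_cross_turn])

/-- The framed representation defined by coordinates. -/
def holRep : FramedRep v₀ n where
  ρ :=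
    { toFun := fun γ => holMap E hx γ.hom
      map_one' := holMap_id E hx v₀
      map_mul' := fun α γ => holMap_comp E hx γ.hom α.hom }
  ξ := holXi E hx v₀
  equivariant γ y := by
    obtain ⟨v, p, rfl⟩ := exists_tCover_eq y
    rw [act_tCover]
    change (holMap E hx (γ⁻¹.hom ≫ p))⁻¹ • lagE n = holMap E hx γ.hom • (holMap E hx p)⁻¹ • lagE n
    rw [holMap_comp, mul_inv_rev, mul_smul]
    congr 1
    rw [inv_eq_iff_mul_eq_one, ← holMap_comp, ← holMap_id E hx v₀]
    congr 1
    exact γ.hom_inv_id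

lemma holRep_ρ (γ : π₁ v₀) : (holRep E hx v₀).ρ γ = holMap E hx γ.hom := rfl

variable {v₀} in
lemma holRep_ξ {v : T.Side} (p : pt v₀ ⟶ pt v) :
    (holRep E hx v₀).ξ (tCover p) = (holMap E hx p)⁻¹ • lagE n := rfl

lemma isHolonomyRep_holRep : IsHolonomyRep E x (holRep E hx v₀) := by
  refine ⟨fun p γ h => ?_, fun p => ?_⟩
  · rw [holRep_ρ, h, holMap_hc, coe_signSp_mul]
  · rw [holRep_ξ, holMap_hc, mul_inv_rev, mul_smul]
    congr 1
    rw [inv_smul_eq_iff, signSp_smul]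

/-- The Lagrangians at the vertices of the lifted face reached by `p` are the image of the standard
triple by the inverse of the transport along `p`. -/
lemma holRep_isMaximal : (holRep E hx v₀).IsMaximal := by
  refine ⟨liftedTriangles v₀, Relation.ReflTransGen.refl, ?_⟩
  rintro a b c ⟨u, v, w, h₁, h₂, p, e⟩
  simp only [Prod.mk.injEq] at e
  obtain ⟨rfl, rfl, rfl⟩ := e
  have e₁ : (holRep E hx v₀).ξ (tCover (p ≫ turnHom h₁)) = (holMap E hx p)⁻¹ • lagF n := by
    rw [holRep_ξ, holMap_comp, mul_inv_rev, mul_smul]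
    congr 1
    rw [inv_smul_eq_iff, holMap_turn_lagF]
  have e₂ : (holRep E hx v₀).ξ (tCover (p ≫ turnHom h₁ ≫ turnHom h₂))
      = (holMap E hx p)⁻¹ • lagD n := by
    rw [holRep_ξ, holMap_comp, mul_inv_rev, mul_smul]
    congr 1
    rw [inv_smul_eq_iff, holMap_comp, mul_smul, holMap_turn_lagD, holMap_turn_lagF]
  have h := (posTriple_std n).smul (L₁ := lagE n) (M := lagD n) (L₂ := lagF n) (holMap E hx p)⁻¹
  rw [← e₁, ← e₂, ← holRep_ξ] at h
  exact h.maslovIndex_eq (finrank_R2 n) (stdForm_isAlt n) (stdForm_nondegenerate n)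
    (Subtype.prop _) (Subtype.prop _) (Subtype.prop _)

lemma continuous_transMat {v w : T.Side} (a : T.Arrow v w) :
    Continuous fun y : (T.A₂ → SymPos n) × (T.A₃ → OO n) => transMat y a := by
  cases a with
  | cross hv h => exact continuous_crossMat.comp ((continuous_apply _).comp continuous_fst)
  | turn h => exact continuous_turnMat.comp ((continuous_apply _).comp continuous_snd)

lemma continuous_pathMat {v w : T.Side} (p : Quiver.Path v w) :
    Continuous fun y : (T.A₂ → SymPos n) × (T.A₃ → OO n) => pathMat y p := by
  induction p with
  | nil => exact continuous_const
  | cons p a ih => exact (continuous_transMat a).mul ih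

lemma continuous_holMap {S : Set T.A₃} {v w : T.Side} (f : pt v ⟶ pt w) :
    Continuous fun y : CoordS T n S => holMap E y.2.1 f := by
  obtain ⟨p, rfl⟩ := exists_hc_eq f
  simp only [holMap_hc]
  exact continuous_const.mul ((continuous_pathMat p).comp continuous_subtype_val)

lemma continuous_holRep {S : Set T.A₃} :
    Continuous fun y : CoordS T n S => holRep E y.2.1 v₀ := by
  rw [continuous_induced_rng]
  refine Continuous.prodMk (continuous_pi fun γ => continuous_holMap E γ.hom)
    (continuous_pi fun c => ?_)
  obtain ⟨v, p, rfl⟩ := exists_tCover_eq c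
  exact (continuous_holMap E p).inv.smul continuous_const

end Holonomy

/-! ### Framed representations in local frames -/

namespace FramedRep

variable {T : IdealTriangulation} {v₀ : T.Side} {n : ℕ}

lemma continuous_data : Continuous fun h : FramedRep v₀ n =>
    ((fun γ => h.ρ γ : π₁ v₀ → Sp n), h.ξ) := continuous_induced_dom

lemma continuous_rho (γ : π₁ v₀) : Continuous fun h : FramedRep v₀ n => h.ρ γ :=
  (continuous_apply γ).comp continuous_data.fst

lemma continuous_xi (x : BdryCover v₀) : Continuous fun h : FramedRep v₀ n => h.ξ x :=
  (continuous_apply x).comp continuous_data.snd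

lemma xi_act (h : FramedRep v₀ n) (x : BdryCover v₀) (γ : π₁ v₀) :
    h.ξ (act x γ) = (h.ρ γ)⁻¹ • h.ξ x := by
  have := h.equivariant γ⁻¹ x
  rwa [inv_inv, map_inv] at this

lemma IsMaximal.posTriple {h : FramedRep v₀ n} (hm : h.IsMaximal) {u v w : T.Side}
    (h₁ : v = next u) (h₂ : w = next v) (p : pt v₀ ⟶ pt u) :
    PosTriple (stdForm n) (h.ξ (tCover p)).1 (h.ξ (tCover (p ≫ turnHom h₁ ≫ turnHom h₂))).1
      (h.ξ (tCover (p ≫ turnHom h₁))).1 := by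
  obtain ⟨𝒯, h𝒯, hm⟩ := hm
  refine posTriple_of_maslovIndex_eq (finrank_R2 n) (stdForm_isAlt n) (stdForm_nondegenerate n)
    (Subtype.prop _) (Subtype.prop _) (Subtype.prop _) ?_
  exact h𝒯.maslovIndex_liftedTriangles (finrank_R2 n) (stdForm_isAlt n) (stdForm_nondegenerate n)
    (ξ := fun x => (h.ξ x).1) (fun x => (h.ξ x).2)
    (fun γ => ⟨spEquiv (h.ρ γ)⁻¹, stdForm_spEquiv _, fun x => by rw [xi_act]; rfl⟩)
    hm _ _ _ (mem_liftedTriangles h₁ h₂ p)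

lemma posTriple_of_equiv {h h' : FramedRep v₀ n} (hm : h.IsMaximal) (e : h ≈ h') {u v w : T.Side}
    (h₁ : v = next u) (h₂ : w = next v) (p : pt v₀ ⟶ pt u) :
    PosTriple (stdForm n) (h'.ξ (tCover p)).1 (h'.ξ (tCover (p ≫ turnHom h₁ ≫ turnHom h₂))).1
      (h'.ξ (tCover (p ≫ turnHom h₁))).1 := by
  obtain ⟨g, -, hξ⟩ := e
  rw [hξ, hξ, hξ]
  exact (hm.posTriple h₁ h₂ p).smul g

/-- The loop made up of the path `f` and of paths from the base point to the ends of `f`. -/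
def loop (q : ∀ v : T.Side, pt v₀ ⟶ pt v) {v w : T.Side} (f : pt v ⟶ pt w) : π₁ v₀ :=
  asIso (q v ≫ f ≫ inv (q w))

variable (q : ∀ v : T.Side, pt v₀ ⟶ pt v)

lemma loop_id (v : T.Side) : loop q (𝟙 (pt v)) = 1 := by
  apply Iso.ext
  change q v ≫ 𝟙 _ ≫ inv (q v) = 𝟙 _
  simp

lemma loop_comp {u v w : T.Side} (f : pt u ⟶ pt v) (g : pt v ⟶ pt w) :
    loop q (f ≫ g) = loop q g * loop q f := by
  apply Iso.ext
  change q u ≫ (f ≫ g) ≫ inv (q w) = (q u ≫ f ≫ inv (q v)) ≫ (q v ≫ g ≫ inv (q w))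
  simp

/-- The paths `q` trivialize the representation at each vertex of the quiver, so that `ρ (loop q f)`
plays the role of parallel transport along `f`; equivariance says that it respects the framing seen
from the ends of `f`. -/
lemma rho_loop_smul (h : FramedRep v₀ n) {u v w : T.Side} (f : pt u ⟶ pt v) (p : pt v ⟶ pt w) :
    h.ρ (loop q f) • h.ξ (tCover (q u ≫ f ≫ p)) = h.ξ (tCover (q v ≫ p)) := by
  have e : act (tCover (q v ≫ p)) (loop q f) = tCover (q u ≫ f ≫ p) := by
    rw [act_tCover]
    congr 1
    change (q u ≫ f ≫ inv (q v)) ≫ q v ≫ p = _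
    simp
  rw [← e, xi_act, smul_inv_smul]

lemma conj_mul_conj (φ : T.Side → Sp n) (h : FramedRep v₀ n) {u v w : T.Side} (f : pt u ⟶ pt v)
    (g : pt v ⟶ pt w) :
    φ w * h.ρ (loop q g) * (φ v)⁻¹ * (φ v * h.ρ (loop q f) * (φ u)⁻¹)
      = φ w * h.ρ (loop q (f ≫ g)) * (φ u)⁻¹ := by
  rw [loop_comp, map_mul]
  group

lemma tCover_turn_turn_turn {u v w x : T.Side} (p : pt v₀ ⟶ pt u) (h₁ : v = next u)
    (h₂ : w = next v) (h₃ : x = next w) :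
    tCover (p ≫ turnHom h₁ ≫ turnHom h₂ ≫ turnHom h₃) = tCover p := by
  obtain rfl : x = u := h₃.trans (eq_next_of_eq h₁ h₂).symm
  rw [turnHom_comp, Category.comp_id]

variable (E : Untwisting T) {q}

/-- Transition matrices of a framed representation in local frames. -/
def frameMat (φ : T.Side → Sp n) (h : FramedRep v₀ n) {v w : T.Side} (a : v ⟶ w) : Sp n :=
  signSp n (E.ε a) * (φ w * h.ρ (loop q (hc a.toPath)) * (φ v)⁻¹)

lemma frameMat_smul {φ : T.Side → Sp n} {h : FramedRep v₀ n} {v w u : T.Side} (a : v ⟶ w)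
    (p : pt w ⟶ pt u) {x : BdryCover v₀} {L L' : Lag n}
    (hx : x = tCover (q v ≫ hc a.toPath ≫ p)) (hL : φ v • h.ξ x = L)
    (hL' : φ w • h.ξ (tCover (q w ≫ p)) = L') : frameMat E (q := q) φ h a • L = L' := by
  subst hx
  rw [← hL, ← hL', frameMat, mul_smul, signSp_smul, mul_smul, inv_smul_smul, mul_smul,
    rho_loop_smul]

/-- `φ` brings the triple of Lagrangians of each face to the standard position. -/
structure IsFrame (q : ∀ v : T.Side, pt v₀ ⟶ pt v) (φ : T.Side → Sp n) (h : FramedRep v₀ n) :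
    Prop where
  lagE : ∀ v, φ v • h.ξ (tCover (q v)) = lagE n
  lagD : ∀ v, φ v • h.ξ (tCover (q v ≫ turnHom (rfl : next v = next v) ≫
    turnHom (rfl : next (next v) = next (next v)))) = lagD n
  lagF : ∀ v, φ v • h.ξ (tCover (q v ≫ turnHom (rfl : next v = next v))) = lagF n

/-- A continuous family of framed representations with frames defines a family of transition
matrices. -/
def transFamily {U : Type*} [TopologicalSpace U] (h : U → FramedRep v₀ n) (hh : Continuous h)
    (φ : U → T.Side → Sp n) (hφ : Continuous φ) (hf : ∀ x, IsFrame q (φ x) (h x)) :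
    TransFamily T n U where
  G a x := frameMat E (q := q) (φ x) (h x) a
  cont {v w} a := continuous_const.mul ((((continuous_apply w).comp hφ).mul
    ((continuous_rho _).comp hh)).mul ((continuous_apply v).comp hφ).inv)
  cross_lagE {v w} hv e x := frameMat_smul E _ (turnHom (rfl : next w = next w))
    (tCover_cross_turn (q v) hv e rfl).symm ((hf x).lagE v) ((hf x).lagF w)
  cross_lagF {v w} hv e x := frameMat_smul E _
    (crossHom (opp_ne_of_eq hv e) (eq_opp_of_eq e) ≫ turnHom (rfl : next v = next v))
    (by
      congr 2
      rw [← Category.assoc]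
      exact (congrArg (· ≫ _) (crossHom_comp hv e _ _)).trans (Category.id_comp _) |>.symm)
    ((hf x).lagF v) (by rw [tCover_cross_turn, (hf x).lagE w])
  -- From `w = next v`, two more turns lead back to `v`; so `t(v)` is the third vertex of the face
  -- as seen from `w`.
  turn_lagE {v w} e x := by
    subst e
    refine frameMat_smul E _ (turnHom (rfl : next (next v) = next (next v)) ≫
      turnHom (rfl : next (next (next v)) = next (next (next v)))) ?_ ((hf x).lagE v)
      ((hf x).lagD _)
    exact (tCover_turn_turn_turn _ _ _ _).symm
  turn_lagD {v w} e x := by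
    subst e
    exact frameMat_smul E _ (turnHom (rfl : next (next v) = next (next v))) rfl ((hf x).lagD v)
      ((hf x).lagF _)
  turn_lagF {v w} e x := by
    subst e
    refine frameMat_smul E _ (𝟙 _) ?_ ((hf x).lagF v) (by rw [Category.comp_id, (hf x).lagE])
    rw [Category.comp_id]
    rfl
  two {v w} hv e hw e' x := by
    have e₁ : hc (Quiver.Hom.toPath (V := T.Side) (Arrow.cross hv e)) ≫
        hc (Quiver.Hom.toPath (V := T.Side) (Arrow.cross hw e')) = 𝟙 _ := crossHom_comp hv e hw e'
    rw [frameMat, frameMat, signSp_mul_mul, conj_mul_conj, e₁, loop_id, map_one, mul_one,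
      mul_inv_cancel, mul_one, E.two, signSp_neg_one]
  three {u v w} e₁ e₂ e₃ x := by
    have e₄ : (hc (Quiver.Hom.toPath (V := T.Side) (Arrow.turn e₁)) ≫
        hc (Quiver.Hom.toPath (V := T.Side) (Arrow.turn e₂))) ≫
        hc (Quiver.Hom.toPath (V := T.Side) (Arrow.turn e₃)) = 𝟙 _ :=
      (Category.assoc _ _ _).trans (turnHom_comp e₁ e₂ e₃)
    rw [frameMat, frameMat, frameMat, signSp_mul_mul, conj_mul_conj, signSp_mul_mul,
      conj_mul_conj, e₄, loop_id, map_one, mul_one, mul_inv_cancel, mul_one, ← mul_assoc, E.three,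
      signSp_neg_one]

-- An identity between transition matrices on arrows propagates to paths; the sign in `frameMat`
-- cancels the one in `untwMat`.
variable {E} in
lemma holMap_eq_of_frameMat {h : FramedRep v₀ n} {φ : T.Side → Sp n}
    {z : (T.A₂ → SymPos n) × (T.A₃ → OO n)} (hz : z ∈ Coord T n) {k : T.Side → Sp n}
    (hk : ∀ {v w : T.Side} (a : v ⟶ w),
      k w * frameMat E (q := q) φ h a * (k v)⁻¹ = transMat z a) {v w : T.Side} (f : pt v ⟶ pt w) :
    holMap E hz f = (k w * φ w) * h.ρ (loop q f) * (k v * φ v)⁻¹ := by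
  obtain ⟨p, rfl⟩ := exists_hc_eq f
  induction p with
  | nil => rw [hc_nil, holMap_id, loop_id, map_one, mul_one, mul_inv_cancel]
  | @cons u w p a ih =>
    have e : untwMat E z a = (k w * φ w) * h.ρ (loop q (hc a.toPath)) * (k u * φ u)⁻¹ := by
      rw [untwMat, ← hk a, frameMat, ← mul_assoc, ← mul_assoc, ← mul_assoc, signSp_mul_comm _ (k w),
        mul_assoc (k w), signSp_mul_self, mul_one, mul_inv_rev]
      simp only [mul_assoc]
    rw [hc_cons, holMap_comp, ih, holMap_toPath, e]
    exact conj_mul_conj q (fun v => k v * φ v) h (hc p) (hc a.toPath)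

variable {E} in
lemma equiv_holRep {h : FramedRep v₀ n} {φ : T.Side → Sp n} (hf : IsFrame q φ h)
    {z : (T.A₂ → SymPos n) × (T.A₃ → OO n)} (hz : z ∈ Coord T n) {k : T.Side → OO n}
    (hk : ∀ {v w : T.Side} (a : v ⟶ w),
      diagO (k w) * frameMat E (q := q) φ h a * (diagO (k v))⁻¹ = transMat z a) :
    h ≈ holRep E hz v₀ := by
  have key {v w : T.Side} (f : pt v ⟶ pt w) := holMap_eq_of_frameMat hz hk f
  -- The chosen path from the base point to itself need not be trivial; the conjugating matrix has
  -- to be corrected by its holonomy.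
  let c : π₁ v₀ := asIso (q v₀)
  refine ⟨diagO (k v₀) * φ v₀ * (h.ρ c)⁻¹, fun γ => ?_, fun x => ?_⟩
  · have e : loop q γ.hom = c⁻¹ * γ * c := by
      apply Iso.ext
      change q v₀ ≫ γ.hom ≫ inv (q v₀) = q v₀ ≫ γ.hom ≫ inv (q v₀)
      rfl
    rw [holRep_ρ, key, e, map_mul, map_mul, map_inv]
    group
  · obtain ⟨v, p, rfl⟩ := exists_tCover_eq x
    rw [holRep_ξ, key, inv_smul_eq_iff]
    have e := rho_loop_smul q h p (𝟙 _)
    rw [Category.comp_id, Category.comp_id] at e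
    have e' : act (tCover p) c = tCover (q v₀ ≫ p) := rfl
    rw [← e', xi_act] at e
    simp only [mul_smul, inv_smul_smul, mul_inv_rev]
    rw [e, hf.lagE, diagO_smul_lagE]

/-- The classes of maximal framed representations. -/
def maxSet (v₀ : T.Side) (n : ℕ) : Set (RepF v₀ n) :=
  {c | ∃ h : FramedRep v₀ n, h.IsMaximal ∧ c = ⟦h⟧}

/-- Local continuous coordinates on the space of maximal framed representations. -/
theorem exists_local_coord {S : Set T.A₃} (hS : T.IsSpanningTree S)
    (h₀ : ((fun h => ⟦h⟧ : FramedRep v₀ n → RepF v₀ n) ⁻¹' maxSet v₀ n : Set _)) :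
    ∃ U : Set ((fun h => ⟦h⟧ : FramedRep v₀ n → RepF v₀ n) ⁻¹' maxSet v₀ n : Set _),
      IsOpen U ∧ h₀ ∈ U ∧ ∃ z : U → CoordS T n S, Continuous z ∧
        ∀ x : U, x.1.1 ≈ holRep E (z x).2.1 v₀ := by
  have q : ∀ v, pt v₀ ⟶ pt v := fun v => (nonempty_hom_of_connects hS.1 v₀ v).some
  have hpos : ∀ (v : T.Side)
      (x : ((fun h => ⟦h⟧ : FramedRep v₀ n → RepF v₀ n) ⁻¹' maxSet v₀ n : Set _)),
      PosTriple (stdForm n) (x.1.ξ (tCover (q v))).1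
        (x.1.ξ (tCover (q v ≫ turnHom (rfl : next v = next v) ≫
          turnHom (rfl : next (next v) = next (next v))))).1
        (x.1.ξ (tCover (q v ≫ turnHom (rfl : next v = next v)))).1 := by
    rintro v ⟨x, h, hm, e⟩
    exact posTriple_of_equiv hm (Quotient.exact e.symm) rfl rfl (q v)
  -- Near `h₀`, frames at each side can be chosen to depend continuously on the representation;
  -- there are finitely many sides, so the intersection of the neighbourhoods is open.
  choose U hU hmem φ hφ hL using fun v => exists_continuous_frame
    ((continuous_xi _).comp continuous_subtype_val) ((continuous_xi _).comp continuous_subtype_val)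
    ((continuous_xi _).comp continuous_subtype_val) (hpos v) h₀
  have hm : ∀ (x : (⋂ v, U v : Set _)) v, x.1 ∈ U v := fun x v => Set.mem_iInter.mp x.2 v
  have hf : ∀ x : (⋂ v, U v : Set _), IsFrame q (fun v => φ v x.1) x.1.1 := fun x =>
    ⟨fun v => (hL v x.1 (hm x v)).1, fun v => (hL v x.1 (hm x v)).2.1,
      fun v => (hL v x.1 (hm x v)).2.2⟩
  obtain ⟨k, z, -, hz, hk⟩ := (transFamily E (q := q) (U := (⋂ v, U v : Set _)) (fun x => x.1.1)
    (continuous_subtype_val.comp continuous_subtype_val) (fun x v => φ v x.1)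
    (continuous_pi fun v => (hφ v).comp_continuous continuous_subtype_val fun x => hm x v)
    hf).exists_coord hS v₀
  exact ⟨⋂ v, U v, isOpen_iInter_of_finite hU, Set.mem_iInter.mpr hmem, z, hz, fun x =>
    equiv_holRep (hf x) (z x).2.1 (k := fun v => k v x) fun a => hk a x⟩

end FramedRep

/-! ### The homeomorphism induced by the holonomy -/

section Homeo

variable {T : IdealTriangulation} {n : ℕ} (E : Untwisting T)

lemma mul_mul_inv_eq_of_conj {G : Type*} [Group G] {a b a' b' g : G}
    (h : b'⁻¹ * a' = g * (b⁻¹ * a) * g⁻¹) : a' * g * a⁻¹ = b' * g * b⁻¹ := by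
  have e : a' = b' * (g * (b⁻¹ * a) * g⁻¹) := by rw [← h, mul_inv_cancel_left]
  rw [e]
  group

/-- A matrix `g` conjugating the representations is transported to every vertex as `hol'(p) g
hol(p)⁻¹`. These matrices intertwine the transition matrices and preserve the framing, so
`exists_conj_of_intertwine` applies. -/
lemma holRep_equiv_iff {S : Set T.A₃} (hS : T.Connects S) (v₀ : T.Side)
    {z z' : (T.A₂ → SymPos n) × (T.A₃ → OO n)} (hz : z ∈ Coord T n) (hz' : z' ∈ Coord T n)
    (hzS : ∀ a ∈ S, z.2 a = 1) (hzS' : ∀ a ∈ S, z'.2 a = 1) :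
    holRep E hz v₀ ≈ holRep E hz' v₀ ↔ conjSetoid T.A₂ T.A₃ n z z' := by
  constructor
  · rintro ⟨g, hρ, hξ⟩
    have hξ' : ∀ {v : T.Side} (p : pt v₀ ⟶ pt v),
        (holMap E hz' p * g * (holMap E hz p)⁻¹) • lagE n = lagE n := by
      intro v p
      have := hξ (tCover p)
      rw [holRep_ξ, holRep_ξ, inv_smul_eq_iff] at this
      rw [mul_smul, mul_smul, ← this]
    have q : ∀ v, pt v₀ ⟶ pt v := fun v => (nonempty_hom_of_connects hS v₀ v).some
    -- Independence of the path: two paths differ by a loop at the base point, where `g` intertwines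
    -- the holonomies.
    have hind : ∀ {v : T.Side} (p p' : pt v₀ ⟶ pt v),
        holMap E hz' p * g * (holMap E hz p)⁻¹
          = holMap E hz' p' * g * (holMap E hz p')⁻¹ := by
      intro v p p'
      have : holMap E hz' (p ≫ inv p') = g * holMap E hz (p ≫ inv p') * g⁻¹ :=
        hρ (asIso (p ≫ inv p'))
      have e : ∀ {y} (hy : y ∈ Coord T n), holMap E hy (p ≫ inv p')
          = (holMap E hy p')⁻¹ * holMap E hy p := by
        intro y hy
        rw [eq_inv_mul_iff_mul_eq, ← holMap_comp, Category.assoc, IsIso.inv_hom_id,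
          Category.comp_id]
      rw [e, e] at this
      exact mul_mul_inv_eq_of_conj this
    refine exists_conj_of_intertwine hS v₀ ⟨hz, hzS⟩ ⟨hz', hzS'⟩
      (fun v => holMap E hz' (q v) * g * (holMap E hz (q v))⁻¹) (fun v => hξ' _)
      (fun v => ?_) (fun {v w} a => ?_)
    -- A turn takes `Span(f)` to `Span(e)`, so the invariance of `Span(e)` at the next side is the
    -- invariance of `Span(f)` at `v`.
    · have e := hξ' (q v ≫ turnHom (rfl : next v = next v))
      rw [holMap_comp, holMap_comp, mul_inv_rev] at e
      simp only [mul_smul] at e ⊢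
      have e₁ : ∀ {y} (hy : y ∈ Coord T n),
          (holMap E hy (turnHom (rfl : next v = next v)))⁻¹ • lagE n = lagF n := fun hy => by
        rw [inv_smul_eq_iff, holMap_turn_lagF]
      rwa [e₁, ← eq_inv_smul_iff, e₁] at e
    · rw [hind (q w) (q v ≫ hc (Quiver.Hom.toPath (V := T.Side) a)), holMap_comp, holMap_comp,
        holMap_toPath, holMap_toPath, untwMat, untwMat, mul_inv_rev]
      have e := signSp_conj (E.ε a) (transMat z' a) (transMat z a)
        (holMap E hz' (q v) * g * (holMap E hz (q v))⁻¹)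
      rw [← e]
      simp only [mul_assoc]
  · rintro ⟨w, h₁, h₂⟩
    have key : ∀ {v v' : T.Side} (f : pt v ⟶ pt v'),
        holMap E hz' f = diagO w * holMap E hz f * (diagO w)⁻¹ := by
      intro v v' f
      obtain ⟨p, rfl⟩ := exists_hc_eq f
      induction p with
      | nil => rw [hc_nil, holMap_id, holMap_id]; group
      | cons p a ih =>
        have e : untwMat E z' a = diagO w * untwMat E z a * (diagO w)⁻¹ := by
          rw [untwMat, untwMat, diagO_mul_transMat w h₁ h₂, ← mul_assoc, ← mul_assoc, ← mul_assoc,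
            signSp_mul_comm _ (diagO w)]
        rw [hc_cons, holMap_comp, holMap_comp, ih, holMap_toPath, holMap_toPath, e]
        group
    refine ⟨diagO w, fun γ => key γ.hom, fun x => ?_⟩
    obtain ⟨v, p, rfl⟩ := exists_tCover_eq x
    rw [holRep_ξ, holRep_ξ, key, inv_smul_eq_iff]
    simp only [mul_smul, inv_smul_smul]
    rw [smul_inv_smul, diagO_smul_lagE]

/-- The holonomy, as a map to the space of framed maximal representations. -/
def holClass {S : Set T.A₃} (v₀ : T.Side) (z : CoordS T n S) : MaxRepF v₀ n :=
  ⟨⟦holRep E z.2.1 v₀⟧, _, holRep_isMaximal E z.2.1 v₀, rfl⟩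

lemma continuous_holClass {S : Set T.A₃} (v₀ : T.Side) :
    Continuous (holClass E v₀ : CoordS T n S → MaxRepF v₀ n) :=
  Continuous.subtype_mk (continuous_quot_mk.comp (continuous_holRep E v₀)) _

lemma holClass_eq_iff {S : Set T.A₃} (hS : T.Connects S) (v₀ : T.Side) (z z' : CoordS T n S) :
    holClass E v₀ z = holClass E v₀ z' ↔ coordSSetoid T n S z z' := by
  refine Iff.trans ?_ (holRep_equiv_iff E hS v₀ z.2.1 z'.2.1 z.2.2 z'.2.2)
  rw [holClass, holClass, Subtype.mk.injEq]
  exact ⟨Quotient.exact, fun h => Quotient.sound h⟩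

namespace FramedRep

variable {v₀ : T.Side}

/-- The saturation of an open set is the union of its preimages under conjugations, which are
continuous. -/
lemma isOpenMap_mk : IsOpenMap (fun h => ⟦h⟧ : FramedRep v₀ n → RepF v₀ n) := by
  let conj : Sp n → FramedRep v₀ n → FramedRep v₀ n := fun g h =>
    { ρ := (MulAut.conj g).toMonoidHom.comp h.ρ
      ξ := fun x => g • h.ξ x
      equivariant := fun γ x => by
        rw [h.equivariant]
        change _ = (g * h.ρ γ * g⁻¹) • g • h.ξ x
        simp only [mul_smul, inv_smul_smul] }
  have hconj : ∀ g, Continuous (conj g) := by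
    intro g
    rw [continuous_induced_rng]
    exact Continuous.prodMk
      (continuous_pi fun γ => (continuous_const.mul (continuous_rho γ)).mul continuous_const)
      (continuous_pi fun x => (continuous_xi x).const_smul g)
  intro U hU
  have e : (fun h => ⟦h⟧ : FramedRep v₀ n → RepF v₀ n) ⁻¹' ((fun h => ⟦h⟧) '' U)
      = ⋃ g, conj g ⁻¹' U := by
    ext h
    simp only [Set.mem_preimage, Set.mem_image, Set.mem_iUnion]
    constructor
    · rintro ⟨h', hU', e⟩
      obtain ⟨g, hρ, hξ⟩ := Quotient.exact e.symm
      have : conj g h = h' := by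
        obtain ⟨ρ', ξ', _⟩ := h'
        have e₁ : (MulAut.conj g).toMonoidHom.comp h.ρ = ρ' :=
          MonoidHom.ext fun γ => (hρ γ).symm
        have e₂ : (fun x => g • h.ξ x) = ξ' := funext fun x => (hξ x).symm
        subst e₁ e₂
        rfl
      exact ⟨g, this ▸ hU'⟩
    · rintro ⟨g, hg⟩
      have hc : h ≈ conj g h := ⟨g, fun _ => rfl, fun _ => rfl⟩
      exact ⟨_, hg, (Quotient.sound hc).symm⟩
  refine isOpen_coinduced.mpr ?_
  change IsOpen ((fun h => ⟦h⟧ : FramedRep v₀ n → RepF v₀ n) ⁻¹' ((fun h => ⟦h⟧) '' U))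
  rw [e]
  exact isOpen_iUnion fun g => hU.preimage (hconj g)

/-- The projection from maximal framed representations to their classes. -/
lemma isQuotientMap_restrictPreimage :
    Topology.IsQuotientMap ((maxSet v₀ n).restrictPreimage
      (fun h => ⟦h⟧ : FramedRep v₀ n → RepF v₀ n)) := by
  -- The set of maximal classes is not known to be open or closed here; it is the openness of the
  -- projection that makes its restriction a quotient map.
  refine (isOpenMap_mk.restrictPreimage _).isQuotientMap
    (continuous_quot_mk.restrictPreimage) ?_
  exact Set.restrictPreimage_surjective _ Quotient.mk_surjective

end FramedRep

/-- The homeomorphism induced by the holonomy. -/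
theorem exists_homeomorph_maxRepF {S : Set T.A₃} (hS : T.IsSpanningTree S) (v₀ : T.Side) :
    ∃ Φ : _root_.Quotient (coordSSetoid T n S) ≃ₜ MaxRepF v₀ n,
      ∀ z : CoordS T n S, Φ (Quotient.mk _ z) = holClass E v₀ z := by
  let F : _root_.Quotient (coordSSetoid T n S) → MaxRepF v₀ n :=
    Quotient.lift (holClass E v₀) fun z z' h => (holClass_eq_iff E hS.1 v₀ z z').mpr h
  have hF : Continuous F := (continuous_holClass E v₀).quotient_lift _
  have hinj : Function.Injective F := by
    intro a b h
    induction a using Quotient.ind with | _ z => ?_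
    induction b using Quotient.ind with | _ z' => ?_
    exact Quotient.sound ((holClass_eq_iff E hS.1 v₀ z z').mp h)
  have hloc := fun h₀ => FramedRep.exists_local_coord (v₀ := v₀) (n := n) E hS h₀
  have hz : ∀ {z : CoordS T n S}
      {x : ((fun h => ⟦h⟧ : FramedRep v₀ n → RepF v₀ n) ⁻¹' FramedRep.maxSet v₀ n : Set _)},
      x.1 ≈ holRep E z.2.1 v₀ → F (Quotient.mk _ z) =
        (FramedRep.maxSet v₀ n).restrictPreimage (fun h => ⟦h⟧) x :=
    fun h => Subtype.ext (Quotient.sound h).symm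
  have hsurj : Function.Surjective F := by
    intro c
    obtain ⟨x, rfl⟩ := FramedRep.isQuotientMap_restrictPreimage.surjective c
    obtain ⟨U, -, hx, z, -, h⟩ := hloc x
    exact ⟨_, hz (h ⟨x, hx⟩)⟩
  let e := Equiv.ofBijective F ⟨hinj, hsurj⟩
  refine ⟨⟨e, hF, ?_⟩, fun z => rfl⟩
  -- Continuity of the inverse can be checked on framed representations, before passing to classes;
  -- there it is locally the class of the continuous coordinates `z`.
  refine (FramedRep.isQuotientMap_restrictPreimage (v₀ := v₀) (n := n)).continuous_iff.mpr
    (continuous_iff_continuousAt.mpr ?_)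
  intro x
  obtain ⟨U, hU, hx, z, hzc, h⟩ := hloc x
  refine ContinuousOn.continuousAt ?_ (hU.mem_nhds hx)
  rw [continuousOn_iff_continuous_domRestrict]
  exact (continuous_quot_mk.comp hzc).congr fun y =>
    ((Equiv.symm_apply_eq e).mpr (hz (h y)).symm).symm

end Homeo

/-! ### Counting faces, edges and vertices -/

namespace IdealTriangulation

variable {T : IdealTriangulation}

instance : Finite T.BdryComp := inferInstanceAs (Finite (Quot _))

/-- A numbering of the sides. -/
def rank (v : T.Side) : ℕ := (Fintype.equivFin T.Side v).1

lemma rank_injective : Function.Injective (rank : T.Side → ℕ) :=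
  Fin.val_injective.comp (Fintype.equivFin T.Side).injective

variable (T) in
/-- The internal edges, represented by one of their two sides. -/
abbrev InnerEdge := {v : T.Side // rank v < rank (opp v)}

variable (T) in
/-- The external edges. -/
abbrev OuterEdge := {v : T.Side // opp v = v}

lemma opp_ne_of_rank_lt {v : T.Side} (h : rank v < rank (opp v)) : opp v ≠ v := by
  intro e
  rw [e] at h
  exact lt_irrefl _ h

lemma rank_lt_or {v : T.Side} (h : opp v ≠ v) :
    rank v < rank (opp v) ∨ rank (opp v) < rank (opp (opp v)) := by
  rw [opp_opp]
  exact Nat.lt_or_gt_of_ne fun e => h (rank_injective e).symm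

/-- Turning around a vertex of the triangulation. -/
def turnPerm : Equiv.Perm T.Side where
  toFun v := next (opp v)
  invFun v := opp (next (next v))
  left_inv v := by
    change opp (next (next (next (opp v)))) = v
    rw [next_next_next, opp_opp]
  right_inv v := by
    change next (opp (opp (next (next v)))) = v
    rw [opp_opp, next_next_next]

/-- Turning around a vertex is a deterministic rewriting that stops exactly at external sides. Two
external sides with the same endpoint `t` have a common reduct, and neither can be rewritten. -/
lemma t_injective_outer {v w : T.Side} (hv : opp v = v) (hw : opp w = w) (h : T.t v = T.t w) :
    v = w := by
  have h' := Quot.eqvGen_exact h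
  let R : T.Side → T.Side → Prop := fun v w => opp v ≠ v ∧ w = next (opp v)
  have hR : Equivalence (Relation.Join (Relation.ReflTransGen R)) := by
    apply Relation.equivalence_join_reflTransGen
    rintro a b c ⟨-, rfl⟩ ⟨-, rfl⟩
    exact ⟨_, Relation.ReflGen.refl, Relation.ReflTransGen.refl⟩
  have hj : Relation.Join (Relation.ReflTransGen R) v w := by
    refine (hR.eqvGen_iff).mp (h'.mono fun a b hab => ?_)
    exact ⟨b, Relation.ReflTransGen.single hab, Relation.ReflTransGen.refl⟩
  have hend : ∀ {x y : T.Side}, opp x = x → Relation.ReflTransGen R x y → y = x := by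
    intro x y hx hxy
    rcases Relation.ReflTransGen.cases_head hxy with h | ⟨c, hc, -⟩
    · exact h.symm
    · exact absurd hx hc.1
  obtain ⟨x, h₁, h₂⟩ := hj
  rw [← hend hv h₁, hend hw h₂]

/-- Turning around `b(v)` from `next v`, either an external side is met, or the orbit of the
permutation closes up at `v`, which is itself external. -/
lemma exists_outer_t_eq {v : T.Side} (hv : opp v = v) :
    ∃ w, opp w = w ∧ T.t w = T.b v := by
  have key : ∀ k : ℕ, (∃ w, opp w = w ∧ T.t w = T.b v) ∨
      T.t ((turnPerm ^ k) (next v)) = T.b v := by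
    intro k
    induction k with
    | zero => exact Or.inr rfl
    | succ k ih =>
      rcases ih with h | h
      · exact Or.inl h
      · by_cases hk : opp ((turnPerm ^ k) (next v)) = (turnPerm ^ k) (next v)
        · exact Or.inl ⟨_, hk, h⟩
        · right
          rw [← h, pow_succ', Equiv.Perm.mul_apply]
          exact (Quot.sound ⟨hk, rfl⟩ : T.t _ = T.t _).symm
  have hfin := isOfFinOrder_of_finite (turnPerm : Equiv.Perm T.Side)
  have hpos := hfin.orderOf_pos
  -- As `v` is external, `next v` is already its first turn, which explains the exponent `orderOf -
  -- 1`.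
  have e : (turnPerm ^ (orderOf (turnPerm : Equiv.Perm T.Side) - 1)) (next v) = v := by
    have h₁ : next v = turnPerm v := by
      change _ = next (opp v)
      rw [hv]
    rw [h₁, ← Equiv.Perm.mul_apply, ← pow_succ, Nat.sub_add_cancel hpos, pow_orderOf_eq_one]
    rfl
  rcases key (orderOf (turnPerm : Equiv.Perm T.Side) - 1) with h | h
  · exact h
  · rw [e] at h
    exact ⟨v, hv, h⟩

variable (T)

/-- Each noncompact component is the endpoint `t` of exactly one external side. -/
lemma card_not_isCompactComp : Nat.card {x : T.BdryComp // ¬ T.IsCompactComp x} = T.r := by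
  refine (Nat.card_congr (Equiv.ofBijective
    (fun v : T.OuterEdge => (⟨T.t v.1, fun h => (h v.1 v.2).1 rfl⟩ :
      {x : T.BdryComp // ¬ T.IsCompactComp x})) ⟨?_, ?_⟩)).symm
  · intro v w h
    exact Subtype.ext (t_injective_outer v.2 w.2 (congrArg Subtype.val h))
  · rintro ⟨x, hx⟩
    simp only [IsCompactComp, not_forall, not_and_or, not_not] at hx
    obtain ⟨v, hv, rfl | rfl⟩ := hx
    · exact ⟨⟨v, hv⟩, rfl⟩
    · obtain ⟨w, hw, e⟩ := exists_outer_t_eq hv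
      exact ⟨⟨w, hw⟩, Subtype.ext e⟩

lemma card_bdryComp : Nat.card T.BdryComp
    = Nat.card {x : T.BdryComp // T.IsCompactComp x} + T.r := by
  classical
  rw [← card_not_isCompactComp, ← Nat.card_sum, Nat.card_congr (Equiv.sumCompl T.IsCompactComp)]

lemma card_edge : Nat.card T.Edge = Nat.card T.InnerEdge + T.r := by
  rw [r, ← Nat.card_sum]
  refine (Nat.card_congr (Equiv.ofBijective
    (Sum.elim (fun v : T.InnerEdge => edge v.1) fun v : T.OuterEdge => edge v.1) ⟨?_, ?_⟩)).symm
  · rintro (v | v) (w | w) h <;> rcases edge_eq_iff.mp h with e | e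
    · rw [Subtype.ext e]
    · have h₁ := v.2
      have h₂ := w.2
      rw [e, opp_opp] at h₂
      exact absurd h₁ h₂.not_gt
    · exact absurd (e ▸ w.2) (opp_ne_of_rank_lt v.2)
    · have h₁ := w.2
      rw [e, opp_opp] at h₁
      exact absurd h₁.symm (opp_ne_of_rank_lt v.2)
    · exact absurd v.2 (e ▸ opp_ne_of_rank_lt w.2)
    · rw [v.2] at e
      exact absurd v.2 (e ▸ opp_ne_of_rank_lt w.2)
    · rw [Subtype.ext e]
    · rw [v.2] at e
      rw [Subtype.ext e]
  · intro x
    induction x using Quot.ind with | mk v => ?_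
    by_cases hv : opp v = v
    · exact ⟨Sum.inr ⟨v, hv⟩, rfl⟩
    · rcases rank_lt_or hv with h | h
      · exact ⟨Sum.inl ⟨v, h⟩, rfl⟩
      · exact ⟨Sum.inl ⟨opp v, h⟩, edge_opp v⟩

lemma card_side : Nat.card T.Side = 3 * Nat.card T.Face := by
  change Nat.card (T.Face × ZMod 3) = _
  rw [Nat.card_prod, Nat.card_zmod, mul_comm]

lemma card_side_eq_two_mul : Nat.card T.Side = 2 * Nat.card T.InnerEdge + T.r := by
  rw [r, two_mul, ← Nat.card_sum, ← Nat.card_sum]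
  refine (Nat.card_congr (Equiv.ofBijective
    (Sum.elim (Sum.elim (fun v : T.InnerEdge => v.1) fun v : T.InnerEdge => opp v.1)
      fun v : T.OuterEdge => v.1) ⟨?_, ?_⟩)).symm
  · have hoo : ∀ v w : T.InnerEdge, v.1 ≠ opp w.1 := by
      intro v w e
      have h₁ := v.2
      have h₂ := w.2
      rw [e, opp_opp] at h₁
      exact h₁.not_gt h₂
    have hio : ∀ (v : T.InnerEdge) (w : T.OuterEdge), v.1 ≠ w.1 := fun v w e =>
      opp_ne_of_rank_lt v.2 (e ▸ w.2)
    have hoi : ∀ (v : T.InnerEdge) (w : T.OuterEdge), opp v.1 ≠ w.1 := fun v w e =>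
      opp_ne_of_rank_lt v.2 (by
        have := w.2
        rw [← e, opp_opp] at this
        exact this.symm)
    rintro ((v | v) | v) ((w | w) | w) h <;> simp only [Sum.elim_inl, Sum.elim_inr] at h
    · rw [Subtype.ext h]
    · exact absurd h (hoo v w)
    · exact absurd h (hio v w)
    · exact absurd h.symm (hoo w v)
    · rw [Subtype.ext (T.glue_glue.injective h)]
    · exact absurd h (hoi v w)
    · exact absurd h.symm (hio w v)
    · exact absurd h.symm (hoi w v)
    · rw [Subtype.ext h]
  · intro v
    by_cases hv : opp v = v
    · exact ⟨Sum.inr ⟨v, hv⟩, rfl⟩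
    · rcases rank_lt_or hv with h | h
      · exact ⟨Sum.inl (Sum.inl ⟨v, h⟩), rfl⟩
      · exact ⟨Sum.inl (Sum.inr ⟨opp v, h⟩), opp_opp T v⟩

/-- In the alternating sum, the compact components are removed and the noncompact ones, equal in
number to the external edges, cancel against these. -/
lemma eulerChar_eq : T.eulerChar = (Nat.card T.Face : ℤ) - Nat.card T.InnerEdge := by
  have h₁ := T.card_bdryComp
  have h₂ := T.card_edge
  rw [eulerChar]
  omega

/-- Counting sides gives `3F = 2I + r` for `F` faces and `I` internal edges; combined with `χ = F -
I`, this is `I = -3χ + r`. -/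
lemma toNat_card_innerEdge : (-3 * T.eulerChar + T.r).toNat = Nat.card T.InnerEdge := by
  have h₁ := T.card_side
  have h₂ := T.card_side_eq_two_mul
  rw [eulerChar_eq]
  omega

variable {T}

/-- The three arrows of a face form a cycle, and a minimal connecting set cannot contain a cycle.
The missing arrow is the one for which the relation of the face will be solved. -/
lemma IsSpanningTree.exists_notMem {S : Set T.A₃} (hS : T.IsSpanningTree S) (f : T.Face) :
    ∃ v : T.Side, v.1 = f ∧ v ∉ S := by
  by_contra! hv
  let v : T.Side := (f, 0)
  have h₁ : v ∈ S \ {next (next v)} := ⟨hv _ rfl, fun e =>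
    next_ne (next (next v)) ((next_next_next T v).trans e)⟩
  have h₂ : next v ∈ S \ {next (next v)} := ⟨hv _ rfl, fun e => next_ne _ (Eq.symm e)⟩
  refine hS.2 (next (next v)) (hv _ rfl) fun x y => ?_
  have := hS.1 x y
  induction this with
  | rel x y h =>
    rcases h with h | ⟨hx, h⟩
    · exact Relation.EqvGen.rel _ _ (Or.inl h)
    · by_cases e : x = next (next v)
      · rw [h, e, next_next_next]
        refine Relation.EqvGen.symm _ _ (Relation.EqvGen.trans _ (next v) _ ?_ ?_)
        · exact Relation.EqvGen.rel _ _ (Or.inr ⟨h₁, rfl⟩)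
        · exact Relation.EqvGen.rel _ _ (Or.inr ⟨h₂, rfl⟩)
      · exact Relation.EqvGen.rel _ _ (Or.inr ⟨⟨hx, e⟩, h⟩)
  | refl x => exact Relation.EqvGen.refl _
  | symm x y _ ih => exact Relation.EqvGen.symm _ _ ih
  | trans x y z _ _ ih₁ ih₂ => exact Relation.EqvGen.trans _ _ _ ih₁ ih₂

/-- The arrows inside the faces that remain free: those that are not in the tree `S` and are not
the chosen arrow of their face. -/
abbrev FreeArrow (S : Set T.A₃) (c : T.Face → T.Side) :=
  {v : T.Side // v ∉ S ∧ v ≠ c v.1}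

lemma IsSpanningTree.card_add_one {S : Set T.A₃} (hS : T.IsSpanningTree S) :
    S.ncard + 1 = Nat.card T.Edge := by
  have v₀ : T.Side := (Classical.arbitrary T.Face, 0)
  rw [← Set.ncard_univ, (hS.treeGrow v₀).ncard_eq]

/-- Of the `3F` arrows, the tree takes `I + r - 1`, one less than the number of edges, and the
chosen arrows take `F`; by `3F = 2I + r` there remain `I - F + 1 = -χ + 1`. -/
lemma toNat_card_freeArrow {S : Set T.A₃} (hS : T.IsSpanningTree S) {c : T.Face → T.Side}
    (hc : ∀ f, (c f).1 = f) (hcS : ∀ f, c f ∉ S) :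
    (-T.eulerChar + 1).toNat = Nat.card (FreeArrow S c) := by
  have h₁ := T.card_side
  have h₂ := T.card_side_eq_two_mul
  have h₃ := hS.card_add_one
  have h₄ := T.card_edge
  have h₅ : Nat.card T.Side = Nat.card (FreeArrow S c) + S.ncard + Nat.card T.Face := by
    rw [← Nat.card_coe_set_eq, ← Nat.card_sum, ← Nat.card_sum]
    refine (Nat.card_congr (Equiv.ofBijective
      (Sum.elim (Sum.elim (fun v : FreeArrow S c => v.1) fun v : S => v.1) c) ⟨?_, ?_⟩)).symm
    · have h₁ : ∀ (v : FreeArrow S c) (w : S), v.1 ≠ w.1 := fun v w h => v.2.1 (h ▸ w.2)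
      have h₂ : ∀ (v : FreeArrow S c) (f : T.Face), v.1 ≠ c f := by
        intro v f h
        have e : v.1.1 = f := (congrArg Prod.fst h).trans (hc f)
        exact v.2.2 (e ▸ h)
      have h₃ : ∀ (v : S) (f : T.Face), v.1 ≠ c f := fun v f h => hcS f (h ▸ v.2)
      rintro ((v | v) | f) ((w | w) | f') h
      · exact congrArg _ (congrArg _ (Subtype.ext h))
      · exact absurd h (h₁ v w)
      · exact absurd h (h₂ v f')
      · exact absurd h.symm (h₁ w v)
      · exact congrArg _ (congrArg _ (Subtype.ext h))
      · exact absurd h (h₃ v f')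
      · exact absurd h.symm (h₂ w f)
      · exact absurd h.symm (h₃ w f)
      · exact congrArg _ ((hc f).symm.trans ((congrArg Prod.fst h).trans (hc f')))
    · intro v
      by_cases h₁ : v ∈ S
      · exact ⟨Sum.inl (Sum.inr ⟨v, h₁⟩), rfl⟩
      · by_cases h₂ : v = c v.1
        · exact ⟨Sum.inr v.1, h₂.symm⟩
        · exact ⟨Sum.inl (Sum.inl ⟨v, h₁, h₂⟩), rfl⟩
  rw [eulerChar_eq]
  omega

variable (T) in
-- The sign `-1` on all arrows inside faces has product `-1` around a 3-cycle, and a numbering of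
-- the sides distinguishes the two arrows of each 2-cycle, which receive opposite signs.
lemma nonempty_untwisting : Nonempty (Untwisting T) := by
  let ε : ∀ {v w : T.Side}, T.Arrow v w → ℤˣ := fun {v w} a => match a with
    | Arrow.cross _ _ => if rank v < rank w then 1 else -1
    | Arrow.turn _ => -1
  refine ⟨⟨fun a => ε a, ?_, ?_⟩⟩
  · intro v w hv h hw h'
    change (if rank w < rank v then (1 : ℤˣ) else -1) * (if rank v < rank w then 1 else -1) = -1
    have hne : rank v ≠ rank w := fun e => hv (by rw [← h, rank_injective e])
    rcases Nat.lt_or_gt_of_ne hne with h | h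
    · rw [if_neg h.not_gt, if_pos h, mul_one]
    · rw [if_neg h.not_gt, if_pos h, one_mul]
  · intro u v w h₁ h₂ h₃
    change (-1 : ℤˣ) * -1 * -1 = -1
    simp

end IdealTriangulation

/-! ### Independent coordinates -/

section FreeCoord

variable {T : IdealTriangulation} {n : ℕ}

namespace IdealTriangulation

lemma eq_or_eq_next {v w : T.Side} (h : w.1 = v.1) : w = v ∨ w = next v ∨ w = next (next v) := by
  have h3 : ∀ i j : ZMod 3, j = i ∨ j = i + 1 ∨ j = i + 1 + 1 := by decide
  rcases h3 v.2 w.2 with e | e | e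
  · exact Or.inl (Prod.ext h e)
  · exact Or.inr (Or.inl (Prod.ext h e))
  · exact Or.inr (Or.inr (Prod.ext h e))

lemma next_next_ne (v : T.Side) : next (next v) ≠ v := fun h =>
  next_ne v (by conv_lhs => rw [← h, next_next_next])

/-- The internal edge crossed by an arrow. -/
def innerEdge (v : T.A₂) : T.InnerEdge :=
  if h : rank v.1 < rank (opp v.1) then ⟨v.1, h⟩
  else ⟨opp v.1, (rank_lt_or v.2).resolve_left h⟩

/-- The arrow attached to an internal edge. -/
def InnerEdge.arrow (v : T.InnerEdge) : T.A₂ := ⟨v.1, opp_ne_of_rank_lt v.2⟩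

lemma innerEdge_arrow (v : T.InnerEdge) : innerEdge v.arrow = v := dif_pos v.2

lemma innerEdge_opp {v w : T.A₂} (h : w.1 = opp v.1) : innerEdge w = innerEdge v := by
  rcases v with ⟨v, hv⟩
  rcases w with ⟨w, hw⟩
  dsimp only at h
  subst h
  unfold innerEdge
  simp only [opp_opp]
  by_cases e : rank v < rank (opp v)
  · rw [dif_neg e.not_gt, dif_pos e]
  · have e' := (rank_lt_or hv).resolve_left e
    rw [opp_opp] at e'
    rw [dif_pos e', dif_neg e]

end IdealTriangulation

lemma coord_arrow_innerEdge {x : (T.A₂ → SymPos n) × (T.A₃ → OO n)} (hx : x ∈ Coord T n)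
    (v : T.A₂) : x.1 (innerEdge v).arrow = x.1 v := by
  by_cases h : rank v.1 < rank (opp v.1)
  · have e : innerEdge v = ⟨v.1, h⟩ := dif_pos h
    rw [e]
    rfl
  · refine hx.1 v _ ?_
    have e : innerEdge v = ⟨opp v.1, (rank_lt_or v.2).resolve_left h⟩ := dif_neg h
    rw [e]
    rfl

variable {S : Set T.A₃} {c : T.Face → T.Side}

open scoped Classical in
/-- Extension by `1` of a family indexed by the free arrows. -/
def extendOne (y : FreeArrow S c → OO n) (v : T.Side) : OO n :=
  if h : v ∉ S ∧ v ≠ c v.1 then y ⟨v, h⟩ else 1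

open scoped Classical in
/-- Extension to all the arrows inside the faces of a family indexed by the free arrows. -/
def extendTurn (y : FreeArrow S c → OO n) (v : T.Side) : OO n :=
  if v = c v.1 then (extendOne y (next (next v)) * extendOne y (next v))⁻¹ else extendOne y v

lemma extendTurn_free (y : FreeArrow S c → OO n) (v : FreeArrow S c) :
    extendTurn y v.1 = y v := by
  rw [extendTurn, if_neg v.2.2, extendOne, dif_pos v.2]

lemma extendTurn_of_mem (hcS : ∀ f, c f ∉ S) (y : FreeArrow S c → OO n) {v : T.Side}
    (hv : v ∈ S) : extendTurn y v = 1 := by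
  have h : v ≠ c v.1 := fun e => hcS v.1 (e ▸ hv)
  rw [extendTurn, if_neg h, extendOne, dif_neg fun h => h.1 hv]

lemma mul_mul_eq_one_cyclic {G : Type*} [Group G] {a b c : G} (h : c * b * a = 1) :
    a * c * b = 1 := by
  have e : a = (c * b)⁻¹ := eq_inv_of_mul_eq_one_right h
  rw [e]
  group

/-- Starting from the chosen arrow of the face, the relation is the definition of the coordinate
there; the other starting points give cyclic permutations of the same product. -/
lemma extendTurn_mul (hc : ∀ f, (c f).1 = f) (y : FreeArrow S c → OO n) (v : T.Side) :
    extendTurn y (next (next v)) * extendTurn y (next v) * extendTurn y v = 1 := by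
  have key : ∀ w : T.Side, w = c w.1 →
      extendTurn y (next (next w)) * extendTurn y (next w) * extendTurn y w = 1 := by
    intro w hw
    have h₁ : next w ≠ c (next w).1 := fun e => next_ne w (e.trans hw.symm)
    have h₂ : next (next w) ≠ c (next (next w)).1 := fun e => next_next_ne w (e.trans hw.symm)
    conv_lhs => rw [extendTurn, extendTurn, extendTurn, if_neg h₁, if_neg h₂, if_pos hw]
    exact mul_inv_cancel _
  have hcv : c v.1 = c (c v.1).1 := by rw [hc]
  have := key _ hcv
  rcases eq_or_eq_next (hc v.1) with e | e | e
  · rwa [e] at this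
  · rw [e, next_next_next] at this
    exact mul_mul_eq_one_cyclic (mul_mul_eq_one_cyclic this)
  · rw [e, next_next_next, next_next_next] at this
    exact mul_mul_eq_one_cyclic this

/-- On the tree the coordinate is `1`, and on the chosen arrow it is forced by the relation of the
face; so the free arrows determine all the others. -/
lemma coordS_turn_eq {x : (T.A₂ → SymPos n) × (T.A₃ → OO n)} (hx : x ∈ CoordS T n S) :
    extendTurn (fun v : FreeArrow S c => x.2 v.1) = x.2 := by
  have h₁ : ∀ v : T.Side, v ≠ c v.1 → extendOne (fun v : FreeArrow S c => x.2 v.1) v = x.2 v := by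
    intro v hv
    by_cases hS : v ∈ S
    · rw [extendOne, dif_neg fun h => h.1 hS, hx.2 v hS]
    · rw [extendOne, dif_pos ⟨hS, hv⟩]
  funext v
  by_cases hv : v = c v.1
  · rw [extendTurn, if_pos hv, h₁ _ fun e => next_ne v (e.trans hv.symm),
      h₁ _ fun e => next_next_ne v (e.trans hv.symm)]
    exact (eq_inv_of_mul_eq_one_right (hx.1.2 v)).symm
  · rw [extendTurn, if_neg hv, h₁ v hv]

lemma continuous_extendTurn (v : T.Side) :
    Continuous fun y : FreeArrow S c → OO n => extendTurn y v := by
  have h : ∀ v : T.Side, Continuous fun y : FreeArrow S c → OO n => extendOne y v := by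
    intro v
    unfold extendOne
    split_ifs with h
    · exact continuous_apply _
    · exact continuous_const
  unfold extendTurn
  split_ifs
  · exact ((h _).mul (h _)).inv
  · exact h v

/-- The coordinates on the internal edges and on the free arrows are independent, and determine all
the others. -/
def freeCoordHomeomorph (hc : ∀ f, (c f).1 = f) (hcS : ∀ f, c f ∉ S) {J L : Type}
    (i : J ≃ T.InnerEdge) (k : L ≃ FreeArrow S c) :
    CoordS T n S ≃ₜ (J → SymPos n) × (L → OO n) where
  toFun x := (fun j => x.1.1 (i j).arrow, fun l => x.1.2 (k l).1)
  invFun y := ⟨(fun v => y.1 (i.symm (innerEdge v)), extendTurn fun v => y.2 (k.symm v)),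
    ⟨⟨fun v w h => congrArg (fun e => y.1 (i.symm e)) (innerEdge_opp h), extendTurn_mul hc _⟩,
      fun a ha => extendTurn_of_mem hcS _ ha⟩⟩
  left_inv x := by
    refine Subtype.ext (Prod.ext (funext fun v => ?_) ?_)
    · dsimp only
      rw [Equiv.apply_symm_apply]
      exact coord_arrow_innerEdge x.2.1 v
    · dsimp only
      simp only [Equiv.apply_symm_apply]
      exact coordS_turn_eq x.2
  right_inv y := by
    refine Prod.ext (funext fun j => ?_) (funext fun l => ?_)
    · dsimp only
      rw [innerEdge_arrow, Equiv.symm_apply_apply]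
    · dsimp only
      rw [extendTurn_free, Equiv.symm_apply_apply]
  continuous_toFun := by
    refine Continuous.prodMk (continuous_pi fun j => ?_) (continuous_pi fun l => ?_)
    · exact (continuous_apply _).comp (continuous_fst.comp continuous_subtype_val)
    · exact (continuous_apply _).comp (continuous_snd.comp continuous_subtype_val)
  continuous_invFun := by
    refine Continuous.subtype_mk (Continuous.prodMk (continuous_pi fun v => ?_)
      (continuous_pi fun v => ?_)) _
    · exact (continuous_apply _).comp continuous_fst
    · exact (continuous_extendTurn v).comp
        (continuous_pi fun w => (continuous_apply _).comp continuous_snd)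

lemma extendTurn_conj (y : FreeArrow S c → OO n) (w : OO n) (v : T.Side) :
    extendTurn (fun a => w * y a * w⁻¹) v = w * extendTurn y v * w⁻¹ := by
  have h : ∀ v, extendOne (fun a => w * y a * w⁻¹) v = w * extendOne y v * w⁻¹ := by
    intro v
    unfold extendOne
    split_ifs
    · rfl
    · group
  unfold extendTurn
  split_ifs
  · rw [h, h]; group
  · exact h v

lemma coordSSetoid_iff (hc : ∀ f, (c f).1 = f) (hcS : ∀ f, c f ∉ S) {J L : Type}
    (i : J ≃ T.InnerEdge) (k : L ≃ FreeArrow S c) (x x' : CoordS T n S) :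
    coordSSetoid T n S x x' ↔ conjSetoid J L n (freeCoordHomeomorph hc hcS i k x)
      (freeCoordHomeomorph hc hcS i k x') := by
  constructor
  · rintro ⟨w, h₁, h₂⟩
    exact ⟨w, fun j => h₁ _, fun l => h₂ _⟩
  · rintro ⟨w, h₁, h₂⟩
    refine ⟨w, fun v => ?_, fun v => ?_⟩
    · have := h₁ (i.symm (innerEdge v))
      change (x'.1.1 (i (i.symm (innerEdge v))).arrow).1
        = w.1 * (x.1.1 (i (i.symm (innerEdge v))).arrow).1 * _ at this
      rwa [Equiv.apply_symm_apply, coord_arrow_innerEdge x.2.1,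
        coord_arrow_innerEdge x'.2.1] at this
    · have h : (fun a : FreeArrow S c => x'.1.2 a.1) = fun a => w * x.1.2 a.1 * w⁻¹ := by
        funext a
        have := h₂ (k.symm a)
        change x'.1.2 (k (k.symm a)).1 = w * x.1.2 (k (k.symm a)).1 * w⁻¹ at this
        rwa [Equiv.apply_symm_apply] at this
      rw [← coordS_turn_eq x'.2, ← coordS_turn_eq x.2, h, extendTurn_conj]

/-- A homeomorphism compatible with equivalence relations induces a homeomorphism of the
quotients. -/
def quotientHomeomorph {A B : Type*} [TopologicalSpace A] [TopologicalSpace B] {s : Setoid A}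
    {t : Setoid B} (e : A ≃ₜ B) (h : ∀ a b, s a b ↔ t (e a) (e b)) :
    _root_.Quotient s ≃ₜ _root_.Quotient t where
  toEquiv := Quotient.congr e.toEquiv h
  continuous_toFun := (continuous_quot_mk.comp e.continuous).quotient_lift _
  continuous_invFun := (continuous_quot_mk.comp e.symm.continuous).quotient_lift _

theorem nonempty_quotient_homeomorph (hS : T.IsSpanningTree S) :
    Nonempty (_root_.Quotient (coordSSetoid T n S) ≃ₜ
      _root_.Quotient (conjSetoid (Fin (-3 * T.eulerChar + T.r).toNat)
        (Fin (-T.eulerChar + 1).toNat) n)) := by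
  choose c hc hcS using hS.exists_notMem
  rw [toNat_card_innerEdge, toNat_card_freeArrow hS hc hcS]
  exact ⟨quotientHomeomorph _ (coordSSetoid_iff hc hcS (Finite.equivFin T.InnerEdge).symm
    (Finite.equivFin (FreeArrow S c)).symm)⟩

end FreeCoord

end

theorem mainTheorem2 (T : IdealTriangulation) (v₀ : T.Side) (n : ℕ)
    (S : Set T.A₃) (hS : T.IsSpanningTree S) :
    -- the holonomy map takes values in the maximal framed twisted local systems
    (∀ z (hz : z ∈ CoordS T n S), (hol z hz.1).IsMaximal v₀) ∧
    -- it is onto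
    (∀ X : FramedLocSys.{u} T n, X.IsMaximal v₀ →
      ∃ z, ∃ hz : z ∈ CoordS T n S, (hol z hz.1).Equivalent X) ∧
    -- its fibres are the orbits of the diagonal conjugation action of `O(n)`
    (∀ z z' (hz : z ∈ CoordS T n S) (hz' : z' ∈ CoordS T n S),
      (hol z hz.1).Equivalent (hol z' hz'.1) ↔
        ∃ w : OO n, (∀ a, (z'.1 a).1 = w.1 * (z.1 a).1 * (w⁻¹ : OO n).1) ∧
          ∀ a, z'.2 a = w * z.2 a * w⁻¹) ∧
    -- it induces a homeomorphism from the quotient to the space of framed maximal representations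
    (∀ E : Untwisting T, ∃ Φ : Quotient (coordSSetoid T n S) ≃ₜ MaxRepF v₀ n,
      ∀ z : CoordS T n S, ∃ h : FramedRep v₀ n,
        IsHolonomyRep E z.1 h ∧ (Φ (Quotient.mk _ z)).1 = Quotient.mk _ h) ∧
    -- the space of framed maximal representations is homeomorphic to
    -- `(Sym⁺(n, ℝ)^(3|χ| + r) × O(n)^(|χ| + 1)) / O(n)`
    Nonempty (Quotient (conjSetoid (Fin (-3 * T.eulerChar + T.r).toNat)
      (Fin (-T.eulerChar + 1).toNat) n) ≃ₜ MaxRepF v₀ n) := by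
  refine ⟨fun z hz => (hol_facesMaximal z hz.1).isMaximal _ v₀, fun X hX => ?_,
    fun z z' hz hz' => hol_equivalent_iff hS.1 v₀ hz hz', fun E => ?_, ?_⟩
  · exact (FramedLocSys.IsMaximal.facesMaximal X hX
      (IdealTriangulation.nonempty_hom_of_connects hS.1 v₀)).exists_hol_equivalent hS v₀
  · obtain ⟨Φ, hΦ⟩ := exists_homeomorph_maxRepF (n := n) E hS v₀
    exact ⟨Φ, fun z => ⟨holRep E z.2.1 v₀, isHolonomyRep_holRep E z.2.1 v₀, by rw [hΦ]; rfl⟩⟩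
  -- The statement no longer involves signs, so any untwisting can be used.
  · obtain ⟨E⟩ := IdealTriangulation.nonempty_untwisting T
    obtain ⟨Φ, -⟩ := exists_homeomorph_maxRepF (n := n) E hS v₀
    obtain ⟨e⟩ := nonempty_quotient_homeomorph (n := n) hS
    exact ⟨e.symm.trans Φ⟩
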